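/- For $i\in\{1,2\}$ let $A_i$ be an invertible real $2\times 2$ matrix, $\mathcal R_i=A_i\mathbb Z^2$, $\Gamma_i=A_i[0,1)^2$, let $\mathcal R_i^*=\{k\in\mathbb R^2: k\cdot x\in\mathbb Z\ \forall x\in\mathcal R_i\}$ be the reciprocal lattice, and put $P_1=2$, $P_2=1$. Two lattices $L_1,L_2\subset\mathbb R^2$ are called incommensurate if, for $v\in\mathbb R^2$, $v+(L_1\cup L_2)=L_1\cup L_2$ holds only for $v=0$. Let $\mathcal A_1,\mathcal A_2$ be disjoint finite sets (orbitals), and for $\alpha,\alpha'\in\mathcal A_1\cup\mathcal A_2$ let $h_{\alpha\alpha'}:\mathbb R^2\to\mathbb C$. For $r>0$ let $B_r$ be the open ball of radius $r$ about $0$ and $\Omega_r=\bigcup_{i}(\mathcal R_i\cap B_r)\times\mathcal A_i$ (disjoint union), and for $j\in\{1,2\}$, $b\in\mathbb R^2$ let $H_{r,j}(b)$ be the matrix $$[H_{r,j}(b)]_{R\alpha,R'\alpha'}=h_{\alpha\alpha'}\bigl(b(\delta_{\alpha\in\mathcal A_{P_j}}-\delta_{\alpha'\in\mathcal A_{P_j}})+R-R'\bigr),\qquad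 R\alpha,R'\alpha'\in\Omega_r .$$ For $g\in C(\mathbb R)$ (complex valued) put $\mathcal D[H_{r,j}(b)](g)=\frac1{|\Omega_r|}\operatorname{Tr}g(H_{r,j}(b))$ and, for $\alpha\in\mathcal A_j$, $\mathcal D_\alpha[H_{r,j}(b)](g)=[g(H_{r,j}(b))]_{0\alpha,0\alpha}$. Let $E[H]=\sup\{\|H_{r,j}(b)\|_2: r>0,\ j\in\{1,2\},\ b\in\Gamma_j\}$, $S[H]=[-E[H],E[H]]$, and let $d(z,S[H])$ be the distance of $z\in\mathbb C$ from $S[H]$. Let $\Lambda$ be the set of $g\in C(\mathbb R)$ that are analytic on $S[H]$, and for $\tilde d>0$ let $\Lambda_{\tilde d}$ be the set of $g\in C(\mathbb R)$ that are analytic (that is, have an analytic continuation, again written $g$) at every $z\in\mathbb C$ with $d(z,S[H])\le\tilde d$. **Theorem.** Assume that all matrices $H_{r,j}(b)$ are Hermitian, that $\mathcal R_1,\mathcal R_2$ are incommensurate and that $\mathcal R_1^*,\mathcal R_2^*$ are incommensurate, and that the $h_{\alpha\alpha'}$ are uniformly continuous with $|h_{\alpha\alpha'}(x)|\le C_0e^{-\tilde\gamma|x|}$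 on $\mathbb R^2$ for some constants $C_0$ and $\tilde\gamma>0$. Then $E[H]<\infty$; for all $j$, $\alpha\in\mathcal A_j$, $b\in\mathbb R^2$ and $g\in C(\mathbb R)$ the limit $\mathcal D_\alpha[H](b,g)=\lim_{r\to\infty}\mathcal D_\alpha[H_{r,j}(b)](g)$ exists and depends only on $g|_{S[H]}$, so that $\mathcal D_\alpha[H](b,\cdot)$ is defined on $C(S[H])$; and $b\mapsto\mathcal D_\alpha[H](b,g)$ (for $g\in C(S[H])$) and $b\mapsto\mathcal D_\alpha[H_{r,j}(b)](g)$ (for $g\in C(\mathbb R)$) are integrable over $\Gamma_{P_j}$. Moreover there is a bounded linear functional $\mathcal D[H]:C(S[H])\to\mathbb C$ such that 1. for $g\in\Lambda$ and $j=1,2$: $\ \mathcal D[H_{r,j}(0)](g)\to\mathcal D[H](g)$ as $r\to\infty$; 2. for $g\in C(S[H])$: $$\mathcal D[H](g)=\nu\sum_{j=1}^2\sum_{\alpha\in\mathcal A_j}\int_{\Gamma_{P_j}}\mathcal D_\alpha[H](b,g)\,db,\qquad \nu=\frac1{|\mathcal A_2|\,|\Gamma_1|+|\mathcal A_1|\,|\Gamma_2|};$$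 3. for every $d_0>0$ there are $C,\gamma>0$ such that for all $\tilde d\in(0,d_0]$, $g\in\Lambda_{\tilde d}$ and $r>0$ $$\Bigl|\mathcal D[H](g)-\nu\sum_{j=1}^2\sum_{\alpha\in\mathcal A_j}\int_{\Gamma_{P_j}}\mathcal D_\alpha[H_{r,j}(b)](g)\,db\Bigr|\le C\tilde d^{-2}\sup_{d(z,S[H])<\tilde d}|g(z)|\,e^{-\gamma\tilde dr}.$$ -/

import Mathlib

open Filter Topology MeasureTheory

universe u

noncomputable section

/-- The plane `ℝ²` with its Euclidean norm. -/
abbrev Plane : Type := EuclideanSpace ℝ (Fin 2)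

/-- Two point sets are incommensurate if no non-zero translation leaves their union invariant. -/
def Incommensurate (L₁ L₂ : Set Plane) : Prop :=
  ∀ v : Plane, (fun x => v + x) '' (L₁ ∪ L₂) = L₁ ∪ L₂ ↔ v = 0

/-- The data of a tight-binding model on a bilayer. The two sheets are indexed by `Fin 2`. Sheet `i`
has the lattice matrix `A i` and the finite orbital set `Orb i`; an element of `Σ i, Orb i`, the
disjoint union of the orbital sets, is an orbital together with the sheet it belongs to.
The hopping functions are `h α α'`. -/
structure Bilayer where
  A : Fin 2 → Matrix (Fin 2) (Fin 2) ℝ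
  det_ne_zero : ∀ i, (A i).det ≠ 0
  Orb : Fin 2 → Type u
  fintypeOrb : ∀ i, Fintype (Orb i)
  h : (Σ i, Orb i) → (Σ i, Orb i) → Plane → ℂ

namespace Bilayer

attribute [instance] Bilayer.fintypeOrb

variable (M : Bilayer.{u})

/-- The transposition `P` of the two sheets. -/
def other (j : Fin 2) : Fin 2 := Equiv.swap 0 1 j

/-- The lattice vector `A_i n`, for `n ∈ ℤ²`. -/
def latticePoint (i : Fin 2) (n : Fin 2 → ℤ) : Plane :=
  WithLp.toLp 2 ((M.A i).mulVec fun k => (n k : ℝ))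

/-- The Bravais lattice of sheet `i`. -/
def lattice (i : Fin 2) : Set Plane := Set.range (M.latticePoint i)

/-- The reciprocal (dual) lattice of sheet `i`: the vectors `k` with `k · x ∈ ℤ` for all lattice
vectors `x`. -/
def reciprocalLattice (i : Fin 2) : Set Plane :=
  {k | ∀ x ∈ M.lattice i, ∃ m : ℤ, inner ℝ k x = (m : ℝ)}

/-- The unit cell `Γ_i = A_i [0,1)²`. -/
def cell (i : Fin 2) : Set Plane :=
  (fun t : Fin 2 → ℝ => (WithLp.toLp 2 ((M.A i).mulVec t) : Plane)) ''
    {t | ∀ k, t k ∈ Set.Ico (0 : ℝ) 1}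

/-- The degrees of freedom `(R, α)`; the lattice site `R = A_i n` is recorded by `n ∈ ℤ²`. -/
abbrev Site : Type u := Σ i : Fin 2, (Fin 2 → ℤ) × M.Orb i

/-- The lattice position `R` of the site `(R, α)`. -/
def position (k : M.Site) : Plane := M.latticePoint k.1 k.2.1

/-- The orbital `α` of the site `(R, α)`. -/
def orbital (k : M.Site) : Σ i, M.Orb i := ⟨k.1, k.2.2⟩

/-- The sites in the open ball of radius `r`. -/
abbrev Cluster (r : ℝ) : Type u := {k : M.Site // ‖M.position k‖ < r}

lemma latticePoint_finite (i : Fin 2) (r : ℝ) : {n | ‖M.latticePoint i n‖ < r}.Finite := by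
  classical
  let L : Plane →L[ℝ] Plane := Matrix.toEuclideanCLM (𝕜 := ℝ) (M.A i)⁻¹
  have hL : ∀ n : Fin 2 → ℤ,
      L (M.latticePoint i n) = WithLp.toLp 2 (fun k => (n k : ℝ)) := by
    intro n
    have hu : IsUnit (M.A i).det := (M.det_ne_zero i).isUnit
    rw [latticePoint, Matrix.toEuclideanCLM_toLp, Matrix.mulVec_mulVec,
      Matrix.nonsing_inv_mul _ hu, Matrix.one_mulVec]
  have hb : ∀ n : Fin 2 → ℤ, ‖M.latticePoint i n‖ < r → ∀ k, |(n k : ℝ)| ≤ ‖L‖ * r := by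
    intro n hn k
    calc |(n k : ℝ)| = ‖(WithLp.toLp 2 (fun k => (n k : ℝ)) : Plane) k‖ := by simp
      _ ≤ ‖(WithLp.toLp 2 (fun k => (n k : ℝ)) : Plane)‖ := PiLp.norm_apply_le _ _
      _ = ‖L (M.latticePoint i n)‖ := by rw [hL]
      _ ≤ ‖L‖ * ‖M.latticePoint i n‖ := L.le_opNorm _
      _ ≤ ‖L‖ * r := by gcongr
  refine (Set.finite_Icc (fun _ : Fin 2 => -⌈‖L‖ * r⌉) (fun _ => ⌈‖L‖ * r⌉)).subset ?_
  intro n hn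
  have h1 : ∀ k, |n k| ≤ ⌈‖L‖ * r⌉ := by
    intro k
    have h2 := (hb n hn k).trans (Int.le_ceil _)
    exact_mod_cast h2
  exact ⟨fun k => (abs_le.mp (h1 k)).1, fun k => (abs_le.mp (h1 k)).2⟩

instance cluster_finite (r : ℝ) : Finite (M.Cluster r) := by
  have hs : {k : M.Site | ‖M.position k‖ < r} ⊆
      ⋃ i : Fin 2, (fun p => (⟨i, p⟩ : M.Site)) ''
        ({n | ‖M.latticePoint i n‖ < r} ×ˢ (Set.univ : Set (M.Orb i))) := by
    rintro ⟨i, n, a⟩ hk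
    exact Set.mem_iUnion.2 ⟨i, (n, a), ⟨hk, trivial⟩, rfl⟩
  exact ((Set.finite_iUnion fun i =>
    ((M.latticePoint_finite i r).prod Set.finite_univ).image _).subset hs).to_subtype

instance clusterFintype (r : ℝ) : Fintype (M.Cluster r) := Fintype.ofFinite _

instance clusterDecidableEq (r : ℝ) : DecidableEq (M.Cluster r) := Classical.decEq _

/-- The indicator that an orbital belongs to sheet `i`. -/
def onSheet (i : Fin 2) (α : Σ i, M.Orb i) : ℝ := if α.1 = i then 1 else 0

/-- The cluster Hamiltonian `H_{r,j}(b)`: the sheet other than `j` is shifted by `b`. -/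
def hamiltonian (j : Fin 2) (r : ℝ) (b : Plane) : Matrix (M.Cluster r) (M.Cluster r) ℂ :=
  fun k l => M.h (M.orbital k) (M.orbital l)
    ((M.onSheet (other j) (M.orbital k) - M.onSheet (other j) (M.orbital l)) • b
      + M.position k - M.position l)

/-- All cluster Hamiltonians are Hermitian matrices. -/
def IsHermitianModel : Prop :=
  ∀ (j : Fin 2) (r : ℝ) (b : Plane), (M.hamiltonian j r b).IsHermitian

/-- The hopping functions are uniformly continuous and decay exponentially. -/
def RegularHopping : Prop :=
  (∀ α α', UniformContinuous (M.h α α')) ∧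
    ∃ C : ℝ, ∃ γ > (0 : ℝ), ∀ α α' x, ‖M.h α α' x‖ ≤ C * Real.exp (-γ * ‖x‖)

/-- The operator norms `‖H_{r,j}(b)‖₂` for `r > 0`, `j` a sheet and `b` in the unit cell `Γ_j`. -/
def hamiltonianNorms : Set ℝ :=
  {x | ∃ r > (0 : ℝ), ∃ j : Fin 2, ∃ b ∈ M.cell j,
    x = ‖Matrix.toEuclideanCLM (𝕜 := ℂ) (M.hamiltonian j r b)‖}

/-- `E[H]`, the supremum of the operator norms of the cluster Hamiltonians. -/
def energyBound : ℝ := sSup M.hamiltonianNorms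

/-- The interval `S[H] = [-E[H], E[H]]`. -/
abbrev energyInterval : Set ℝ := Set.Icc (-M.energyBound) M.energyBound

lemma energyBound_nonneg : 0 ≤ M.energyBound :=
  Real.sSup_nonneg (by rintro x ⟨r, -, j, b, -, rfl⟩; exact norm_nonneg _)

/-- The continuous extension of `f ∈ C(S[H])` to the real line, constant on either side of `S[H]`.
Spectra of the clusters lie in `S[H]`, so that the values off `S[H]` play no role. -/
def extend (f : C(M.energyInterval, ℂ)) : ℝ → ℂ :=
  Set.IccExtend (neg_le_self M.energyBound_nonneg) f

/-- `g(B)` for a Hermitian matrix `B` and a complex-valued function `g` on the real line, through the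
functional calculus applied to the real and the imaginary part of `g`. -/
def matrixFunction {n : Type*} [Fintype n] [DecidableEq n] (B : Matrix n n ℂ) (g : ℝ → ℂ) :
    Matrix n n ℂ :=
  cfc (fun x => (g x).re) B + Complex.I • cfc (fun x => (g x).im) B

/-- The density of states of a finite Hermitian matrix, `g ↦ Tr g(B) / n`. -/
def dos {n : Type*} [Fintype n] [DecidableEq n] (B : Matrix n n ℂ) (g : ℝ → ℂ) : ℂ :=
  (1 / (Fintype.card n : ℂ)) * (matrixFunction B g).trace

/-- The site at the origin of sheet `j` with orbital `α`, in a cluster of radius `r > 0`. -/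
def originSite (j : Fin 2) (α : M.Orb j) {r : ℝ} (hr : 0 < r) : M.Cluster r :=
  ⟨⟨j, 0, α⟩, by
    have h0 : M.position ⟨j, 0, α⟩ = 0 := by
      have h1 : (fun k : Fin 2 => (((0 : Fin 2 → ℤ) k : ℤ) : ℝ)) = 0 := by
        ext k
        simp
      simp only [position, latticePoint]
      rw [h1, Matrix.mulVec_zero, WithLp.toLp_zero]
    simpa [h0] using hr⟩

/-- The local density of states of a cluster at an orbital `α` of sheet `j`: the diagonal entry of
`g(H_{r,j}(b))` at `(0, α)`, for `r > 0`. -/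
def clusterLdos (j : Fin 2) (α : M.Orb j) (r : ℝ) (b : Plane) (g : ℝ → ℂ) : ℂ :=
  if hr : 0 < r then
    matrixFunction (M.hamiltonian j r b) g (M.originSite j α hr) (M.originSite j α hr)
  else 0

/-- The local density of states of the infinite system at the shift `b`, applied to `f ∈ C(S[H])`:
the limit of the local densities of states of the clusters. -/
def ldos (j : Fin 2) (α : M.Orb j) (b : Plane) (f : C(M.energyInterval, ℂ)) : ℂ :=
  limUnder atTop fun r : ℝ => M.clusterLdos j α r b (M.extend f)

/-- The normalisation `ν = 1 / (|𝒜₂| |Γ₁| + |𝒜₁| |Γ₂|)`. -/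
def nu : ℝ :=
  1 / (Fintype.card (M.Orb 1) * volume.real (M.cell 0)
    + Fintype.card (M.Orb 0) * volume.real (M.cell 1))

/-- The class `Λ`: continuous functions on the real line that are analytic on `S[H]`. -/
def analyticClass : Set C(ℝ, ℂ) := {g | AnalyticOnNhd ℝ g M.energyInterval}

/-- The distance of `z ∈ ℂ` from `S[H]`. -/
def distToInterval (z : ℂ) : ℝ :=
  Metric.infDist z ((fun x : ℝ => (x : ℂ)) '' M.energyInterval)

/-- `g ∈ C(ℝ)` belongs to the class `Λ_d`, with analytic continuation `G`: the function `G` is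
analytic at every `z` at distance at most `d` from `S[H]`, and agrees with `g` at the real ones among
these points. -/
def IsAnalyticWithin (d : ℝ) (g : C(ℝ, ℂ)) (G : ℂ → ℂ) : Prop :=
  AnalyticOnNhd ℂ G {z | M.distToInterval z ≤ d} ∧
    ∀ x : ℝ, M.distToInterval (x : ℂ) ≤ d → G (x : ℂ) = g x

/-- The supremum of `|G|` over the points at distance less than `d` from `S[H]`. -/
def supNear (d : ℝ) (G : ℂ → ℂ) : ℝ :=
  sSup ((fun z => ‖G z‖) '' {z | M.distToInterval z < d})

end Bilayer

end

/-! Locality of the resolvent reduces the theorem to the equidistribution of one lattice modulo the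
other.

Locality is a Combes–Thomas argument. Let `z` keep a distance of order `d` from `S[H]`. Since the
hopping decays exponentially, conjugating `H` by `exp (t * dist)` with `t` proportional to `d`
perturbs it by at most half the lower bound for `z - H`, so the columns of the resolvent decay at a
rate of order `d`. Removing the sites at distance at least `s` then changes a diagonal resolvent
entry by at most a constant times `d⁻² * exp (-γ * d * s)`. Cauchy's formula on a rectangle around
`S[H]` transfers this to `g(H)` for analytic `g` (`Matrix.IsHermitian.norm_resolvent_sub_le`,
`Matrix.IsHermitian.norm_matrixFunction_sub_le`, `Bilayer.RegularHopping.exists_truncation`).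
Diagonal entries of `g(H)` are averages of `g` over the spectrum and polynomials are dense, so the
local limits exist for every continuous `g` and are continuous in the shift `b`. Averaging the
truncation estimate over the cells gives the error bound.

Entries of `H` depend only on differences of positions. Translating the two sheets by lattice
vectors therefore exhibits one Hamiltonian as a principal submatrix of another
(`Bilayer.hamiltonian_eq_submatrix`). Hence `E[H]` bounds all shifts, the local density is periodic
under the lattice of the shifted sheet, and a site `R` deep inside the unshifted cluster sees the
infinite system with the other sheet shifted by `-R`.

The trace thus becomes, up to a boundary layer of vanishing proportion, a sum over the points of one
lattice of a continuous function periodic under the other. Incommensurability of the dual lattices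
says that no non-trivial character of the second torus is trivial on the first lattice, and Weyl's
criterion turns the sum into an integral over the cell (`Bilayer.tendsto_average_latticeBall`).
Counting lattice points in discs produces the factor `ν`. -/

noncomputable section

/-! ### Hermitian matrices: spectral weights, norms and decay of resolvents -/

open Matrix in
/-- The diagonal entries of functions of a Hermitian matrix are averages over its eigenvalues, with
weights which do not depend on the function. -/
theorem Matrix.IsHermitian.exists_spectral_weights {n : Type*} [Fintype n] [DecidableEq n]
    {B : Matrix n n ℂ} (hB : B.IsHermitian) (i : n) :
    ∃ p : n → ℝ, (∀ k, 0 ≤ p k) ∧ ∑ k, p k = 1 ∧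
      (∀ g : ℝ → ℂ, Bilayer.matrixFunction B g i i = ∑ k, (p k : ℂ) * g (hB.eigenvalues k)) ∧
      (∀ m : ℕ, (B ^ m) i i = ∑ k, (p k : ℂ) * (hB.eigenvalues k : ℂ) ^ m) ∧
      ∀ z : ℂ, (∀ k, z ≠ hB.eigenvalues k) → ∃ v : n → ℂ,
        z • v - B *ᵥ v = Pi.single i 1 ∧
          v i = ∑ k, (p k : ℂ) * (z - hB.eigenvalues k)⁻¹ := by
  set U : Matrix n n ℂ := (hB.eigenvectorUnitary : Matrix n n ℂ) with hU
  have hUU : U * star U = 1 := Unitary.coe_mul_star_self _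
  have hUU' : star U * U = 1 := Unitary.coe_star_mul_self _
  have hdiag : ∀ d : n → ℂ, (U * diagonal d * star U) i i
      = ∑ k, ((‖U i k‖ ^ 2 : ℝ) : ℂ) * d k := by
    intro d
    rw [mul_apply]
    refine Finset.sum_congr rfl fun k _ => ?_
    rw [mul_diagonal, star_apply, RCLike.star_def, mul_right_comm, RCLike.mul_conj]
    push_cast
    rfl
  have hspec : B = U * diagonal (fun k => (hB.eigenvalues k : ℂ)) * star U := by
    conv_lhs => rw [hB.spectral_theorem]
    rw [Unitary.conjStarAlgAut_apply]
    rfl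
  have hpow : ∀ m : ℕ, B ^ m = U * diagonal (fun k => (hB.eigenvalues k : ℂ) ^ m) * star U := by
    intro m
    induction m with
    | zero => simp [hUU]
    | succ m ih =>
      rw [pow_succ, ih]
      refine (congrArg (_ * ·) hspec).trans ?_
      rw [show ∀ a b c d : Matrix n n ℂ, a * b * star U * (U * c * d)
        = a * (b * (star U * U) * c) * d by intros; simp only [mul_assoc], hUU', mul_one,
        diagonal_mul_diagonal]
      simp only [pow_succ]
  -- The weights are the squared components of the `i`-th basis vector in the eigenbasis; they add
  -- up to one because `U * star U = 1`. The vector in the last clause is column `i` of the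
  -- resolvent.
  refine ⟨fun k => ‖U i k‖ ^ 2, fun k => by positivity, ?_, ?_, ?_, ?_⟩
  · have h1 := hdiag (fun _ => 1)
    rw [diagonal_one, mul_one, hUU, one_apply_eq] at h1
    simp only [mul_one] at h1
    exact_mod_cast h1.symm
  · intro g
    have hcfc : ∀ f : ℝ → ℝ, (cfc f B) i i
        = ∑ k, ((‖U i k‖ ^ 2 : ℝ) : ℂ) * (f (hB.eigenvalues k) : ℂ) := by
      intro f
      rw [hB.cfc_eq, IsHermitian.cfc, Unitary.conjStarAlgAut_apply]
      exact hdiag _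
    rw [Bilayer.matrixFunction, add_apply, smul_apply, hcfc, hcfc, smul_eq_mul, Finset.mul_sum,
      ← Finset.sum_add_distrib]
    refine Finset.sum_congr rfl fun k _ => ?_
    conv_rhs => rw [← Complex.re_add_im (g (hB.eigenvalues k))]
    ring
  · intro m
    rw [hpow, hdiag]
  · intro z hz
    refine ⟨(U * diagonal (fun k => (z - hB.eigenvalues k)⁻¹) * star U).col i, ?_, hdiag _⟩
    have h1 : z • (1 : Matrix n n ℂ) - B
        = U * diagonal (fun k => z - (hB.eigenvalues k : ℂ)) * star U := by
      conv_lhs => rw [hspec, ← hUU]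
      rw [← diagonal_sub, mul_sub, sub_mul, ← smul_one_eq_diagonal]
      simp
    have h2 : (z • (1 : Matrix n n ℂ) - B) * (U * diagonal (fun k => (z - hB.eigenvalues k)⁻¹)
        * star U) = 1 := by
      rw [h1, show ∀ a b c d : Matrix n n ℂ, a * b * star U * (U * c * d)
        = a * (b * (star U * U) * c) * d by intros; simp only [mul_assoc], hUU', mul_one,
        diagonal_mul_diagonal]
      have h3 : (fun k => (z - (hB.eigenvalues k : ℂ)) * (z - (hB.eigenvalues k : ℂ))⁻¹)
          = fun _ => 1 := by
        funext k
        exact mul_inv_cancel₀ (sub_ne_zero.2 (hz k))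
      rw [h3, diagonal_one, mul_one, hUU]
    have h3 : ∀ v : n → ℂ, z • v - B *ᵥ v = (z • (1 : Matrix n n ℂ) - B) *ᵥ v := by
      intro v
      rw [sub_mulVec, smul_mulVec, one_mulVec]
    rw [h3, ← mulVec_single_one, mulVec_mulVec, h2, one_mulVec]

open Matrix in
theorem Matrix.IsHermitian.abs_eigenvalues_le {n : Type*} [Fintype n] [DecidableEq n]
    {B : Matrix n n ℂ} (hB : B.IsHermitian) (k : n) :
    |hB.eigenvalues k| ≤ ‖toEuclideanCLM (𝕜 := ℂ) B‖ := by
  have h1 : toEuclideanCLM (𝕜 := ℂ) B (hB.eigenvectorBasis k)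
      = (hB.eigenvalues k : ℝ) • hB.eigenvectorBasis k := by
    apply (WithLp.ofLp_injective 2)
    rw [ofLp_toEuclideanCLM, hB.mulVec_eigenvectorBasis]
    rfl
  have h2 := (toEuclideanCLM (𝕜 := ℂ) B).le_opNorm (hB.eigenvectorBasis k)
  rw [h1, norm_smul, (hB.eigenvectorBasis).norm_eq_one, mul_one, mul_one] at h2
  exact h2

open Matrix in
/-- Schur's test. -/
theorem Matrix.norm_toEuclideanCLM_le_of_sum_le {n : Type*} [Fintype n] [DecidableEq n]
    (B : Matrix n n ℂ) {K : ℝ} (hK : 0 ≤ K) (hrow : ∀ i, ∑ j, ‖B i j‖ ≤ K)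
    (hcol : ∀ j, ∑ i, ‖B i j‖ ≤ K) : ‖toEuclideanCLM (𝕜 := ℂ) B‖ ≤ K := by
  refine ContinuousLinearMap.opNorm_le_bound _ hK fun x => ?_
  refine le_of_sq_le_sq ?_ (by positivity)
  rw [mul_pow, EuclideanSpace.norm_sq_eq, EuclideanSpace.norm_sq_eq]
  have h1 : ∀ i, ‖(toEuclideanCLM (𝕜 := ℂ) B x) i‖ ^ 2 ≤ K * ∑ j, ‖B i j‖ * ‖x j‖ ^ 2 := by
    intro i
    have h2 : ‖(toEuclideanCLM (𝕜 := ℂ) B x) i‖ ≤ ∑ j, ‖B i j‖ * ‖x j‖ := by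
      rw [show (toEuclideanCLM (𝕜 := ℂ) B x) i = ∑ j, B i j * x j from rfl]
      refine (norm_sum_le _ _).trans (le_of_eq ?_)
      simp
    -- Cauchy–Schwarz with `‖B i j‖` split evenly between the two factors, so that a row sum comes
    -- out. The column sums enter when the order of summation is exchanged below.
    have h3 : (∑ j, ‖B i j‖ * ‖x j‖) ^ 2 ≤ (∑ j, ‖B i j‖) * ∑ j, ‖B i j‖ * ‖x j‖ ^ 2 := by
      refine Finset.sum_sq_le_sum_mul_sum_of_sq_le_mul _ (fun _ _ => norm_nonneg _)
        (fun _ _ => by positivity) fun j _ => le_of_eq (by ring)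
    calc _ ≤ (∑ j, ‖B i j‖ * ‖x j‖) ^ 2 := by gcongr
      _ ≤ _ := h3
      _ ≤ _ := by
        gcongr
        exact hrow i
  calc _ ≤ ∑ i, K * ∑ j, ‖B i j‖ * ‖x j‖ ^ 2 := Finset.sum_le_sum fun i _ => h1 i
    _ = K * ∑ j, (∑ i, ‖B i j‖) * ‖x j‖ ^ 2 := by
      rw [← Finset.mul_sum, Finset.sum_comm]
      simp only [Finset.sum_mul]
    _ ≤ K * ∑ j, K * ‖x j‖ ^ 2 := by
      gcongr with j
      exact hcol j
    _ = _ := by rw [← Finset.mul_sum]; ring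

theorem EuclideanSpace.norm_comp_le {X Y : Type*} [Fintype X] [Fintype Y] (φ : Y ↪ X)
    (v : X → ℂ) :
    ‖(WithLp.toLp 2 (v ∘ φ) : EuclideanSpace ℂ Y)‖ ≤ ‖(WithLp.toLp 2 v : EuclideanSpace ℂ X)‖ := by
  refine le_of_sq_le_sq ?_ (norm_nonneg _)
  rw [EuclideanSpace.norm_sq_eq, EuclideanSpace.norm_sq_eq]
  calc _ = ∑ x ∈ Finset.univ.map φ, ‖v x‖ ^ 2 := by simp
    _ ≤ _ := Finset.sum_le_sum_of_subset_of_nonneg (Finset.subset_univ _) fun _ _ _ => by positivity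

/-- The general summand `F` serves both the norm of a vector extended by zero and the entries of a
matrix applied to it. -/
theorem Function.Embedding.sum_extend_zero {X Y β : Type*} [Fintype X] [Fintype Y]
    [AddCommMonoid β] (φ : Y ↪ X) (v : Y → ℂ) (F : X → ℂ → β) (hF : ∀ x, F x 0 = 0) :
    ∑ x, F x (Function.extend φ v 0 x) = ∑ y, F (φ y) (v y) := by
  symm
  refine Fintype.sum_of_injective φ φ.injective _ _ (fun x hx => ?_) fun y => ?_
  · rw [Function.extend_apply' _ _ _ (by simpa using hx)]
    exact hF x
  · rw [φ.injective.extend_apply]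

-- A principal submatrix is a compression: extend by zero, which is isometric, apply `B`, and
-- restrict, which does not increase the norm.
open Matrix in
theorem Matrix.norm_toEuclideanCLM_submatrix_le {X Y : Type*} [Fintype X] [DecidableEq X]
    [Fintype Y] [DecidableEq Y] (B : Matrix X X ℂ) (φ : Y ↪ X) :
    ‖toEuclideanCLM (𝕜 := ℂ) (B.submatrix φ φ)‖ ≤ ‖toEuclideanCLM (𝕜 := ℂ) B‖ := by
  refine ContinuousLinearMap.opNorm_le_bound _ (norm_nonneg _) fun x => ?_
  set e : EuclideanSpace ℂ X := WithLp.toLp 2 (Function.extend φ (WithLp.ofLp x) 0) with he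
  have h1 : ‖e‖ = ‖x‖ := by
    rw [EuclideanSpace.norm_eq, EuclideanSpace.norm_eq]
    congr 1
    exact φ.sum_extend_zero (WithLp.ofLp x) (fun _ c => ‖c‖ ^ 2) (by simp)
  have h2 : toEuclideanCLM (𝕜 := ℂ) (B.submatrix φ φ) x
      = WithLp.toLp 2 ((WithLp.ofLp (toEuclideanCLM (𝕜 := ℂ) B e)) ∘ φ) := by
    ext y
    exact (φ.sum_extend_zero (WithLp.ofLp x) (fun x' c => B (φ y) x' * c) (by simp)).symm
  rw [h2, ← h1]
  exact (EuclideanSpace.norm_comp_le φ _).trans ((toEuclideanCLM (𝕜 := ℂ) B).le_opNorm e)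

-- The form `⟪x, B x⟫` is real and at most `E * ‖x‖ ^ 2` in absolute value. The imaginary part of
-- `⟪x, (z - B) x⟫` in the first case, or its real part in the second, is then at least `δ * ‖x‖ ^
-- 2` in absolute value, and Cauchy–Schwarz concludes.
open Matrix in
theorem Matrix.IsHermitian.mul_norm_le_norm_smul_sub {n : Type*} [Fintype n] [DecidableEq n]
    {B : Matrix n n ℂ} (hB : B.IsHermitian) {E δ : ℝ} (hE : ‖toEuclideanCLM (𝕜 := ℂ) B‖ ≤ E)
    {z : ℂ} (hz : δ ≤ |z.im| ∨ E + δ ≤ |z.re|) (x : EuclideanSpace ℂ n) :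
    δ * ‖x‖ ≤ ‖z • x - toEuclideanCLM (𝕜 := ℂ) B x‖ := by
  set T := toEuclideanCLM (𝕜 := ℂ) B with hT
  rcases eq_or_ne x 0 with rfl | hx
  · simp
  have hx0 : 0 < ‖x‖ := norm_pos_iff.2 hx
  have hsa : IsSelfAdjoint T := by
    have h : IsSelfAdjoint B := hB
    exact h.map (toEuclideanCLM (𝕜 := ℂ) (n := n))
  have him : (inner ℂ x (T x)).im = 0 := by
    have h1 := hsa.isSymmetric x x
    have h2 : (starRingEnd ℂ) (inner ℂ x (T x)) = inner ℂ x (T x) := by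
      rw [inner_conj_symm]
      exact h1
    exact Complex.conj_eq_iff_im.1 h2
  have hre : |(inner ℂ x (T x)).re| ≤ E * ‖x‖ ^ 2 := by
    refine (Complex.abs_re_le_norm _).trans ((norm_inner_le_norm _ _).trans ?_)
    have h3 := (T.le_opNorm x).trans (mul_le_mul_of_nonneg_right hE hx0.le)
    nlinarith
  have hinner : inner ℂ x (z • x - T x) = z * ((‖x‖ ^ 2 : ℝ) : ℂ) - inner ℂ x (T x) := by
    rw [inner_sub_right, inner_smul_right, inner_self_eq_norm_sq_to_K]
    push_cast
    rfl
  have hle : ‖inner ℂ x (z • x - T x)‖ ≤ ‖x‖ * ‖z • x - T x‖ := norm_inner_le_norm _ _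
  suffices h : δ * ‖x‖ ^ 2 ≤ ‖inner ℂ x (z • x - T x)‖ by
    have h4 := h.trans hle
    rw [sq, ← mul_assoc, mul_comm] at h4
    exact le_of_mul_le_mul_left h4 hx0
  rcases hz with hz | hz
  · refine le_trans ?_ (Complex.abs_im_le_norm _)
    rw [hinner, Complex.sub_im, him, sub_zero, Complex.im_mul_ofReal, abs_mul,
      abs_of_nonneg (sq_nonneg ‖x‖)]
    gcongr
  · refine le_trans ?_ (Complex.abs_re_le_norm _)
    rw [hinner, Complex.sub_re, Complex.re_mul_ofReal]
    have h5 : |z.re * ‖x‖ ^ 2| - |(inner ℂ x (T x)).re|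
        ≤ |z.re * ‖x‖ ^ 2 - (inner ℂ x (T x)).re| := abs_sub_abs_le_abs_sub _ _
    rw [abs_mul, abs_of_nonneg (sq_nonneg ‖x‖)] at h5
    nlinarith [sq_nonneg ‖x‖, mul_le_mul_of_nonneg_right hz (sq_nonneg ‖x‖)]

open Matrix in
/-- Resolvents of a Hermitian matrix and of a principal submatrix differ by an exponentially small
amount at sites which are far from the removed indices. -/
theorem Matrix.IsHermitian.norm_resolvent_sub_le {X Y : Type*} [Fintype X] [DecidableEq X]
    [Fintype Y] [DecidableEq Y] {B : Matrix X X ℂ} (hB : B.IsHermitian) (φ : Y ↪ X) {E δ s t : ℝ}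
    (hE : ‖toEuclideanCLM (𝕜 := ℂ) B‖ ≤ E) (hδ : 0 < δ) (ht : 0 ≤ t) {z : ℂ}
    (hz : δ ≤ |z.im| ∨ E + δ ≤ |z.re|) {w : X → ℝ} {y₀ : Y} (hw : w (φ y₀) = 0)
    (hs : ∀ x ∉ Set.range φ, s ≤ w x)
    (hconj : ‖toEuclideanCLM (𝕜 := ℂ)
      (of fun k l => B k l * ((Real.exp (t * (w k - w l)) - 1 : ℝ) : ℂ))‖ ≤ δ / 2)
    {v : X → ℂ} (hv : z • v - B *ᵥ v = Pi.single (φ y₀) 1)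
    {u : Y → ℂ} (hu : z • u - B.submatrix φ φ *ᵥ u = Pi.single y₀ 1) :
    ‖v (φ y₀) - u y₀‖ ≤ 2 * E / δ ^ 2 * Real.exp (-t * s) := by
  have hE0 : 0 ≤ E := (norm_nonneg _).trans hE
  set C : Matrix X X ℂ := of fun k l => B k l * ((Real.exp (t * (w k - w l)) - 1 : ℝ) : ℂ) with hC
  -- Combes–Thomas: the weighted resolvent column solves the same equation with `B` replaced by its
  -- conjugate `B + C`. The source is unchanged because the weight is one at `φ y₀`.
  set x : X → ℂ := fun k => (Real.exp (t * w k) : ℂ) * v k with hx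
  have hBx : B *ᵥ x + C *ᵥ x = fun k => (Real.exp (t * w k) : ℂ) * (B *ᵥ v) k := by
    funext k
    simp only [Pi.add_apply, mulVec, dotProduct, ← Finset.sum_add_distrib, Finset.mul_sum]
    refine Finset.sum_congr rfl fun l _ => ?_
    have h1 : Real.exp (t * (w k - w l)) * Real.exp (t * w l) = Real.exp (t * w k) := by
      rw [← Real.exp_add]
      ring_nf
    have h2 : ((Real.exp (t * (w k - w l)) : ℝ) : ℂ) * (Real.exp (t * w l) : ℝ)
        = (Real.exp (t * w k) : ℝ) := by exact_mod_cast h1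
    simp only [hC, of_apply, hx]
    rw [← h2]
    push_cast
    ring
  have hxeq : z • x - B *ᵥ x = Pi.single (φ y₀) 1 + C *ᵥ x := by
    have h1 : z • x - (B *ᵥ x + C *ᵥ x) = Pi.single (φ y₀) 1 := by
      rw [hBx]
      funext k
      have h2 := congrFun hv k
      simp only [Pi.sub_apply, Pi.smul_apply, smul_eq_mul] at h2
      simp only [Pi.sub_apply, Pi.smul_apply, smul_eq_mul, hx]
      rw [show z * ((Real.exp (t * w k) : ℂ) * v k) - (Real.exp (t * w k) : ℂ) * (B *ᵥ v) k
        = (Real.exp (t * w k) : ℂ) * (z * v k - (B *ᵥ v) k) by ring, h2]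
      by_cases hk : k = φ y₀
      · subst hk
        simp [hw]
      · simp [hk]
    rw [← h1]
    abel
  -- The lower bound `δ * ‖x‖` absorbs the perturbation `δ / 2 * ‖x‖`, which leaves `‖x‖ ≤ 2 / δ`.
  have hxn : ‖(WithLp.toLp 2 x : EuclideanSpace ℂ X)‖ ≤ 2 / δ := by
    have h1 := hB.mul_norm_le_norm_smul_sub hE hz (WithLp.toLp 2 x)
    rw [toEuclideanCLM_toLp, ← WithLp.toLp_smul, ← WithLp.toLp_sub, hxeq, WithLp.toLp_add,
      ← toEuclideanCLM_toLp] at h1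
    have h2 : ‖(WithLp.toLp 2 (Pi.single (φ y₀) 1) : EuclideanSpace ℂ X)‖ ≤ 1 := by
      simp
    have h3 := (ContinuousLinearMap.le_opNorm (toEuclideanCLM (𝕜 := ℂ) C)
      (WithLp.toLp 2 x)).trans (mul_le_mul_of_nonneg_right hconj (norm_nonneg _))
    have h4 := h1.trans ((norm_add_le _ _).trans (add_le_add h2 h3))
    rw [le_div_iff₀ hδ]
    linarith
  classical
  -- The part of `v` on the removed indices. The weight there is at least `exp (t * s)`, so the
  -- bound on `x` makes this part exponentially small.
  set q : X → ℂ := fun k => if k ∈ Set.range φ then 0 else v k with hq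
  have hqn : ‖(WithLp.toLp 2 q : EuclideanSpace ℂ X)‖ ≤ Real.exp (-t * s) * (2 / δ) := by
    refine le_trans ?_ (mul_le_mul_of_nonneg_left hxn (Real.exp_nonneg _))
    refine le_of_sq_le_sq ?_ (by positivity)
    rw [mul_pow, EuclideanSpace.norm_sq_eq, EuclideanSpace.norm_sq_eq, Finset.mul_sum]
    refine Finset.sum_le_sum fun k _ => ?_
    rw [← mul_pow]
    refine pow_le_pow_left₀ (norm_nonneg _) ?_ 2
    by_cases hk : k ∈ Set.range φ
    · simp only [hq, hk, if_true, norm_zero]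
      positivity
    · simp only [hq, hk, if_false, hx, norm_mul, Complex.norm_real, Real.norm_eq_abs, Real.abs_exp]
      rw [← mul_assoc, ← Real.exp_add]
      refine le_mul_of_one_le_left (norm_nonneg _) (Real.one_le_exp ?_)
      nlinarith [hs k hk]
  set d : Y → ℂ := v ∘ φ - u with hd
  -- Restricted to the kept indices, the equation for `v` is the one for `u` with the coupling to
  -- the removed indices as an additional source.
  have hdeq : z • d - B.submatrix φ φ *ᵥ d = (B *ᵥ q) ∘ φ := by
    have h1 : B.submatrix φ φ *ᵥ (v ∘ φ) + (B *ᵥ q) ∘ φ = (B *ᵥ v) ∘ φ := by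
      funext y
      have h2 : (B.submatrix φ φ *ᵥ (v ∘ φ)) y
          = ∑ l, B (φ y) l * (if l ∈ Set.range φ then v l else 0) := by
        refine Fintype.sum_of_injective φ φ.injective _ _ (fun l hl => ?_) fun y' => ?_
        · simp only [hl, if_false, mul_zero]
        · simp
      rw [Pi.add_apply, h2]
      simp only [Function.comp_apply, mulVec, dotProduct, hq]
      rw [← Finset.sum_add_distrib]
      refine Finset.sum_congr rfl fun l _ => ?_
      split_ifs <;> simp
    have h3 : (z • v - B *ᵥ v) ∘ φ = Pi.single y₀ 1 := by
      rw [hv]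
      funext y
      by_cases hy : y = y₀
      · subst hy
        simp
      · simp [hy]
    rw [hd, mulVec_sub, smul_sub]
    have h4 : (z • v - B *ᵥ v) ∘ φ = z • (v ∘ φ) - (B *ᵥ v) ∘ φ := rfl
    rw [h4, ← h1, ← hu] at h3
    linear_combination (norm := abel) h3
  have hdn : δ * ‖(WithLp.toLp 2 d : EuclideanSpace ℂ Y)‖ ≤ E * (Real.exp (-t * s) * (2 / δ)) := by
    have h1 := (hB.submatrix φ).mul_norm_le_norm_smul_sub
      ((norm_toEuclideanCLM_submatrix_le B φ).trans hE) hz (WithLp.toLp 2 d)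
    rw [toEuclideanCLM_toLp, ← WithLp.toLp_smul, ← WithLp.toLp_sub, hdeq] at h1
    refine h1.trans ((EuclideanSpace.norm_comp_le φ _).trans ?_)
    rw [← toEuclideanCLM_toLp]
    exact (ContinuousLinearMap.le_opNorm _ _).trans (mul_le_mul hE hqn (norm_nonneg _) hE0)
  have h1 : ‖v (φ y₀) - u y₀‖ ≤ ‖(WithLp.toLp 2 d : EuclideanSpace ℂ Y)‖ :=
    PiLp.norm_apply_le (WithLp.toLp 2 d : EuclideanSpace ℂ Y) y₀
  refine h1.trans ?_
  rw [← mul_le_mul_iff_right₀ hδ]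
  refine hdn.trans (le_of_eq ?_)
  field_simp

/-! ### Cauchy's formula on rectangles -/

/-- The integral of `f` along the boundary of the rectangle `[-L, L] × [-δ, δ]`, counterclockwise. -/
def rectangleIntegral (L δ : ℝ) (f : ℂ → ℂ) : ℂ :=
  (∫ x : ℝ in -L..L, f (x + (-δ : ℝ) * Complex.I)) - (∫ x : ℝ in -L..L, f (x + δ * Complex.I)) +
    Complex.I • (∫ y : ℝ in -δ..δ, f (L + y * Complex.I)) -
    Complex.I • (∫ y : ℝ in -δ..δ, f ((-L : ℝ) + y * Complex.I))

/-- The boundary of the rectangle `[-L, L] × [-δ, δ]`. -/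
def rectangleBoundary (L δ : ℝ) : Set ℂ :=
  {z | |z.re| ≤ L ∧ |z.im| ≤ δ ∧ (|z.re| = L ∨ |z.im| = δ)}

section rectangle

variable {L δ : ℝ}

theorem mem_rectangleBoundary_horizontal {x y : ℝ} (hδ : 0 ≤ δ) (hy : y = δ ∨ y = -δ)
    (hx : x ∈ Set.Icc (-L) L) : (x + y * Complex.I : ℂ) ∈ rectangleBoundary L δ := by
  have h : |y| = δ := by
    rcases hy with rfl | rfl
    · exact abs_of_nonneg hδ
    · rw [abs_neg, abs_of_nonneg hδ]
  simp [rectangleBoundary, h, abs_le.2 hx]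

theorem mem_rectangleBoundary_vertical {x y : ℝ} (hL : 0 ≤ L) (hx : x = L ∨ x = -L)
    (hy : y ∈ Set.Icc (-δ) δ) : (x + y * Complex.I : ℂ) ∈ rectangleBoundary L δ := by
  have h : |x| = L := by
    rcases hx with rfl | rfl
    · exact abs_of_nonneg hL
    · rw [abs_neg, abs_of_nonneg hL]
  simp [rectangleBoundary, h, abs_le.2 hy]

theorem intervalIntegrable_horizontal (hL : 0 ≤ L) (hδ : 0 ≤ δ) {f : ℂ → ℂ}
    (hf : ContinuousOn f (rectangleBoundary L δ)) {y : ℝ} (hy : y = δ ∨ y = -δ) :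
    IntervalIntegrable (fun x : ℝ => f (x + y * Complex.I)) volume (-L) L := by
  refine ContinuousOn.intervalIntegrable ?_
  rw [Set.uIcc_of_le (by linarith)]
  exact hf.comp (by fun_prop) fun x hx => mem_rectangleBoundary_horizontal hδ hy hx

theorem intervalIntegrable_vertical (hL : 0 ≤ L) (hδ : 0 ≤ δ) {f : ℂ → ℂ}
    (hf : ContinuousOn f (rectangleBoundary L δ)) {x : ℝ} (hx : x = L ∨ x = -L) :
    IntervalIntegrable (fun y : ℝ => f (x + y * Complex.I)) volume (-δ) δ := by
  refine ContinuousOn.intervalIntegrable ?_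
  rw [Set.uIcc_of_le (by linarith)]
  exact hf.comp (by fun_prop) fun x' hx' => mem_rectangleBoundary_vertical hL hx hx'

theorem norm_rectangleIntegral_le (hL : 0 ≤ L) (hδ : 0 ≤ δ) {f : ℂ → ℂ} {C : ℝ}
    (hf : ∀ z ∈ rectangleBoundary L δ, ‖f z‖ ≤ C) :
    ‖rectangleIntegral L δ f‖ ≤ C * (4 * L + 4 * δ) := by
  have hh : ∀ y : ℝ, (y = δ ∨ y = -δ) →
      ‖∫ x : ℝ in -L..L, f (x + y * Complex.I)‖ ≤ C * (2 * L) := by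
    intro y hy
    refine (intervalIntegral.norm_integral_le_of_norm_le_const (C := C) fun x hx => ?_).trans
      (le_of_eq ?_)
    · rw [Set.uIoc_of_le (by linarith)] at hx
      exact hf _ (mem_rectangleBoundary_horizontal hδ hy ⟨hx.1.le, hx.2⟩)
    · rw [abs_of_nonneg (by linarith)]
      ring
  have hv : ∀ x : ℝ, (x = L ∨ x = -L) →
      ‖Complex.I • ∫ y : ℝ in -δ..δ, f (x + y * Complex.I)‖ ≤ C * (2 * δ) := by
    intro x hx
    rw [norm_smul, Complex.norm_I, one_mul]
    refine (intervalIntegral.norm_integral_le_of_norm_le_const (C := C) fun y hy => ?_).trans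
      (le_of_eq ?_)
    · rw [Set.uIoc_of_le (by linarith)] at hy
      exact hf _ (mem_rectangleBoundary_vertical hL hx ⟨hy.1.le, hy.2⟩)
    · rw [abs_of_nonneg (by linarith)]
      ring
  refine (norm_sub_le _ _).trans ?_
  have h1 := norm_add_le ((∫ x : ℝ in -L..L, f (x + (-δ : ℝ) * Complex.I))
    - (∫ x : ℝ in -L..L, f (x + δ * Complex.I)))
    (Complex.I • (∫ y : ℝ in -δ..δ, f (L + y * Complex.I)))
  have h2 := norm_sub_le (∫ x : ℝ in -L..L, f (x + (-δ : ℝ) * Complex.I))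
    (∫ x : ℝ in -L..L, f (x + δ * Complex.I))
  linarith [hh δ (Or.inl rfl), hh (-δ) (Or.inr rfl), hv L (Or.inl rfl), hv (-L) (Or.inr rfl)]

theorem rectangleIntegral_congr (hL : 0 ≤ L) (hδ : 0 ≤ δ) {f g : ℂ → ℂ}
    (h : ∀ z ∈ rectangleBoundary L δ, f z = g z) :
    rectangleIntegral L δ f = rectangleIntegral L δ g := by
  have hh : ∀ y : ℝ, (y = δ ∨ y = -δ) → ∫ x : ℝ in -L..L, f (x + y * Complex.I)
      = ∫ x : ℝ in -L..L, g (x + y * Complex.I) := by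
    intro y hy
    refine intervalIntegral.integral_congr fun x hx => ?_
    rw [Set.uIcc_of_le (by linarith)] at hx
    exact h _ (mem_rectangleBoundary_horizontal hδ hy hx)
  have hv : ∀ x : ℝ, (x = L ∨ x = -L) → ∫ y : ℝ in -δ..δ, f (x + y * Complex.I)
      = ∫ y : ℝ in -δ..δ, g (x + y * Complex.I) := by
    intro x hx
    refine intervalIntegral.integral_congr fun y hy => ?_
    rw [Set.uIcc_of_le (by linarith)] at hy
    exact h _ (mem_rectangleBoundary_vertical hL hx hy)
  rw [rectangleIntegral, rectangleIntegral, hh δ (Or.inl rfl), hh (-δ) (Or.inr rfl),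
    hv L (Or.inl rfl), hv (-L) (Or.inr rfl)]

theorem rectangleIntegral_sum (hL : 0 ≤ L) (hδ : 0 ≤ δ) {ι : Type*} (s : Finset ι) (c : ι → ℂ)
    (f : ι → ℂ → ℂ) (hf : ∀ i ∈ s, ContinuousOn (f i) (rectangleBoundary L δ)) :
    rectangleIntegral L δ (fun z => ∑ i ∈ s, c i * f i z)
      = ∑ i ∈ s, c i * rectangleIntegral L δ (f i) := by
  have hh : ∀ y : ℝ, (y = δ ∨ y = -δ) → ∫ x : ℝ in -L..L, ∑ i ∈ s, c i * f i (x + y * Complex.I)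
      = ∑ i ∈ s, c i * ∫ x : ℝ in -L..L, f i (x + y * Complex.I) := by
    intro y hy
    rw [intervalIntegral.integral_finsetSum fun i hi =>
      (intervalIntegrable_horizontal hL hδ (hf i hi) hy).const_mul _]
    simp only [intervalIntegral.integral_const_mul]
  have hv : ∀ x : ℝ, (x = L ∨ x = -L) → ∫ y : ℝ in -δ..δ, ∑ i ∈ s, c i * f i (x + y * Complex.I)
      = ∑ i ∈ s, c i * ∫ y : ℝ in -δ..δ, f i (x + y * Complex.I) := by
    intro x hx
    rw [intervalIntegral.integral_finsetSum fun i hi =>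
      (intervalIntegrable_vertical hL hδ (hf i hi) hx).const_mul _]
    simp only [intervalIntegral.integral_const_mul]
  rw [rectangleIntegral, hh δ (Or.inl rfl), hh (-δ) (Or.inr rfl),
    hv L (Or.inl rfl), hv (-L) (Or.inr rfl)]
  simp only [rectangleIntegral, smul_eq_mul, Finset.mul_sum, ← Finset.sum_add_distrib,
    ← Finset.sum_sub_distrib]
  exact Finset.sum_congr rfl fun i _ => by ring

theorem rectangleBoundary_sub_ne_zero {l : ℝ} (hδ : 0 < δ) (hl : |l| < L) {z : ℂ}
    (hz : z ∈ rectangleBoundary L δ) : z - l ≠ 0 := by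
  intro h
  rw [sub_eq_zero] at h
  subst h
  rcases hz.2.2 with h | h
  · exact hl.ne h
  · simp at h
    exact hδ.ne h

/-- The principal logarithm of `z - l` is a primitive on the bottom, right and top sides. The left
side crosses its cut, so there the primitive is the logarithm of `-(z - l)`. The two branches differ
by `π * I` with opposite signs at the two left corners, which produces the value `2 * π * I`. -/
theorem rectangleIntegral_inv {l : ℝ} (hδ : 0 < δ) (hl : |l| < L) :
    rectangleIntegral L δ (fun z => (z - l)⁻¹) = 2 * Real.pi * Complex.I := by
  have hL : 0 < L := (abs_nonneg l).trans_lt hl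
  obtain ⟨hl1, hl2⟩ := abs_lt.1 hl
  have hcont : ContinuousOn (fun z : ℂ => (z - l)⁻¹) (rectangleBoundary L δ) :=
    (continuousOn_id.sub continuousOn_const).inv₀ fun z hz => rectangleBoundary_sub_ne_zero hδ hl hz
  have hh : ∀ y : ℝ, (y = δ ∨ y = -δ) → ∫ x : ℝ in -L..L, ((x + y * Complex.I : ℂ) - l)⁻¹
      = Complex.log (L + y * Complex.I - l) - Complex.log ((-L : ℝ) + y * Complex.I - l) := by
    intro y hy
    refine intervalIntegral.integral_eq_sub_of_hasDerivAt
      (f := fun x : ℝ => Complex.log (x + y * Complex.I - l)) (fun x _ => ?_)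
      (intervalIntegrable_horizontal hL.le hδ.le hcont hy)
    have h1 : HasDerivAt (fun x : ℝ => (x + y * Complex.I - l : ℂ)) 1 x :=
      ((Complex.ofRealCLM.hasDerivAt (x := x)).add_const _).sub_const _
    have h2 := h1.clog_real (by
      right
      rcases hy with rfl | rfl <;> simp [hδ.ne'])
    simpa using h2
  have hright : Complex.I • ∫ y : ℝ in -δ..δ, ((L + y * Complex.I : ℂ) - l)⁻¹
      = Complex.log (L + δ * Complex.I - l) - Complex.log (L + (-δ : ℝ) * Complex.I - l) := by
    rw [← intervalIntegral.integral_smul]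
    refine intervalIntegral.integral_eq_sub_of_hasDerivAt
      (f := fun y : ℝ => Complex.log (L + y * Complex.I - l)) (fun y _ => ?_)
      ((intervalIntegrable_vertical hL.le hδ.le hcont (Or.inl rfl)).const_mul _)
    have h1 : HasDerivAt (fun y : ℝ => (L + y * Complex.I - l : ℂ)) (1 * Complex.I) y :=
      (((Complex.ofRealCLM.hasDerivAt (x := y)).mul_const _).const_add _).sub_const _
    have h2 := h1.clog_real (by
      left
      simp [hl2])
    simpa [div_eq_mul_inv] using h2
  have hleft : Complex.I • ∫ y : ℝ in -δ..δ, (((-L : ℝ) + y * Complex.I : ℂ) - l)⁻¹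
      = Complex.log (-((-L : ℝ) + δ * Complex.I - l))
        - Complex.log (-((-L : ℝ) + (-δ : ℝ) * Complex.I - l)) := by
    rw [← intervalIntegral.integral_smul]
    refine intervalIntegral.integral_eq_sub_of_hasDerivAt
      (f := fun y : ℝ => Complex.log (-((-L : ℝ) + y * Complex.I - l))) (fun y _ => ?_)
      ((intervalIntegrable_vertical hL.le hδ.le hcont (Or.inr rfl)).const_mul _)
    have h1 : HasDerivAt (fun y : ℝ => (-((-L : ℝ) + y * Complex.I - l) : ℂ)) (-(1 * Complex.I)) y :=
      ((((Complex.ofRealCLM.hasDerivAt (x := y)).mul_const _).const_add _).sub_const _).neg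
    have h2 := h1.clog_real (by
      left
      simp
      linarith)
    rw [neg_div_neg_eq, one_mul, div_eq_mul_inv] at h2
    exact h2
  have hneg1 : ∀ w : ℂ, 0 < w.im → Complex.log (-w) = Complex.log w - Real.pi * Complex.I := by
    intro w hw
    rw [Complex.log, Complex.log, Complex.arg_neg_eq_arg_sub_pi_of_im_pos hw, norm_neg]
    push_cast
    ring
  have hneg2 : ∀ w : ℂ, w.im < 0 → Complex.log (-w) = Complex.log w + Real.pi * Complex.I := by
    intro w hw
    rw [Complex.log, Complex.log, Complex.arg_neg_eq_arg_add_pi_of_im_neg hw, norm_neg]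
    push_cast
    ring
  rw [rectangleIntegral, hh δ (Or.inl rfl), hh (-δ) (Or.inr rfl), hright, hleft,
    hneg1 ((-L : ℝ) + δ * Complex.I - l) (by simpa using hδ),
    hneg2 ((-L : ℝ) + (-δ : ℝ) * Complex.I - l) (by simpa using hδ)]
  ring

/-- The Cauchy integral formula on a rectangle, at real points. -/
theorem rectangleIntegral_mul_inv {l : ℝ} (hδ : 0 < δ) (hl : |l| < L) {G : ℂ → ℂ}
    (hG : DifferentiableOn ℂ G {z | |z.re| ≤ L ∧ |z.im| ≤ δ}) :
    rectangleIntegral L δ (fun z => G z * (z - l)⁻¹) = 2 * Real.pi * Complex.I * G l := by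
  have hL : 0 < L := (abs_nonneg l).trans_lt hl
  have hset : (Set.uIcc (-L) L) ×ℂ (Set.uIcc (-δ) δ) = {z : ℂ | |z.re| ≤ L ∧ |z.im| ≤ δ} := by
    ext z
    rw [Complex.mem_reProdIm, Set.uIcc_of_le (by linarith), Set.uIcc_of_le (by linarith)]
    simp only [Set.mem_Icc, abs_le, Set.mem_ofPred_eq]
  have hnhds : {z : ℂ | |z.re| ≤ L ∧ |z.im| ≤ δ} ∈ 𝓝 (l : ℂ) := by
    have h1 : ∀ᶠ z : ℂ in 𝓝 (l : ℂ), |z.re| < L :=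
      (Complex.continuous_re.abs.continuousAt).eventually_lt continuousAt_const (by simpa using hl)
    have h2 : ∀ᶠ z : ℂ in 𝓝 (l : ℂ), |z.im| < δ :=
      (Complex.continuous_im.abs.continuousAt).eventually_lt continuousAt_const (by simpa using hδ)
    filter_upwards [h1, h2] with z hz1 hz2 using ⟨hz1.le, hz2.le⟩
  -- On the boundary `G z * (z - l)⁻¹` is `dslope G l z` plus `G l * (z - l)⁻¹`. The slope is
  -- holomorphic across `l` and integrates to zero.
  have hds : DifferentiableOn ℂ (dslope G l) {z | |z.re| ≤ L ∧ |z.im| ≤ δ} :=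
    (Complex.differentiableOn_dslope hnhds).2 hG
  have hzero : rectangleIntegral L δ (dslope G l) = 0 :=
    Complex.integral_boundary_rect_eq_zero_of_differentiableOn (dslope G l) ⟨-L, -δ⟩ ⟨L, δ⟩
      (by rw [hset]; exact hds)
  have hbd : rectangleBoundary L δ ⊆ {z | |z.re| ≤ L ∧ |z.im| ≤ δ} := fun z hz => ⟨hz.1, hz.2.1⟩
  have hinv : ContinuousOn (fun z : ℂ => (z - l)⁻¹) (rectangleBoundary L δ) :=
    (continuousOn_id.sub continuousOn_const).inv₀ fun z hz => rectangleBoundary_sub_ne_zero hδ hl hz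
  have hsplit := rectangleIntegral_sum hL.le hδ.le Finset.univ ![1, G l]
    ![dslope G l, fun z => (z - l)⁻¹] (by
      intro i _
      fin_cases i
      · exact hds.continuousOn.mono hbd
      · exact hinv)
  simp only [Fin.sum_univ_two, Matrix.cons_val_zero, Matrix.cons_val_one, one_mul] at hsplit
  rw [hzero, zero_add, rectangleIntegral_inv hδ hl] at hsplit
  rw [mul_comm, ← hsplit]
  refine rectangleIntegral_congr hL.le hδ.le fun z hz => ?_
  have hne := rectangleBoundary_sub_ne_zero hδ hl hz
  rw [dslope_of_ne _ (sub_ne_zero.1 hne), slope_def_field]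
  field_simp
  ring

/-- A linear combination of point evaluations at real points is controlled on analytic functions by
its Cauchy transform on the boundary of a rectangle. -/
theorem norm_sum_mul_le_of_cauchyTransform {ι : Type*} [Fintype ι] (hδ : 0 < δ) (hL : 0 ≤ L)
    (c : ι → ℂ) {l : ι → ℝ} (hl : ∀ k, |l k| < L) {G : ℂ → ℂ} {C ε : ℝ} (hC : 0 ≤ C)
    (hG : DifferentiableOn ℂ G {z | |z.re| ≤ L ∧ |z.im| ≤ δ})
    (hGC : ∀ z ∈ rectangleBoundary L δ, ‖G z‖ ≤ C)
    (hε : ∀ z ∈ rectangleBoundary L δ, ‖∑ k, c k * (z - l k)⁻¹‖ ≤ ε) :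
    ‖∑ k, c k * G (l k)‖ ≤ C * ε * (L + δ) := by
  have hbd : rectangleBoundary L δ ⊆ {z | |z.re| ≤ L ∧ |z.im| ≤ δ} := fun z hz => ⟨hz.1, hz.2.1⟩
  have h1 := rectangleIntegral_sum hL hδ.le Finset.univ c (fun k z => G z * (z - l k)⁻¹)
    fun k _ => (hG.continuousOn.mono hbd).mul
      ((continuousOn_id.sub continuousOn_const).inv₀ fun z hz =>
        rectangleBoundary_sub_ne_zero hδ (hl k) hz)
  simp only [rectangleIntegral_mul_inv hδ (hl _) hG] at h1
  have h2 : ∑ k, c k * (2 * Real.pi * Complex.I * G (l k))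
      = 2 * Real.pi * Complex.I * ∑ k, c k * G (l k) := by
    rw [Finset.mul_sum]
    exact Finset.sum_congr rfl fun k _ => by ring
  have h3 := norm_rectangleIntegral_le hL hδ.le (f := fun z => ∑ k, c k * (G z * (z - l k)⁻¹))
    (C := C * ε) fun z hz => by
      have h4 : ∑ k, c k * (G z * (z - l k)⁻¹) = G z * ∑ k, c k * (z - l k)⁻¹ := by
        rw [Finset.mul_sum]
        exact Finset.sum_congr rfl fun k _ => by ring
      rw [h4, norm_mul]
      exact mul_le_mul (hGC z hz) (hε z hz) (norm_nonneg _) hC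
  rw [h1, h2, norm_mul] at h3
  have h5 : ‖(2 * Real.pi * Complex.I : ℂ)‖ = 2 * Real.pi := by
    simp [abs_of_pos Real.pi_pos]
  rw [h5] at h3
  -- The perimeter `4 * L + 4 * δ` divided by `2 * π` is at most `L + δ`, because `π ≥ 2`.
  nlinarith [Real.pi_gt_three, norm_nonneg (∑ k, c k * G (l k))]

end rectangle

open Matrix in
/-- Diagonal entries of analytic functions of a Hermitian matrix and of a principal submatrix differ
by an exponentially small amount at sites which are far from the removed indices. -/
theorem Matrix.IsHermitian.norm_matrixFunction_sub_le {X Y : Type*} [Fintype X] [DecidableEq X]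
    [Fintype Y] [DecidableEq Y] {B : Matrix X X ℂ} (hB : B.IsHermitian) (φ : Y ↪ X) {E δ s t : ℝ}
    (hE : ‖toEuclideanCLM (𝕜 := ℂ) B‖ ≤ E) (hδ : 0 < δ) (ht : 0 ≤ t)
    {w : X → ℝ} {y₀ : Y} (hw : w (φ y₀) = 0) (hs : ∀ x ∉ Set.range φ, s ≤ w x)
    (hconj : ‖toEuclideanCLM (𝕜 := ℂ)
      (of fun k l => B k l * ((Real.exp (t * (w k - w l)) - 1 : ℝ) : ℂ))‖ ≤ δ / 2)
    {g : ℝ → ℂ} {G : ℂ → ℂ} {C : ℝ} (hC : 0 ≤ C)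
    (hG : DifferentiableOn ℂ G {z | |z.re| ≤ E + δ ∧ |z.im| ≤ δ})
    (hGC : ∀ z ∈ rectangleBoundary (E + δ) δ, ‖G z‖ ≤ C)
    (hgG : ∀ x : ℝ, |x| ≤ E → G x = g x) :
    ‖Bilayer.matrixFunction B g (φ y₀) (φ y₀)
        - Bilayer.matrixFunction (B.submatrix φ φ) g y₀ y₀‖
      ≤ C * (2 * E / δ ^ 2 * Real.exp (-t * s)) * (E + δ + δ) := by
  have hE0 : 0 ≤ E := (norm_nonneg _).trans hE
  have hB' := hB.submatrix φ
  have hE' := (norm_toEuclideanCLM_submatrix_le B φ).trans hE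
  obtain ⟨p, -, -, hp, -, hpv⟩ := hB.exists_spectral_weights (φ y₀)
  obtain ⟨q, -, -, hq, -, hqv⟩ := hB'.exists_spectral_weights y₀
  -- The two spectra form a single signed family of point masses. Its Cauchy transform is the
  -- difference of the resolvent entries, and its value on `G` is the difference of the diagonal
  -- entries.
  have h1 := norm_sum_mul_le_of_cauchyTransform (L := E + δ) hδ (by positivity)
    (Sum.elim (fun k => (p k : ℂ)) fun k => -(q k : ℂ)) (l := Sum.elim hB.eigenvalues hB'.eigenvalues)
    (ε := 2 * E / δ ^ 2 * Real.exp (-t * s)) (by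
      rintro (k | k)
      · exact ((hB.abs_eigenvalues_le k).trans hE).trans_lt (by linarith)
      · exact ((hB'.abs_eigenvalues_le k).trans hE').trans_lt (by linarith)) hC hG hGC (by
      intro z hz
      have hz' : δ ≤ |z.im| ∨ E + δ ≤ |z.re| := by
        rcases hz.2.2 with h | h
        · exact Or.inr h.ge
        · exact Or.inl h.ge
      have hne : ∀ x : ℝ, |x| ≤ E → z ≠ x := by
        rintro x hx rfl
        rcases hz' with h | h
        · simp at h
          linarith
        · simp at h
          linarith
      obtain ⟨v, hv, hv0⟩ := hpv z fun k => hne _ ((hB.abs_eigenvalues_le k).trans hE)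
      obtain ⟨u, hu, hu0⟩ := hqv z fun k => hne _ ((hB'.abs_eigenvalues_le k).trans hE')
      have h2 := hB.norm_resolvent_sub_le φ hE hδ ht hz' hw hs hconj hv hu
      rw [hv0, hu0] at h2
      simpa [Fintype.sum_sum_type, sub_eq_add_neg] using h2)
  have h3 : ∑ k, Sum.elim (fun k => (p k : ℂ)) (fun k => -(q k : ℂ)) k
      * G (Sum.elim hB.eigenvalues hB'.eigenvalues k : ℝ)
      = ∑ k, (p k : ℂ) * g (hB.eigenvalues k) - ∑ k, (q k : ℂ) * g (hB'.eigenvalues k) := by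
    rw [Fintype.sum_sum_type]
    simp only [Sum.elim_inl, Sum.elim_inr, neg_mul, Finset.sum_neg_distrib, ← sub_eq_add_neg]
    congr 1
    · exact Finset.sum_congr rfl fun k _ => by
        rw [hgG _ ((hB.abs_eigenvalues_le k).trans hE)]
    · exact Finset.sum_congr rfl fun k _ => by
        rw [hgG _ ((hB'.abs_eigenvalues_le k).trans hE')]
  rw [hp, hq, ← h3]
  exact h1

/-! ### Lattice sums and uniform bounds for the Hamiltonians -/

namespace Bilayer

variable (M : Bilayer.{u})

theorem latticePoint_add (i : Fin 2) (m n : Fin 2 → ℤ) :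
    M.latticePoint i (m + n) = M.latticePoint i m + M.latticePoint i n := by
  rw [latticePoint, latticePoint, latticePoint, ← WithLp.toLp_add, ← Matrix.mulVec_add]
  congr 2
  funext k
  simp

@[simp]
theorem latticePoint_zero (i : Fin 2) : M.latticePoint i 0 = 0 := by
  have h := M.latticePoint_add i 0 0
  rw [add_zero] at h
  exact left_eq_add.1 h

theorem latticePoint_neg (i : Fin 2) (n : Fin 2 → ℤ) :
    M.latticePoint i (-n) = -M.latticePoint i n := by
  rw [eq_neg_iff_add_eq_zero, ← latticePoint_add, neg_add_cancel, latticePoint_zero]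

/-- The coordinates of a point of the plane with respect to the lattice basis of sheet `i`. -/
def coordinates (i : Fin 2) (x : Plane) : Fin 2 → ℝ := (M.A i)⁻¹.mulVec (WithLp.ofLp x)

/-- The point of the plane with given coordinates with respect to the lattice basis of sheet `i`. -/
def ofCoordinates (i : Fin 2) (t : Fin 2 → ℝ) : Plane := WithLp.toLp 2 ((M.A i).mulVec t)

theorem coordinates_ofCoordinates (i : Fin 2) (t : Fin 2 → ℝ) :
    M.coordinates i (M.ofCoordinates i t) = t := by
  rw [coordinates, ofCoordinates, Matrix.mulVec_mulVec,
    Matrix.nonsing_inv_mul _ (M.det_ne_zero i).isUnit, Matrix.one_mulVec]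

theorem ofCoordinates_coordinates (i : Fin 2) (x : Plane) :
    M.ofCoordinates i (M.coordinates i x) = x := by
  rw [coordinates, ofCoordinates, Matrix.mulVec_mulVec,
    Matrix.mul_nonsing_inv _ (M.det_ne_zero i).isUnit, Matrix.one_mulVec]

theorem coordinates_sub (i : Fin 2) (x y : Plane) :
    M.coordinates i (x - y) = M.coordinates i x - M.coordinates i y := by
  rw [coordinates, WithLp.ofLp_sub, Matrix.mulVec_sub, coordinates, coordinates]

theorem ofCoordinates_intCast (i : Fin 2) (n : Fin 2 → ℤ) :
    M.ofCoordinates i (fun k => n k) = M.latticePoint i n := rfl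

theorem ofCoordinates_add (i : Fin 2) (s t : Fin 2 → ℝ) :
    M.ofCoordinates i (s + t) = M.ofCoordinates i s + M.ofCoordinates i t := by
  rw [ofCoordinates, Matrix.mulVec_add, WithLp.toLp_add, ofCoordinates, ofCoordinates]

theorem exists_abs_coordinates_le (i : Fin 2) :
    ∃ c > (0 : ℝ), ∀ x k, |M.coordinates i x k| ≤ c * ‖x‖ := by
  let L : Plane →L[ℝ] Plane := Matrix.toEuclideanCLM (𝕜 := ℝ) (M.A i)⁻¹
  refine ⟨‖L‖ + 1, by positivity, fun x k => ?_⟩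
  calc |M.coordinates i x k| = ‖(L x) k‖ := rfl
    _ ≤ ‖L x‖ := PiLp.norm_apply_le _ _
    _ ≤ ‖L‖ * ‖x‖ := L.le_opNorm _
    _ ≤ _ := by nlinarith [norm_nonneg x]

/-- In lattice coordinates, subtracting the integer part of `y` reduces to `y` in the unit cell at
the cost of a constant factor. What remains is dominated by a product of two geometric series,
whence a bound free of `y`. -/
theorem exists_sum_exp_latticePoint_le (i : Fin 2) {a : ℝ} (ha : 0 < a) :
    ∃ K : ℝ, 0 ≤ K ∧ ∀ (y : Plane) (s : Finset (Fin 2 → ℤ)),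
      ∑ n ∈ s, Real.exp (-a * ‖y - M.latticePoint i n‖) ≤ K := by
  obtain ⟨c, hc, hcoord⟩ := M.exists_abs_coordinates_le i
  -- Each of the two coordinates of `n - f` is at most `c * ‖y - R‖ + 1` in absolute value, `R`
  -- being the lattice point of `n`. With this `q`, the weighted sum of both is at most `a * ‖y - R‖
  -- + 2 * q`.
  set q : ℝ := a / (2 * c) with hq
  have hq0 : 0 < q := by positivity
  have hsum1 : Summable fun m : ℤ => Real.exp (-q * |(m : ℝ)|) := by
    have h := summable_geometric_of_lt_one (Real.exp_nonneg (-q)) (by rwa [Real.exp_lt_one_iff, neg_lt_zero])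
    refine Summable.of_nat_of_neg ?_ ?_ <;>
    · refine h.congr fun n => ?_
      rw [← Real.exp_nat_mul]
      simp [mul_comm]
  have hsum2 : Summable fun n : Fin 2 → ℤ =>
      Real.exp (-q * |(n 0 : ℝ)|) * Real.exp (-q * |(n 1 : ℝ)|) := by
    have h := hsum1.mul_of_nonneg hsum1 (fun _ => Real.exp_nonneg _) (fun _ => Real.exp_nonneg _)
    exact (finTwoArrowEquiv ℤ).summable_iff.2 h
  refine ⟨Real.exp (2 * q) * ∑' n : Fin 2 → ℤ, Real.exp (-q * |(n 0 : ℝ)|)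
    * Real.exp (-q * |(n 1 : ℝ)|), ?_, ?_⟩
  · exact mul_nonneg (Real.exp_nonneg _) (tsum_nonneg fun _ => by positivity)
  intro y s
  set t := M.coordinates i y with ht
  set f : Fin 2 → ℤ := fun k => ⌊t k⌋ with hf
  have hterm : ∀ n : Fin 2 → ℤ, Real.exp (-a * ‖y - M.latticePoint i n‖)
      ≤ Real.exp (2 * q) * (Real.exp (-q * |((n - f) 0 : ℝ)|)
        * Real.exp (-q * |((n - f) 1 : ℝ)|)) := by
    intro n
    have hk : ∀ k, |((n k - f k : ℝ))| ≤ c * ‖y - M.latticePoint i n‖ + 1 := by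
      intro k
      have h1 := hcoord (y - M.latticePoint i n) k
      rw [coordinates_sub, ← ofCoordinates_intCast, coordinates_ofCoordinates, Pi.sub_apply] at h1
      rw [ofCoordinates_intCast] at h1
      have h2 : (n k - f k : ℝ) = -(t k - n k) + Int.fract (t k) := by
        rw [Int.fract]
        ring
      rw [h2]
      refine (abs_add_le _ _).trans ?_
      rw [abs_neg, abs_of_nonneg (Int.fract_nonneg (t k))]
      exact add_le_add h1 (Int.fract_lt_one _).le
    rw [← Real.exp_add, ← Real.exp_add]
    refine Real.exp_le_exp.2 ?_
    have h0 := hk 0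
    have h1 := hk 1
    have h3 : a = 2 * c * q := by
      rw [hq]
      field_simp
    have h4 : q * (|(n 0 - f 0 : ℝ)| + |(n 1 - f 1 : ℝ)|)
        ≤ q * (2 * (c * ‖y - M.latticePoint i n‖ + 1)) := by
      refine mul_le_mul_of_nonneg_left ?_ hq0.le
      linarith
    have h5 : q * (2 * (c * ‖y - M.latticePoint i n‖ + 1))
      = a * ‖y - M.latticePoint i n‖ + 2 * q := by
      rw [h3]
      ring
    simp only [Pi.sub_apply, Int.cast_sub]
    linarith
  refine (Finset.sum_le_sum fun n _ => hterm n).trans ?_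
  rw [← Finset.mul_sum]
  refine mul_le_mul_of_nonneg_left ?_ (Real.exp_nonneg _)
  have h6 : Summable fun n : Fin 2 → ℤ =>
      Real.exp (-q * |((n - f) 0 : ℝ)|) * Real.exp (-q * |((n - f) 1 : ℝ)|) := by
    have := (Equiv.subRight f).summable_iff.2 hsum2
    simpa [Function.comp_def] using this
  refine (h6.sum_le_tsum s fun _ _ => by positivity).trans (le_of_eq ?_)
  rw [← (Equiv.subRight f).tsum_eq (fun n : Fin 2 → ℤ => Real.exp (-q * |(n 0 : ℝ)|)
    * Real.exp (-q * |(n 1 : ℝ)|))]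
  simp

/-- The position of a site when the sheet other than `j` is shifted by `b`. -/
def shiftedPosition (j : Fin 2) (b : Plane) (k : M.Site) : Plane :=
  M.onSheet (other j) (M.orbital k) • b + M.position k

theorem hamiltonian_apply (j : Fin 2) (r : ℝ) (b : Plane) (k l : M.Cluster r) :
    M.hamiltonian j r b k l = M.h (M.orbital k) (M.orbital l)
      (M.shiftedPosition j b k - M.shiftedPosition j b l) := by
  rw [hamiltonian, shiftedPosition, shiftedPosition]
  congr 1
  module

/-- The shift is constant on each sheet and is absorbed into the centre `y`. This gives uniformity
in the shift and in the radius. -/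
theorem exists_sum_exp_shiftedPosition_le {a : ℝ} (ha : 0 < a) :
    ∃ K : ℝ, 0 ≤ K ∧ ∀ (j : Fin 2) (b y : Plane) (r : ℝ),
      ∑ k : M.Cluster r, Real.exp (-a * ‖y - M.shiftedPosition j b k‖) ≤ K := by
  classical
  choose K hK0 hK using fun i => M.exists_sum_exp_latticePoint_le i ha
  refine ⟨∑ i : Fin 2, ∑ _α : M.Orb i, K i,
    Finset.sum_nonneg fun i _ => Finset.sum_nonneg fun _ _ => hK0 i, fun j b y r => ?_⟩
  let N : Finset (Fin 2 → ℤ) := Finset.univ.image fun k : M.Cluster r => k.1.2.1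
  let S : Finset M.Site := Finset.univ.sigma fun i : Fin 2 => N ×ˢ (Finset.univ : Finset (M.Orb i))
  have h1 : ∑ k : M.Cluster r, Real.exp (-a * ‖y - M.shiftedPosition j b k‖)
      ≤ ∑ k ∈ S, Real.exp (-a * ‖y - M.shiftedPosition j b k‖) := by
    refine (Finset.sum_map Finset.univ (Function.Embedding.subtype _)
      (fun k => Real.exp (-a * ‖y - M.shiftedPosition j b k‖))).symm.trans_le ?_
    refine Finset.sum_le_sum_of_subset_of_nonneg (fun k hk => ?_) fun _ _ _ => Real.exp_nonneg _
    obtain ⟨k', -, rfl⟩ := Finset.mem_map.1 hk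
    refine Finset.mem_sigma.2 ⟨Finset.mem_univ _, Finset.mem_product.2 ⟨?_, Finset.mem_univ _⟩⟩
    exact Finset.mem_image.2 ⟨k', Finset.mem_univ _, rfl⟩
  refine h1.trans ?_
  rw [Finset.sum_sigma]
  refine Finset.sum_le_sum fun i _ => ?_
  rw [Finset.sum_product_right]
  refine Finset.sum_le_sum fun α _ => ?_
  refine le_trans (le_of_eq ?_) (hK i (y - M.onSheet (other j) ⟨i, α⟩ • b) N)
  refine Finset.sum_congr rfl fun n _ => ?_
  rw [sub_sub]
  rfl

variable {M}

theorem _root_.Real.abs_exp_sub_one_le_mul_exp (x : ℝ) : |Real.exp x - 1| ≤ |x| * Real.exp |x| := by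
  rcases le_total 0 x with hx | hx
  · rw [abs_of_nonneg hx, abs_of_nonneg (by linarith [Real.one_le_exp hx])]
    have h1 := Real.add_one_le_exp (-x)
    have h2 : Real.exp x * Real.exp (-x) = 1 := by rw [← Real.exp_add]; simp
    nlinarith [Real.exp_pos x]
  · rw [abs_of_nonpos hx, abs_of_nonpos (by linarith [Real.exp_le_one_iff.2 hx])]
    have h1 := Real.add_one_le_exp x
    have h2 := Real.one_le_exp (neg_nonneg.2 hx)
    nlinarith

-- Both bounds are Schur's test. The distance to `x₀` is 1-Lipschitz, so a conjugated entry is at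
-- most `t * v * exp (t * v)` times the original one, `v` being the distance of the two sites.
-- Linearity in `t` later permits a choice of `t` proportional to the distance from the spectrum.
open Matrix in
theorem RegularHopping.exists_norm_le (hhop : M.RegularHopping) :
    ∃ K > (0 : ℝ), ∃ t₀ > (0 : ℝ), ∀ (j : Fin 2) (r : ℝ) (b : Plane),
      ‖toEuclideanCLM (𝕜 := ℂ) (M.hamiltonian j r b)‖ ≤ K ∧
      ∀ (x₀ : Plane) (t : ℝ), 0 ≤ t → t ≤ t₀ →
        ‖toEuclideanCLM (𝕜 := ℂ) (of fun k l : M.Cluster r => M.hamiltonian j r b k l *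
          ((Real.exp (t * (‖M.shiftedPosition j b k - x₀‖ - ‖M.shiftedPosition j b l - x₀‖)) - 1 : ℝ)
            : ℂ))‖ ≤ K * t := by
  obtain ⟨-, C', γ, hγ, hC'⟩ := hhop
  -- The given constant may be negative when there are no orbitals.
  set C := |C'| with hCdef
  have hC0 : 0 ≤ C := abs_nonneg _
  have hC : ∀ α α' x, ‖M.h α α' x‖ ≤ C * Real.exp (-γ * ‖x‖) := fun α α' x =>
    (hC' α α' x).trans (mul_le_mul_of_nonneg_right (le_abs_self _) (Real.exp_nonneg _))
  obtain ⟨S, hS0, hS⟩ := M.exists_sum_exp_shiftedPosition_le (a := γ / 4) (by positivity)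
  have hrow : ∀ (j : Fin 2) (r : ℝ) (b : Plane) (c : ℝ), 0 ≤ c →
      ∀ D : Matrix (M.Cluster r) (M.Cluster r) ℂ, (∀ k l, ‖D k l‖ ≤ c * Real.exp (-(γ / 4) *
        ‖M.shiftedPosition j b k - M.shiftedPosition j b l‖)) →
        ‖toEuclideanCLM (𝕜 := ℂ) D‖ ≤ c * S := by
    intro j r b c hc D hD
    refine norm_toEuclideanCLM_le_of_sum_le _ (by positivity) (fun k => ?_) fun l => ?_
    · refine (Finset.sum_le_sum fun l _ => hD k l).trans ?_
      rw [← Finset.mul_sum]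
      exact mul_le_mul_of_nonneg_left (hS j b _ r) hc
    · refine (Finset.sum_le_sum fun k _ => hD k l).trans ?_
      rw [← Finset.mul_sum]
      simp only [norm_sub_rev _ (M.shiftedPosition j b l)]
      exact mul_le_mul_of_nonneg_left (hS j b _ r) hc
  refine ⟨C * S + C * (4 / γ) * S + 1, by positivity, γ / 2, by positivity, fun j r b => ⟨?_, ?_⟩⟩
  · refine (hrow j r b C hC0 _ fun k l => ?_).trans ?_
    · rw [hamiltonian_apply]
      refine (hC _ _ _).trans (mul_le_mul_of_nonneg_left (Real.exp_le_exp.2 ?_) hC0)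
      nlinarith [norm_nonneg (M.shiftedPosition j b k - M.shiftedPosition j b l)]
    · have : 0 ≤ C * (4 / γ) * S := by positivity
      linarith
  · intro x₀ t ht ht'
    refine (hrow j r b (C * (4 / γ) * t) (by positivity) _ fun k l => ?_).trans ?_
    · rw [of_apply, norm_mul, hamiltonian_apply, Complex.norm_real, Real.norm_eq_abs]
      set v := ‖M.shiftedPosition j b k - M.shiftedPosition j b l‖ with hv
      have hv0 : 0 ≤ v := norm_nonneg _
      have hw : |‖M.shiftedPosition j b k - x₀‖ - ‖M.shiftedPosition j b l - x₀‖| ≤ v := by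
        refine (abs_norm_sub_norm_le _ _).trans (le_of_eq ?_)
        rw [sub_sub_sub_cancel_right]
      have h1 : |t * (‖M.shiftedPosition j b k - x₀‖ - ‖M.shiftedPosition j b l - x₀‖)| ≤ t * v := by
        rw [abs_mul, abs_of_nonneg ht]
        exact mul_le_mul_of_nonneg_left hw ht
      have h2 := (Real.abs_exp_sub_one_le_mul_exp _).trans
        (mul_le_mul h1 (Real.exp_le_exp.2 h1) (Real.exp_nonneg _) (by positivity))
      -- The rate `γ` is spent in three parts: `γ / 4` absorbs the factor `v`, `γ / 2` pays for `exp
      -- (t * v)`, and `γ / 4` is left for the lattice sum.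
      have h3 : v ≤ 4 / γ * Real.exp (γ / 4 * v) := by
        have := Real.add_one_le_exp (γ / 4 * v)
        calc v = 4 / γ * (γ / 4 * v) := by field_simp
          _ ≤ _ := mul_le_mul_of_nonneg_left (by linarith) (by positivity)
      have h4 : Real.exp (t * v) ≤ Real.exp (γ / 2 * v) :=
        Real.exp_le_exp.2 (mul_le_mul_of_nonneg_right ht' hv0)
      calc _ ≤ C * Real.exp (-γ * v) * (t * v * Real.exp (t * v)) :=
            mul_le_mul (hC _ _ _) h2 (abs_nonneg _) (by positivity)
        _ ≤ C * Real.exp (-γ * v) * (t * (4 / γ * Real.exp (γ / 4 * v)) * Real.exp (γ / 2 * v)) := by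
            gcongr
        _ = C * (4 / γ) * t * (Real.exp (-γ * v) * Real.exp (γ / 4 * v) * Real.exp (γ / 2 * v)) := by
            ring
        _ = _ := by
            rw [← Real.exp_add, ← Real.exp_add]
            ring_nf
    · have : 0 ≤ (C * S + 1) * t := by positivity
      nlinarith

end Bilayer

/-! ### Translations of the sheets and principal submatrices -/

namespace Bilayer

variable (M : Bilayer.{u})

theorem other_ne (j : Fin 2) : other j ≠ j := by
  fin_cases j <;> decide

theorem eq_or_eq_other (i j : Fin 2) : i = j ∨ i = other j := by
  fin_cases i <;> fin_cases j <;> decide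

@[simp]
theorem other_other (j : Fin 2) : other (other j) = j := by
  fin_cases j <;> decide

/-- The embedding of clusters given by a lattice translation of each of the sheets. -/
def clusterTranslation (τ : Fin 2 → Fin 2 → ℤ) {r r' : ℝ}
    (h : ∀ i, r + ‖M.latticePoint i (τ i)‖ ≤ r') : M.Cluster r ↪ M.Cluster r' where
  toFun k := ⟨⟨k.1.1, k.1.2.1 + τ k.1.1, k.1.2.2⟩, by
    have hk : ‖M.latticePoint k.1.1 k.1.2.1‖ < r := k.2
    rw [position, latticePoint_add]
    exact (norm_add_le _ _).trans_lt (by linarith [h k.1.1])⟩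
  inj' := by
    rintro ⟨⟨i, n, α⟩, hk⟩ ⟨⟨i', n', α'⟩, hk'⟩ h
    simp only [Subtype.mk.injEq, Sigma.mk.injEq] at h
    obtain ⟨rfl, h⟩ := h
    simp only [heq_eq_eq, Prod.mk.injEq, add_left_inj] at h
    obtain ⟨rfl, rfl⟩ := h
    rfl

theorem position_clusterTranslation (τ : Fin 2 → Fin 2 → ℤ) {r r' : ℝ}
    (h : ∀ i, r + ‖M.latticePoint i (τ i)‖ ≤ r') (k : M.Cluster r) :
    M.position (M.clusterTranslation τ h k) = M.position k + M.latticePoint k.1.1 (τ k.1.1) :=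
  M.latticePoint_add _ _ _

theorem le_norm_of_notMem_range_clusterTranslation (τ : Fin 2 → Fin 2 → ℤ) {r r' : ℝ}
    (h : ∀ i, r + ‖M.latticePoint i (τ i)‖ ≤ r') {x : M.Cluster r'}
    (hx : x ∉ Set.range (M.clusterTranslation τ h)) :
    r ≤ ‖M.position x - M.latticePoint x.1.1 (τ x.1.1)‖ := by
  by_contra hlt
  push Not at hlt
  refine hx ⟨⟨⟨x.1.1, x.1.2.1 - τ x.1.1, x.1.2.2⟩, ?_⟩, ?_⟩
  · rw [position, sub_eq_add_neg, latticePoint_add, latticePoint_neg, ← sub_eq_add_neg]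
    exact hlt
  · obtain ⟨⟨i, n, α⟩, hk⟩ := x
    refine Subtype.ext ?_
    change (⟨i, n - τ i + τ i, α⟩ : M.Site) = ⟨i, n, α⟩
    rw [sub_add_cancel]

/-- The displacement of sheet `i` when the sheet other than `j` is shifted by `b`. -/
def sheetShift (j : Fin 2) (b : Plane) (i : Fin 2) : Plane := if i = other j then b else 0

theorem shiftedPosition_eq (j : Fin 2) (b : Plane) (k : M.Site) :
    M.shiftedPosition j b k = sheetShift j b k.1 + M.position k := by
  rw [shiftedPosition, onSheet, sheetShift, orbital]
  split_ifs <;> simp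

theorem norm_sheetShift_le (j : Fin 2) (b : Plane) (i : Fin 2) : ‖sheetShift j b i‖ ≤ ‖b‖ := by
  rw [sheetShift]
  split_ifs <;> simp

/-- The hopping sees only differences of positions, so a common displacement `v` of both sheets is
invisible. Different choices of `τ` give the enlargement of a cluster, the periodicity in the shift,
and the recentring at a site. -/
theorem hamiltonian_eq_submatrix {j j' : Fin 2} {b b' : Plane} (τ : Fin 2 → Fin 2 → ℤ) {r r' : ℝ}
    (h : ∀ i, r + ‖M.latticePoint i (τ i)‖ ≤ r') {v : Plane}
    (hv : ∀ i, sheetShift j' b' i + M.latticePoint i (τ i) = sheetShift j b i + v) :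
    M.hamiltonian j r b = (M.hamiltonian j' r' b').submatrix
      (M.clusterTranslation τ h) (M.clusterTranslation τ h) := by
  ext k l
  rw [Matrix.submatrix_apply, hamiltonian_apply, hamiltonian_apply]
  simp only [shiftedPosition_eq, position_clusterTranslation]
  have hk := hv k.1.1
  have hl := hv l.1.1
  have h1 : ∀ a b c d e f v : Plane, a + d = e + v → b + c = f + v → ∀ p q : Plane,
      e + p - (f + q) = a + (p + d) - (b + (q + c)) := by
    intro a b c d e f v h1 h2 p q
    rw [← sub_eq_iff_eq_add] at h1 h2
    rw [← h1, ← h2]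
    abel
  exact congrArg _ (h1 _ _ _ _ _ _ _ hk hl _ _)

theorem exists_cell_add_latticePoint (i : Fin 2) (b : Plane) :
    ∃ c ∈ M.cell i, ∃ n, b = c + M.latticePoint i n := by
  refine ⟨M.ofCoordinates i fun k => Int.fract (M.coordinates i b k),
    ⟨_, fun k => ⟨Int.fract_nonneg _, Int.fract_lt_one _⟩, rfl⟩,
    fun k => ⌊M.coordinates i b k⌋, ?_⟩
  rw [← ofCoordinates_intCast, ← ofCoordinates_add]
  conv_lhs => rw [← M.ofCoordinates_coordinates i b]
  congr 1
  funext k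
  exact (Int.fract_add_floor _).symm

variable {M}

theorem RegularHopping.bddAbove_hamiltonianNorms (hhop : M.RegularHopping) :
    BddAbove M.hamiltonianNorms := by
  obtain ⟨K, -, t₀, -, h⟩ := hhop.exists_norm_le
  refine ⟨K, ?_⟩
  rintro x ⟨r, -, j, b, -, rfl⟩
  exact (h j r b).1

-- The supremum runs over `b` in the cell of sheet `j`, although the other sheet is the shifted one.
-- Up to a common translation, shifting the other sheet by a lattice vector of sheet `j` is the
-- opposite translation of sheet `j`, which only relabels its sites. An arbitrary shift thus occurs
-- as a submatrix of a larger cluster with shift in the cell.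
open Matrix in
theorem RegularHopping.norm_hamiltonian_le (hhop : M.RegularHopping) (j : Fin 2) (r : ℝ)
    (b : Plane) : ‖toEuclideanCLM (𝕜 := ℂ) (M.hamiltonian j r b)‖ ≤ M.energyBound := by
  obtain ⟨c, hc, n, rfl⟩ := M.exists_cell_add_latticePoint j b
  set τ : Fin 2 → Fin 2 → ℤ := fun i => if i = j then -n else 0 with hτ
  -- Here `r` may be negative, while the supremum admits positive radii only.
  set r' : ℝ := |r| + ‖M.latticePoint j n‖ + 1 with hr'
  have hle : ∀ i, r + ‖M.latticePoint i (τ i)‖ ≤ r' := by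
    intro i
    simp only [hτ]
    split_ifs with hi
    · subst hi
      rw [latticePoint_neg, norm_neg]
      linarith [le_abs_self r]
    · rw [latticePoint_zero, norm_zero]
      linarith [le_abs_self r, norm_nonneg (M.latticePoint j n)]
  have hsub : M.hamiltonian j r (c + M.latticePoint j n) = (M.hamiltonian j r' c).submatrix
      (M.clusterTranslation τ hle) (M.clusterTranslation τ hle) := by
    refine M.hamiltonian_eq_submatrix τ hle (v := -M.latticePoint j n) fun i => ?_
    rcases eq_or_eq_other i j with rfl | rfl
    · simp [hτ, sheetShift, (other_ne i).symm, latticePoint_neg]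
    · simp [hτ, sheetShift, other_ne]
  rw [hsub]
  refine (norm_toEuclideanCLM_submatrix_le _ _).trans ?_
  exact le_csSup hhop.bddAbove_hamiltonianNorms ⟨r', by positivity, j, c, hc, rfl⟩

/-! ### Neighbourhoods of `S[H]` and the truncation estimate -/

variable (M)

theorem distToInterval_le (z : ℂ) {x : ℝ} (hx : x ∈ M.energyInterval) :
    M.distToInterval z ≤ ‖z - x‖ := by
  rw [← dist_eq_norm]
  exact Metric.infDist_le_dist_of_mem ⟨x, hx, rfl⟩

theorem distToInterval_le_of_abs_le {δ : ℝ} (hδ : 0 ≤ δ) {z : ℂ}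
    (hre : |z.re| ≤ M.energyBound + δ) (him : |z.im| ≤ δ) : M.distToInterval z ≤ 2 * δ := by
  have hE := M.energyBound_nonneg
  obtain ⟨x, hx, hxz⟩ : ∃ x ∈ M.energyInterval, |z.re - x| ≤ δ := by
    obtain ⟨h1, h2⟩ := abs_le.1 hre
    rcases le_total z.re (-M.energyBound) with h | h
    · exact ⟨-M.energyBound, ⟨le_rfl, by linarith⟩, abs_le.2 ⟨by linarith, by linarith⟩⟩
    rcases le_total z.re M.energyBound with h' | h'
    · exact ⟨z.re, ⟨h, h'⟩, by simpa using hδ⟩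
    · exact ⟨M.energyBound, ⟨by linarith, le_rfl⟩, abs_le.2 ⟨by linarith, by linarith⟩⟩
  refine (M.distToInterval_le z hx).trans ((Complex.norm_le_abs_re_add_abs_im _).trans ?_)
  simp only [Complex.sub_re, Complex.ofReal_re, Complex.sub_im, Complex.ofReal_im, sub_zero]
  linarith

/-- Compactness bounds an analytic continuation near `S[H]`, so that the `sSup` in `supNear` is a
genuine supremum and not the default value. -/
theorem isCompact_distToInterval_le (d : ℝ) : IsCompact {z | M.distToInterval z ≤ d} := by
  refine Metric.isCompact_of_isClosed_isBounded
    (isClosed_le (Metric.continuous_infDist_pt _) continuous_const) ?_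
  refine (Metric.isBounded_closedBall (x := (0 : ℂ)) (r := M.energyBound + d)).subset fun z hz => ?_
  have hne : ((fun x : ℝ => (x : ℂ)) '' M.energyInterval).Nonempty :=
    ⟨_, 0, ⟨by linarith [M.energyBound_nonneg], M.energyBound_nonneg⟩, rfl⟩
  obtain ⟨y, ⟨x, hx, rfl⟩, hxz⟩ := (isCompact_Icc.image
    Complex.continuous_ofReal).exists_infDist_eq_dist hne z
  have h1 : dist z (x : ℂ) ≤ d := hxz ▸ hz
  rw [Metric.mem_closedBall, dist_zero_right]
  have h2 : ‖(x : ℂ)‖ ≤ M.energyBound := by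
    rw [Complex.norm_real]
    exact abs_le.2 hx
  have h3 := norm_add_le (z - x) (x : ℂ)
  rw [sub_add_cancel, ← dist_eq_norm] at h3
  linarith

variable {M}

theorem IsAnalyticWithin.norm_le_supNear {d : ℝ} {g : C(ℝ, ℂ)} {G : ℂ → ℂ}
    (hG : M.IsAnalyticWithin d g G) {z : ℂ} (hz : M.distToInterval z < d) :
    ‖G z‖ ≤ M.supNear d G := by
  refine le_csSup ?_ ⟨z, hz, rfl⟩
  refine ((M.isCompact_distToInterval_le d).bddAbove_image hG.1.continuousOn.norm).mono ?_
  exact Set.image_mono fun z (hz : M.distToInterval z < d) => hz.le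

theorem supNear_nonneg (d : ℝ) (G : ℂ → ℂ) : 0 ≤ M.supNear d G :=
  Real.sSup_nonneg (by rintro x ⟨z, -, rfl⟩; exact norm_nonneg _)

/-- The truncation estimate: passing from a cluster to a subcluster changes the local density of
states by an amount which is exponentially small in the distance from the removed sites. -/
theorem RegularHopping.exists_truncation (hhop : M.RegularHopping) (hherm : M.IsHermitianModel)
    {d₀ : ℝ} (hd₀ : 0 < d₀) :
    ∃ C > (0 : ℝ), ∃ γ > (0 : ℝ), ∀ d : ℝ, 0 < d → d ≤ d₀ → ∀ (g : C(ℝ, ℂ)) (G : ℂ → ℂ),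
      M.IsAnalyticWithin d g G → ∀ (i j : Fin 2) (r r' s : ℝ) (b b' : Plane)
      (φ : M.Cluster r ↪ M.Cluster r') (k : M.Cluster r),
      M.hamiltonian i r b = (M.hamiltonian j r' b').submatrix φ φ →
      (∀ x ∉ Set.range φ, s ≤ ‖M.shiftedPosition j b' x - M.shiftedPosition j b' (φ k)‖) →
      ‖matrixFunction (M.hamiltonian j r' b') g (φ k) (φ k)
          - matrixFunction (M.hamiltonian i r b) g k k‖
        ≤ C * (d ^ 2)⁻¹ * M.supNear d G * Real.exp (-γ * d * s) := by
  obtain ⟨K, hK, t₀, ht₀, hconj⟩ := hhop.exists_norm_le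
  set E := M.energyBound with hE
  have hE0 : 0 ≤ E := M.energyBound_nonneg
  -- With `δ = d / 3` the rectangle stays within distance `2 * δ < d` of `S[H]`. The weight `t = γ *
  -- d` has to satisfy `K * t ≤ δ / 2 = d / 6` and `t ≤ t₀`, hence the minimum. The factor 18 is `2
  -- * 9`, the 9 coming from `δ ^ 2`.
  refine ⟨18 * E * (E + d₀) + 1, by positivity, min (1 / (6 * K)) (t₀ / d₀), by positivity, ?_⟩
  set γ := min (1 / (6 * K)) (t₀ / d₀) with hγ
  have hγ0 : 0 < γ := by positivity
  intro d hd hdd g G hG i j r r' s b b' φ k hsub hs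
  have hγK : K * γ ≤ 1 / 6 := by
    calc K * γ ≤ K * (1 / (6 * K)) := mul_le_mul_of_nonneg_left (min_le_left _ _) hK.le
      _ = 1 / 6 := by field_simp
  have hγt : γ * d ≤ t₀ := by
    calc γ * d ≤ t₀ / d₀ * d₀ := mul_le_mul (min_le_right _ _) hdd hd.le (by positivity)
      _ = t₀ := by field_simp
  have hmem : ∀ z : ℂ, |z.re| ≤ E + d / 3 → |z.im| ≤ d / 3 → M.distToInterval z < d := by
    intro z h1 h2
    exact (M.distToInterval_le_of_abs_le (by positivity) h1 h2).trans_lt (by linarith)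
  have hmain := (hherm j r' b').norm_matrixFunction_sub_le φ (E := E) (δ := d / 3) (s := s)
    (t := γ * d) (hhop.norm_hamiltonian_le j r' b') (by positivity) (by positivity)
    (w := fun x => ‖M.shiftedPosition j b' x - M.shiftedPosition j b' (φ k)‖) (y₀ := k)
    (by simp) hs (((hconj j r' b').2 _ _ (by positivity) hγt).trans (by nlinarith))
    (g := g) (G := G) (supNear_nonneg d G)
    (hG.1.differentiableOn.mono fun z hz => (hmem z hz.1 hz.2).le)
    (fun z hz => hG.norm_le_supNear (hmem z hz.1 hz.2.1))
    (fun x hx => hG.2 x ((M.distToInterval_le x (abs_le.1 hx)).trans (by simpa using hd.le)))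
  rw [hsub]
  refine hmain.trans ?_
  have hS := supNear_nonneg (M := M) d G
  have hexp := Real.exp_nonneg (-(γ * d) * s)
  have h1 : M.supNear d G * (2 * E / (d / 3) ^ 2 * Real.exp (-(γ * d) * s)) * (E + d / 3 + d / 3)
      = (18 * E * (E + d / 3 + d / 3)) * ((d ^ 2)⁻¹ * M.supNear d G * Real.exp (-(γ * d) * s)) := by
    field_simp
    ring
  rw [h1, neg_mul γ d, mul_assoc (_ * (d ^ 2)⁻¹),
    mul_assoc (18 * E * (E + d₀) + 1), ← mul_assoc (d ^ 2)⁻¹]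
  refine mul_le_mul_of_nonneg_right ?_ (by positivity)
  have : 18 * E * (E + d / 3 + d / 3) ≤ 18 * E * (E + d₀) :=
    mul_le_mul_of_nonneg_left (by linarith) (by positivity)
  linarith

end Bilayer

/-! ### Polynomial approximation and the local density of states -/

/-- A complex polynomial as a continuous function on the real line. -/
def Polynomial.toRealContinuousMap (P : Polynomial ℂ) : C(ℝ, ℂ) :=
  ⟨fun x => P.eval (x : ℂ), by fun_prop⟩

/-- Weierstrass for the real and the imaginary part. Polynomials serve twice: they are entire, so
the analytic estimates apply, and their values at a matrix depend continuously on its entries. -/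
theorem ContinuousMap.exists_polynomial_near (g : C(ℝ, ℂ)) (E : ℝ) {ε : ℝ} (hε : 0 < ε) :
    ∃ P : Polynomial ℂ, ∀ x ∈ Set.Icc (-E) E, ‖g x - P.toRealContinuousMap x‖ ≤ ε := by
  obtain ⟨p, hp⟩ := exists_polynomial_near_of_continuousOn (-E) E (fun x => (g x).re)
    (by fun_prop) (ε / 2) (by positivity)
  obtain ⟨q, hq⟩ := exists_polynomial_near_of_continuousOn (-E) E (fun x => (g x).im)
    (by fun_prop) (ε / 2) (by positivity)
  refine ⟨p.map Complex.ofRealHom + Polynomial.C Complex.I * q.map Complex.ofRealHom,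
    fun x hx => ?_⟩
  have h1 : ∀ p : Polynomial ℝ, (p.map Complex.ofRealHom).eval (x : ℂ) = (p.eval x : ℝ) := by
    intro p
    rw [← Complex.ofRealHom_eq_coe, Polynomial.eval_map, Polynomial.eval₂_hom,
      Complex.ofRealHom_eq_coe]
  have h2 : g x - (p.map Complex.ofRealHom
      + Polynomial.C Complex.I * q.map Complex.ofRealHom).toRealContinuousMap x
      = (((g x).re - p.eval x : ℝ) : ℂ) + (((g x).im - q.eval x : ℝ) : ℂ) * Complex.I := by
    simp only [Polynomial.toRealContinuousMap, ContinuousMap.coe_mk, Polynomial.eval_add,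
      Polynomial.eval_mul, Polynomial.eval_C, h1]
    conv_lhs => rw [← Complex.re_add_im (g x)]
    push_cast
    ring
  rw [h2]
  refine (norm_add_le _ _).trans ?_
  rw [norm_mul, Complex.norm_I, mul_one, Complex.norm_real, Complex.norm_real]
  have h3 := (hp x hx).le
  have h4 := (hq x hx).le
  rw [abs_sub_comm] at h3 h4
  simp only [Real.norm_eq_abs]
  linarith

theorem Real.tendsto_mul_exp_neg_mul_sub (a c : ℝ) {γ : ℝ} (hγ : 0 < γ) :
    Tendsto (fun r : ℝ => a * Real.exp (-γ * (r - c))) atTop (𝓝 0) := by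
  rw [← mul_zero a]
  refine Tendsto.const_mul _ (Real.tendsto_exp_atBot.comp ?_)
  refine Tendsto.const_mul_atTop_of_neg (by linarith) ?_
  exact tendsto_atTop_add_const_right _ _ tendsto_id

namespace Bilayer

-- A diagonal entry averages `g` over a spectrum inside `[-E, E]` with probability weights. This
-- stability is uniform over clusters and carries results from polynomials to continuous functions.
open Matrix in
theorem norm_matrixFunction_diag_sub_le {n : Type*} [Fintype n] [DecidableEq n]
    {B : Matrix n n ℂ} (hB : B.IsHermitian) {E : ℝ} (hE : ‖toEuclideanCLM (𝕜 := ℂ) B‖ ≤ E)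
    {g g' : ℝ → ℂ} {ε : ℝ} (h : ∀ x ∈ Set.Icc (-E) E, ‖g x - g' x‖ ≤ ε) (k : n) :
    ‖matrixFunction B g k k - matrixFunction B g' k k‖ ≤ ε := by
  obtain ⟨p, hp0, hp1, hp, -, -⟩ := hB.exists_spectral_weights k
  rw [hp, hp, ← Finset.sum_sub_distrib]
  refine (norm_sum_le _ _).trans ?_
  calc _ ≤ ∑ i, p i * ε := by
        refine Finset.sum_le_sum fun i _ => ?_
        rw [← mul_sub, norm_mul, Complex.norm_real, Real.norm_of_nonneg (hp0 i)]
        exact mul_le_mul_of_nonneg_left (h _ (abs_le.1 ((hB.abs_eigenvalues_le i).trans hE)))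
          (hp0 i)
    _ = ε := by rw [← Finset.sum_mul, hp1, one_mul]

theorem matrixFunction_diag_add {n : Type*} [Fintype n] [DecidableEq n]
    {B : Matrix n n ℂ} (hB : B.IsHermitian) (g g' : ℝ → ℂ) (k : n) :
    matrixFunction B (g + g') k k = matrixFunction B g k k + matrixFunction B g' k k := by
  obtain ⟨p, -, -, hp, -, -⟩ := hB.exists_spectral_weights k
  simp only [hp, Pi.add_apply, mul_add, Finset.sum_add_distrib]

theorem matrixFunction_diag_smul {n : Type*} [Fintype n] [DecidableEq n]
    {B : Matrix n n ℂ} (hB : B.IsHermitian) (c : ℂ) (g : ℝ → ℂ) (k : n) :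
    matrixFunction B (c • g) k k = c * matrixFunction B g k k := by
  obtain ⟨p, -, -, hp, -, -⟩ := hB.exists_spectral_weights k
  simp only [hp, Pi.smul_apply, smul_eq_mul, Finset.mul_sum]
  exact Finset.sum_congr rfl fun i _ => by ring

theorem matrixFunction_diag_polynomial {n : Type*} [Fintype n] [DecidableEq n]
    {B : Matrix n n ℂ} (hB : B.IsHermitian) (P : Polynomial ℂ) (k : n) :
    matrixFunction B P.toRealContinuousMap k k
      = ∑ m ∈ Finset.range (P.natDegree + 1), P.coeff m * (B ^ m) k k := by
  obtain ⟨p, -, -, hp, hpow, -⟩ := hB.exists_spectral_weights k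
  simp only [hp, hpow, Polynomial.toRealContinuousMap, ContinuousMap.coe_mk,
    Polynomial.eval_eq_sum_range, Finset.mul_sum]
  rw [Finset.sum_comm]
  exact Finset.sum_congr rfl fun m _ => Finset.sum_congr rfl fun i _ => by ring

variable {M : Bilayer.{u}}

theorem isAnalyticWithin_polynomial (d : ℝ) (P : Polynomial ℂ) :
    M.IsAnalyticWithin d P.toRealContinuousMap fun z => P.eval z :=
  ⟨(AnalyticOnNhd.eval_polynomial P).mono (Set.subset_univ _), fun _ _ => rfl⟩

theorem clusterLdos_of_pos (j : Fin 2) (α : M.Orb j) {r : ℝ} (hr : 0 < r) (b : Plane) (g : ℝ → ℂ) :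
    M.clusterLdos j α r b g
      = matrixFunction (M.hamiltonian j r b) g (M.originSite j α hr) (M.originSite j α hr) :=
  dif_pos hr

theorem norm_clusterLdos_sub_le (hhop : M.RegularHopping) (hherm : M.IsHermitianModel)
    (j : Fin 2) (α : M.Orb j) (r : ℝ) (b : Plane) {g g' : ℝ → ℂ} {ε : ℝ}
    (h : ∀ x ∈ M.energyInterval, ‖g x - g' x‖ ≤ ε) :
    ‖M.clusterLdos j α r b g - M.clusterLdos j α r b g'‖ ≤ ε := by
  by_cases hr : 0 < r
  · rw [clusterLdos_of_pos j α hr, clusterLdos_of_pos j α hr]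
    exact norm_matrixFunction_diag_sub_le (hherm j r b) (hhop.norm_hamiltonian_le j r b) h _
  · rw [clusterLdos, clusterLdos, dif_neg hr, dif_neg hr, sub_zero, norm_zero]
    exact (norm_nonneg _).trans (h 0 ⟨by linarith [M.energyBound_nonneg], M.energyBound_nonneg⟩)

theorem clusterLdos_congr (hhop : M.RegularHopping) (hherm : M.IsHermitianModel)
    (j : Fin 2) (α : M.Orb j) (r : ℝ) (b : Plane) {g g' : ℝ → ℂ}
    (h : ∀ x ∈ M.energyInterval, g x = g' x) :
    M.clusterLdos j α r b g = M.clusterLdos j α r b g' := by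
  have h1 := norm_clusterLdos_sub_le hhop hherm j α r b (g := g) (g' := g') (ε := 0)
    fun x hx => by rw [h x hx, sub_self, norm_zero]
  exact sub_eq_zero.1 (norm_le_zero_iff.1 h1)

theorem clusterLdos_add (hherm : M.IsHermitianModel)
    (j : Fin 2) (α : M.Orb j) (r : ℝ) (b : Plane) (g g' : ℝ → ℂ) :
    M.clusterLdos j α r b (g + g') = M.clusterLdos j α r b g + M.clusterLdos j α r b g' := by
  by_cases hr : 0 < r
  · simp only [clusterLdos_of_pos j α hr]
    exact matrixFunction_diag_add (hherm j r b) _ _ _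
  · simp [clusterLdos, dif_neg hr]

theorem clusterLdos_smul (hherm : M.IsHermitianModel)
    (j : Fin 2) (α : M.Orb j) (r : ℝ) (b : Plane) (c : ℂ) (g : ℝ → ℂ) :
    M.clusterLdos j α r b (c • g) = c * M.clusterLdos j α r b g := by
  by_cases hr : 0 < r
  · simp only [clusterLdos_of_pos j α hr]
    exact matrixFunction_diag_smul (hherm j r b) _ _ _
  · simp [clusterLdos, dif_neg hr]

theorem continuous_hamiltonian (hhop : M.RegularHopping) (j : Fin 2)
    (r : ℝ) : Continuous fun b => M.hamiltonian j r b := by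
  refine continuous_matrix fun k l => ?_
  refine (hhop.1 _ _).continuous.comp ?_
  fun_prop

/-- For polynomials the entries of powers of the Hamiltonian are continuous in `b`; the
approximation of `g` is uniform in `b`. -/
theorem continuous_clusterLdos (hhop : M.RegularHopping) (hherm : M.IsHermitianModel)
    (j : Fin 2) (α : M.Orb j) (r : ℝ) (g : C(ℝ, ℂ)) :
    Continuous fun b => M.clusterLdos j α r b g := by
  by_cases hr : 0 < r
  · refine continuous_of_uniform_approx_of_continuous fun u hu => ?_
    obtain ⟨ε, hε, hεu⟩ := Metric.mem_uniformity_dist.1 hu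
    obtain ⟨P, hP⟩ := g.exists_polynomial_near M.energyBound (half_pos hε)
    refine ⟨fun b => M.clusterLdos j α r b P.toRealContinuousMap, ?_, fun b => hεu ?_⟩
    · simp only [clusterLdos_of_pos j α hr, matrixFunction_diag_polynomial (hherm j r _)]
      refine continuous_finsetSum _ fun m _ => continuous_const.mul ?_
      have h1 := (continuous_hamiltonian hhop j r).pow m
      exact h1.matrix_elem _ _
    · rw [dist_eq_norm]
      exact (norm_clusterLdos_sub_le hhop hherm j α r b hP).trans_lt (half_lt_self hε)
  · simp only [clusterLdos, dif_neg hr]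
    exact continuous_const

/-- The truncation estimate for the local density of states of concentric clusters. -/
theorem exists_norm_clusterLdos_sub_le (hhop : M.RegularHopping) (hherm : M.IsHermitianModel)
    {d₀ : ℝ} (hd₀ : 0 < d₀) :
    ∃ C > (0 : ℝ), ∃ γ > (0 : ℝ), ∀ d : ℝ, 0 < d → d ≤ d₀ → ∀ (g : C(ℝ, ℂ)) (G : ℂ → ℂ),
      M.IsAnalyticWithin d g G → ∀ (j : Fin 2) (α : M.Orb j) (r r' : ℝ) (b : Plane),
      0 < r → r ≤ r' →
      ‖M.clusterLdos j α r' b g - M.clusterLdos j α r b g‖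
        ≤ C * (d ^ 2)⁻¹ * M.supNear d G * Real.exp (-γ * d * (r - ‖b‖)) := by
  obtain ⟨C, hC, γ, hγ, h⟩ := hhop.exists_truncation hherm hd₀
  refine ⟨C, hC, γ, hγ, fun d hd hdd g G hG j α r r' b hr hrr' => ?_⟩
  have hle : ∀ i, r + ‖M.latticePoint i ((0 : Fin 2 → Fin 2 → ℤ) i)‖ ≤ r' := by
    intro i
    simpa using hrr'
  have horigin : M.clusterTranslation 0 hle (M.originSite j α hr)
      = M.originSite j α (hr.trans_le hrr') := by
    refine Subtype.ext ?_
    simp [clusterTranslation, originSite]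
  rw [clusterLdos_of_pos j α hr, clusterLdos_of_pos j α (hr.trans_le hrr'), ← horigin]
  -- Removed sites have norm at least `r` before the shift, which moves a site by at most `‖b‖`.
  refine h d hd hdd g G hG j j r r' (r - ‖b‖) b b (M.clusterTranslation 0 hle) _
    (M.hamiltonian_eq_submatrix 0 hle (v := 0) (by simp)) fun x hx => ?_
  have h1 := M.le_norm_of_notMem_range_clusterTranslation 0 hle hx
  have h2 : M.shiftedPosition j b (M.clusterTranslation 0 hle (M.originSite j α hr)) = 0 := by
    rw [shiftedPosition_eq, position_clusterTranslation]
    have h3 : M.position (M.originSite j α hr) = 0 := M.latticePoint_zero j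
    have h4 : sheetShift j b (M.clusterTranslation 0 hle (M.originSite j α hr)).1.1 = 0 :=
      if_neg (other_ne j).symm
    rw [h3, h4]
    simp
  rw [h2, sub_zero, shiftedPosition_eq]
  simp only [Pi.zero_apply, latticePoint_zero, sub_zero] at h1
  have h4 := norm_sub_le (sheetShift j b x.1.1 + M.position x) (sheetShift j b x.1.1)
  rw [add_sub_cancel_left] at h4
  linarith [norm_sheetShift_le j b x.1.1]

/-- The truncation estimate makes the net Cauchy for a polynomial; the error of replacing `g` by a
polynomial does not depend on the radius. -/
theorem exists_tendsto_clusterLdos (hhop : M.RegularHopping) (hherm : M.IsHermitianModel)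
    (j : Fin 2) (α : M.Orb j) (b : Plane) (g : C(ℝ, ℂ)) :
    ∃ x, Tendsto (fun r : ℝ => M.clusterLdos j α r b g) atTop (𝓝 x) := by
  refine cauchySeq_tendsto_of_complete (Metric.cauchySeq_iff'.2 fun ε hε => ?_)
  obtain ⟨P, hP⟩ := g.exists_polynomial_near M.energyBound (show 0 < ε / 4 by positivity)
  obtain ⟨C, hC, γ, hγ, h⟩ := exists_norm_clusterLdos_sub_le hhop hherm one_pos
  have hlim : Tendsto (fun r : ℝ => C * ((1 : ℝ) ^ 2)⁻¹ * M.supNear 1 (fun z => P.eval z)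
      * Real.exp (-γ * 1 * (r - ‖b‖))) atTop (𝓝 0) := by
    rw [neg_mul]
    exact Real.tendsto_mul_exp_neg_mul_sub _ _ (by linarith)
  obtain ⟨N, hN, hN0⟩ := ((hlim.eventually (gt_mem_nhds (show 0 < ε / 4 by positivity))).and
    (eventually_gt_atTop 0)).exists
  refine ⟨N, fun r hr => ?_⟩
  have h1 := h 1 one_pos le_rfl _ _ (isAnalyticWithin_polynomial (M := M) 1 P) j α N r b hN0 hr
  have h2 := norm_clusterLdos_sub_le hhop hherm j α r b hP
  have h3 := norm_clusterLdos_sub_le hhop hherm j α N b hP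
  rw [norm_sub_rev] at h3
  rw [dist_eq_norm]
  have h4 := norm_add₃_le
    (a := M.clusterLdos j α r b g - M.clusterLdos j α r b P.toRealContinuousMap)
    (b := M.clusterLdos j α r b P.toRealContinuousMap
      - M.clusterLdos j α N b P.toRealContinuousMap)
    (c := M.clusterLdos j α N b P.toRealContinuousMap - M.clusterLdos j α N b g)
  rw [sub_add_sub_cancel, sub_add_sub_cancel] at h4
  linarith

/-- The extension to the real line of a continuous function on `S[H]`, as a continuous map. -/
def extendMap (f : C(M.energyInterval, ℂ)) : C(ℝ, ℂ) :=
  ⟨M.extend f, f.continuous.Icc_extend'⟩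

theorem extendMap_apply (f : C(M.energyInterval, ℂ)) (x : M.energyInterval) :
    extendMap f x = f x :=
  Set.IccExtend_val _ _ _

theorem tendsto_clusterLdos_extend (hhop : M.RegularHopping) (hherm : M.IsHermitianModel)
    (j : Fin 2) (α : M.Orb j) (b : Plane) (f : C(M.energyInterval, ℂ)) :
    Tendsto (fun r : ℝ => M.clusterLdos j α r b (M.extend f)) atTop (𝓝 (M.ldos j α b f)) :=
  tendsto_nhds_limUnder (exists_tendsto_clusterLdos hhop hherm j α b (extendMap f))

theorem tendsto_clusterLdos (hhop : M.RegularHopping) (hherm : M.IsHermitianModel)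
    (j : Fin 2) (α : M.Orb j) (b : Plane) (g : C(ℝ, ℂ)) :
    Tendsto (fun r : ℝ => M.clusterLdos j α r b g) atTop
      (𝓝 (M.ldos j α b (g.restrict M.energyInterval))) := by
  refine (tendsto_clusterLdos_extend hhop hherm j α b _).congr fun r => ?_
  refine clusterLdos_congr hhop hherm j α r b fun x hx => ?_
  exact extendMap_apply (g.restrict M.energyInterval) ⟨x, hx⟩

theorem norm_ldos_sub_le (hhop : M.RegularHopping) (hherm : M.IsHermitianModel)
    (j : Fin 2) (α : M.Orb j) (b : Plane) {f f' : C(M.energyInterval, ℂ)} {ε : ℝ}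
    (h : ∀ x, ‖f x - f' x‖ ≤ ε) : ‖M.ldos j α b f - M.ldos j α b f'‖ ≤ ε := by
  refine le_of_tendsto ((tendsto_clusterLdos_extend hhop hherm j α b f).sub
    (tendsto_clusterLdos_extend hhop hherm j α b f')).norm (Eventually.of_forall fun r => ?_)
  refine norm_clusterLdos_sub_le hhop hherm j α r b fun x hx => ?_
  have h1 : M.extend f x = f ⟨x, hx⟩ := extendMap_apply f ⟨x, hx⟩
  have h2 : M.extend f' x = f' ⟨x, hx⟩ := extendMap_apply f' ⟨x, hx⟩
  rw [h1, h2]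
  exact h _

theorem ldos_add (hhop : M.RegularHopping) (hherm : M.IsHermitianModel)
    (j : Fin 2) (α : M.Orb j) (b : Plane) (f f' : C(M.energyInterval, ℂ)) :
    M.ldos j α b (f + f') = M.ldos j α b f + M.ldos j α b f' := by
  refine tendsto_nhds_unique (tendsto_clusterLdos_extend hhop hherm j α b (f + f')) ?_
  refine ((tendsto_clusterLdos_extend hhop hherm j α b f).add
    (tendsto_clusterLdos_extend hhop hherm j α b f')).congr fun r => ?_
  rw [← clusterLdos_add hherm]
  rfl

theorem ldos_smul (hhop : M.RegularHopping) (hherm : M.IsHermitianModel)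
    (j : Fin 2) (α : M.Orb j) (b : Plane) (c : ℂ) (f : C(M.energyInterval, ℂ)) :
    M.ldos j α b (c • f) = c * M.ldos j α b f := by
  refine tendsto_nhds_unique (tendsto_clusterLdos_extend hhop hherm j α b (c • f)) ?_
  refine ((tendsto_clusterLdos_extend hhop hherm j α b f).const_mul c).congr fun r => ?_
  rw [← clusterLdos_smul hherm]
  rfl

theorem norm_ldos_le (hhop : M.RegularHopping) (hherm : M.IsHermitianModel)
    (j : Fin 2) (α : M.Orb j) (b : Plane) (f : C(M.energyInterval, ℂ)) : ‖M.ldos j α b f‖ ≤ ‖f‖ := by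
  have h0 : M.ldos j α b 0 = 0 := by
    have h := ldos_smul hhop hherm j α b 0 0
    rw [zero_mul] at h
    have h' : (0 : ℂ) • (0 : C(M.energyInterval, ℂ)) = 0 :=
      ContinuousMap.ext fun x => zero_mul _
    rwa [h'] at h
  have h1 := norm_ldos_sub_le hhop hherm j α b (f := f) (f' := 0) (ε := ‖f‖) fun x => by
    simpa using f.norm_coe_le_norm x
  rwa [h0, sub_zero] at h1

theorem exists_norm_ldos_sub_le (hhop : M.RegularHopping) (hherm : M.IsHermitianModel)
    {d₀ : ℝ} (hd₀ : 0 < d₀) :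
    ∃ C > (0 : ℝ), ∃ γ > (0 : ℝ), ∀ d : ℝ, 0 < d → d ≤ d₀ → ∀ (g : C(ℝ, ℂ)) (G : ℂ → ℂ),
      M.IsAnalyticWithin d g G → ∀ (j : Fin 2) (α : M.Orb j) (r : ℝ) (b : Plane), 0 < r →
      ‖M.ldos j α b (g.restrict M.energyInterval) - M.clusterLdos j α r b g‖
        ≤ C * (d ^ 2)⁻¹ * M.supNear d G * Real.exp (-γ * d * (r - ‖b‖)) := by
  obtain ⟨C, hC, γ, hγ, h⟩ := exists_norm_clusterLdos_sub_le hhop hherm hd₀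
  refine ⟨C, hC, γ, hγ, fun d hd hdd g G hG j α r b hr => ?_⟩
  refine le_of_tendsto ((tendsto_clusterLdos hhop hherm j α b g).sub_const _).norm ?_
  filter_upwards [eventually_ge_atTop r] with r' hr'
  exact h d hd hdd g G hG j α r r' b hr hr'

/-- Two approximations are nested. Polynomials approximate uniformly in `b`; for a polynomial the
clusters approximate only locally uniformly, since the truncation error grows with `‖b‖`. -/
theorem continuous_ldos (hhop : M.RegularHopping) (hherm : M.IsHermitianModel)
    (j : Fin 2) (α : M.Orb j) (f : C(M.energyInterval, ℂ)) : Continuous fun b => M.ldos j α b f := by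
  refine continuous_of_uniform_approx_of_continuous fun u hu => ?_
  obtain ⟨ε, hε, hεu⟩ := Metric.mem_uniformity_dist.1 hu
  obtain ⟨P, hP⟩ := (extendMap f).exists_polynomial_near M.energyBound (half_pos hε)
  refine ⟨fun b => M.ldos j α b (P.toRealContinuousMap.restrict M.energyInterval), ?_,
    fun b => hεu ?_⟩
  · refine continuous_of_locally_uniform_approx_of_continuousAt fun b₀ v hv => ?_
    obtain ⟨η, hη, hηv⟩ := Metric.mem_uniformity_dist.1 hv
    obtain ⟨C, hC, γ, hγ, h⟩ := exists_norm_ldos_sub_le hhop hherm one_pos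
    have hlim : Tendsto (fun r : ℝ => C * ((1 : ℝ) ^ 2)⁻¹ * M.supNear 1 (fun z => P.eval z)
        * Real.exp (-γ * 1 * (r - (‖b₀‖ + 1)))) atTop (𝓝 0) := by
      rw [neg_mul]
      exact Real.tendsto_mul_exp_neg_mul_sub _ _ (by linarith)
    obtain ⟨r, hr, hr0⟩ := ((hlim.eventually (gt_mem_nhds hη)).and
      (eventually_gt_atTop 0)).exists
    refine ⟨Metric.ball b₀ 1, Metric.ball_mem_nhds _ one_pos,
      fun b => M.clusterLdos j α r b P.toRealContinuousMap,
      (continuous_clusterLdos hhop hherm j α r _).continuousAt, fun b hb => hηv ?_⟩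
    rw [dist_eq_norm]
    refine (h 1 one_pos le_rfl _ _ (isAnalyticWithin_polynomial (M := M) 1 P) j α r b hr0).trans_lt
      (lt_of_le_of_lt ?_ hr)
    have hb' : ‖b‖ ≤ ‖b₀‖ + 1 := by
      have h1 := norm_add_le (b - b₀) b₀
      rw [sub_add_cancel] at h1
      rw [Metric.mem_ball, dist_eq_norm] at hb
      linarith
    have hS := supNear_nonneg (M := M) 1 fun z => P.eval z
    refine mul_le_mul_of_nonneg_left (Real.exp_le_exp.2 ?_) (by positivity)
    nlinarith
  · rw [dist_eq_norm]
    refine (norm_ldos_sub_le hhop hherm j α b fun x => ?_).trans_lt (half_lt_self hε)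
    have := hP x x.2
    rwa [extendMap_apply] at this

end Bilayer

/-! ### Averages over the unit cells -/

namespace Bilayer

variable (M : Bilayer.{u})

theorem continuous_coordinates (i : Fin 2) : Continuous (M.coordinates i) :=
  continuous_const.matrix_mulVec (PiLp.continuous_ofLp 2 _)

theorem continuous_ofCoordinates (i : Fin 2) : Continuous (M.ofCoordinates i) :=
  (PiLp.continuous_toLp 2 _).comp (continuous_const.matrix_mulVec continuous_id)

theorem cell_eq_preimage (i : Fin 2) :
    M.cell i = M.coordinates i ⁻¹' Set.univ.pi fun _ => Set.Ico (0 : ℝ) 1 := by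
  ext x
  simp only [Set.mem_preimage, Set.mem_univ_pi]
  constructor
  · rintro ⟨t, ht, rfl⟩
    have h := M.coordinates_ofCoordinates i t
    rw [ofCoordinates] at h
    rw [h]
    exact ht
  · intro hx
    exact ⟨_, hx, M.ofCoordinates_coordinates i x⟩

theorem isBounded_cell (i : Fin 2) : Bornology.IsBounded (M.cell i) := by
  have h : IsCompact (M.ofCoordinates i '' Set.univ.pi fun _ => Set.Icc (0 : ℝ) 1) :=
    (isCompact_univ_pi fun _ => isCompact_Icc).image (M.continuous_ofCoordinates i)
  refine h.isBounded.subset ?_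
  rintro _ ⟨t, ht, rfl⟩
  exact ⟨t, fun k _ => ⟨(ht k).1, (ht k).2.le⟩, rfl⟩

theorem volume_cell_lt_top (i : Fin 2) : volume (M.cell i) < ⊤ :=
  (M.isBounded_cell i).measure_lt_top

theorem integrableOn_cell (i : Fin 2) {f : Plane → ℂ} (hf : Continuous f) :
    IntegrableOn f (M.cell i) volume := by
  obtain ⟨R, hR⟩ := (M.isBounded_cell i).subset_closedBall 0
  exact (hf.continuousOn.integrableOn_compact (isCompact_closedBall 0 R)).mono_set hR

theorem exists_norm_le_of_mem_cell : ∃ R : ℝ, 0 ≤ R ∧ ∀ i, ∀ b ∈ M.cell i, ‖b‖ ≤ R := by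
  choose R hR using fun i => (M.isBounded_cell i).subset_closedBall 0
  refine ⟨max 0 (max (R 0) (R 1)), le_max_left _ _, fun i b hb => ?_⟩
  have h := hR i hb
  rw [Metric.mem_closedBall, dist_zero_right] at h
  fin_cases i
  · exact h.trans ((le_max_left _ _).trans (le_max_right _ _))
  · exact h.trans ((le_max_right _ _).trans (le_max_right _ _))

theorem nu_nonneg : 0 ≤ M.nu := by
  rw [nu]
  positivity

variable {M}

/-- The density of states of the infinite system, as the average of the local densities of states
over the unit cells. -/
def dosLimit (hhop : M.RegularHopping) (hherm : M.IsHermitianModel) :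
    C(M.energyInterval, ℂ) →L[ℂ] ℂ :=
  LinearMap.mkContinuous
    { toFun := fun f => (M.nu : ℂ) * ∑ j : Fin 2, ∑ α : M.Orb j,
        ∫ b in M.cell (other j), M.ldos j α b f
      map_add' := fun f f' => by
        have h : ∀ (j : Fin 2) (α : M.Orb j), ∫ b in M.cell (other j), M.ldos j α b (f + f')
            = (∫ b in M.cell (other j), M.ldos j α b f)
              + ∫ b in M.cell (other j), M.ldos j α b f' := by
          intro j α
          simp only [ldos_add hhop hherm]
          exact integral_add (M.integrableOn_cell _ (continuous_ldos hhop hherm j α f))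
            (M.integrableOn_cell _ (continuous_ldos hhop hherm j α f'))
        simp only [h, Finset.sum_add_distrib, mul_add]
      map_smul' := fun c f => by
        have h : ∀ (j : Fin 2) (α : M.Orb j), ∫ b in M.cell (other j), M.ldos j α b (c • f)
            = c * ∫ b in M.cell (other j), M.ldos j α b f := by
          intro j α
          rw [← integral_const_mul]
          congr 1
          funext b
          exact ldos_smul hhop hherm j α b c f
        simp only [h, ← Finset.mul_sum, RingHom.id_apply, smul_eq_mul]
        ring }
    (M.nu * ∑ j : Fin 2, ∑ _α : M.Orb j, volume.real (M.cell (other j))) fun f => by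
      simp only [LinearMap.coe_mk, AddHom.coe_mk]
      rw [norm_mul, Complex.norm_real, Real.norm_of_nonneg M.nu_nonneg, mul_assoc]
      refine mul_le_mul_of_nonneg_left ?_ M.nu_nonneg
      rw [Finset.sum_mul]
      refine (norm_sum_le _ _).trans (Finset.sum_le_sum fun j _ => ?_)
      rw [Finset.sum_mul]
      refine (norm_sum_le _ _).trans (Finset.sum_le_sum fun α _ => ?_)
      rw [mul_comm]
      exact norm_setIntegral_le_of_norm_le_const (M.volume_cell_lt_top _)
        fun b _ => norm_ldos_le hhop hherm j α b f

theorem dosLimit_apply (hhop : M.RegularHopping) (hherm : M.IsHermitianModel)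
    (f : C(M.energyInterval, ℂ)) :
    dosLimit hhop hherm f = (M.nu : ℂ) * ∑ j : Fin 2, ∑ α : M.Orb j,
      ∫ b in M.cell (other j), M.ldos j α b f := rfl

/-- The local estimate is integrated. The loss `exp (γ * d * ‖b‖)` is at most `exp (γ * d₀ * R)` on
the bounded cells, which is where the constant comes to depend on `d₀`. -/
theorem exists_norm_dosLimit_sub_le (hhop : M.RegularHopping) (hherm : M.IsHermitianModel)
    {d₀ : ℝ} (hd₀ : 0 < d₀) :
    ∃ C > (0 : ℝ), ∃ γ > (0 : ℝ), ∀ d : ℝ, 0 < d → d ≤ d₀ → ∀ (g : C(ℝ, ℂ)) (G : ℂ → ℂ),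
      M.IsAnalyticWithin d g G → ∀ r : ℝ, 0 < r →
      ‖dosLimit hhop hherm (g.restrict M.energyInterval) - (M.nu : ℂ) * ∑ j : Fin 2,
          ∑ α : M.Orb j, ∫ b in M.cell (other j), M.clusterLdos j α r b g‖
        ≤ C * (d ^ 2)⁻¹ * M.supNear d G * Real.exp (-γ * d * r) := by
  obtain ⟨C, hC, γ, hγ, h⟩ := exists_norm_ldos_sub_le hhop hherm hd₀
  obtain ⟨R, hR0, hR⟩ := M.exists_norm_le_of_mem_cell
  set V : ℝ := M.nu * ∑ j : Fin 2, ∑ _α : M.Orb j, volume.real (M.cell (other j)) with hV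
  have hV0 : 0 ≤ V := mul_nonneg M.nu_nonneg (by positivity)
  refine ⟨C * Real.exp (γ * d₀ * R) * (V + 1), by positivity, γ, hγ,
    fun d hd hdd g G hG r hr => ?_⟩
  have hS := supNear_nonneg (M := M) d G
  set X : ℝ := C * (d ^ 2)⁻¹ * M.supNear d G * (Real.exp (γ * d₀ * R) * Real.exp (-γ * d * r))
    with hX
  have hX0 : 0 ≤ X := by positivity
  have hbound : ∀ (j : Fin 2) (α : M.Orb j), ∀ b ∈ M.cell (other j),
      ‖M.ldos j α b (g.restrict M.energyInterval) - M.clusterLdos j α r b g‖ ≤ X := by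
    intro j α b hb
    refine (h d hd hdd g G hG j α r b hr).trans (mul_le_mul_of_nonneg_left ?_ (by positivity))
    rw [← Real.exp_add, Real.exp_le_exp]
    have h1 : γ * d * ‖b‖ ≤ γ * d₀ * R := by
      have := hR _ b hb
      gcongr
    linarith
  have hint : ∀ (j : Fin 2) (α : M.Orb j),
      ‖(∫ b in M.cell (other j), M.ldos j α b (g.restrict M.energyInterval))
        - ∫ b in M.cell (other j), M.clusterLdos j α r b g‖
        ≤ X * volume.real (M.cell (other j)) := by
    intro j α
    rw [← integral_sub (M.integrableOn_cell _ (continuous_ldos hhop hherm j α _))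
      (M.integrableOn_cell _ (continuous_clusterLdos hhop hherm j α r g))]
    exact norm_setIntegral_le_of_norm_le_const (M.volume_cell_lt_top _) (hbound j α)
  have hsum : ‖dosLimit hhop hherm (g.restrict M.energyInterval) - (M.nu : ℂ) * ∑ j : Fin 2,
      ∑ α : M.Orb j, ∫ b in M.cell (other j), M.clusterLdos j α r b g‖ ≤ V * X := by
    rw [dosLimit_apply, ← mul_sub, norm_mul, Complex.norm_real, Real.norm_of_nonneg M.nu_nonneg,
      hV, mul_assoc]
    refine mul_le_mul_of_nonneg_left ?_ M.nu_nonneg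
    simp only [← Finset.sum_sub_distrib, Finset.sum_mul]
    refine (norm_sum_le _ _).trans (Finset.sum_le_sum fun j _ => ?_)
    refine (norm_sum_le _ _).trans (Finset.sum_le_sum fun α _ => ?_)
    rw [mul_comm]
    exact hint j α
  refine hsum.trans ?_
  calc V * X ≤ (V + 1) * X := mul_le_mul_of_nonneg_right (by linarith) hX0
    _ = _ := by rw [hX]; ring

end Bilayer

/-! ### Counting lattice points and averaging characters -/

namespace Bilayer

variable (M : Bilayer.{u})

/-- The lattice points of sheet `i` in the open ball of radius `r`. -/
def latticeBall (i : Fin 2) (r : ℝ) : Finset (Fin 2 → ℤ) := (M.latticePoint_finite i r).toFinset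

theorem mem_latticeBall {i : Fin 2} {r : ℝ} {n : Fin 2 → ℤ} :
    n ∈ M.latticeBall i r ↔ ‖M.latticePoint i n‖ < r := by
  rw [latticeBall, Set.Finite.mem_toFinset]
  rfl

theorem latticeBall_mono (i : Fin 2) {r r' : ℝ} (h : r ≤ r') :
    M.latticeBall i r ⊆ M.latticeBall i r' := by
  intro n hn
  rw [mem_latticeBall] at hn ⊢
  exact hn.trans_le h

theorem ofCoordinates_smul (i : Fin 2) (c : ℝ) (t : Fin 2 → ℝ) :
    M.ofCoordinates i (c • t) = c • M.ofCoordinates i t := by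
  rw [ofCoordinates, Matrix.mulVec_smul, WithLp.toLp_smul, ofCoordinates]

theorem map_coordinates_volume (i : Fin 2) :
    Measure.map (M.coordinates i) volume = ENNReal.ofReal |(M.A i).det| • volume := by
  have hdet : ((M.A i)⁻¹).det ≠ 0 := by
    rw [Matrix.det_nonsing_inv, Ring.inverse_eq_inv']
    exact inv_ne_zero (M.det_ne_zero i)
  have h1 := Real.map_matrix_volume_pi_eq_smul_volume_pi hdet
  rw [Matrix.det_nonsing_inv, Ring.inverse_eq_inv', inv_inv] at h1
  rw [← h1, ← (PiLp.volume_preserving_ofLp (Fin 2)).map_eq, Measure.map_map]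
  · rfl
  · exact (LinearMap.continuous_of_finiteDimensional _).measurable
  · exact (PiLp.volume_preserving_ofLp (Fin 2)).measurable

theorem volume_real_coordinates_preimage (i : Fin 2) {s : Set (Fin 2 → ℝ)}
    (hs : MeasurableSet s) :
    volume.real (M.coordinates i ⁻¹' s) = |(M.A i).det| * volume.real s := by
  rw [measureReal_def, ← Measure.map_apply (M.continuous_coordinates i).measurable hs,
    map_coordinates_volume, Measure.smul_apply, smul_eq_mul, ENNReal.toReal_mul,
    ENNReal.toReal_ofReal (abs_nonneg _), measureReal_def]

theorem volume_real_cell (i : Fin 2) : volume.real (M.cell i) = |(M.A i).det| := by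
  rw [cell_eq_preimage, M.volume_real_coordinates_preimage i
    (MeasurableSet.univ_pi fun _ => measurableSet_Ico), measureReal_def, Real.volume_pi_Ico]
  simp

theorem volume_real_cell_pos (i : Fin 2) : 0 < volume.real (M.cell i) := by
  rw [volume_real_cell]
  exact abs_pos.2 (M.det_ne_zero i)

theorem setIntegral_cell (i : Fin 2) {F : Plane → ℂ} (hF : Continuous F) :
    ∫ x in M.cell i, F x = (|(M.A i).det| : ℝ) *
      ∫ t in Set.univ.pi fun _ : Fin 2 => Set.Ico (0 : ℝ) 1, F (M.ofCoordinates i t) := by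
  have hm : MeasurableSet (Set.univ.pi fun _ : Fin 2 => Set.Ico (0 : ℝ) 1) :=
    MeasurableSet.univ_pi fun _ => measurableSet_Ico
  have h1 := setIntegral_map (μ := (volume : Measure Plane)) hm
    (f := fun t => F (M.ofCoordinates i t)) (g := M.coordinates i)
    ((hF.comp (M.continuous_ofCoordinates i)).aestronglyMeasurable)
    (M.continuous_coordinates i).aemeasurable
  simp only [ofCoordinates_coordinates] at h1
  rw [cell_eq_preimage, ← h1, map_coordinates_volume, Measure.restrict_smul, integral_smul_measure,
    ENNReal.toReal_ofReal (abs_nonneg _), Complex.real_smul]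

-- In lattice coordinates the disc becomes a bounded convex set, whose boundary is null. The points
-- of `ℤ² / r` in it then number asymptotically `r ^ 2` times its area.
open scoped Pointwise in
theorem tendsto_card_latticeBall_div_sq (i : Fin 2) :
    Tendsto (fun r : ℝ => ((M.latticeBall i r).card : ℝ) / r ^ 2) atTop
      (𝓝 (volume.real (Metric.ball (0 : Plane) 1) / volume.real (M.cell i))) := by
  set s : Set (Fin 2 → ℝ) := M.ofCoordinates i ⁻¹' Metric.ball 0 1 with hs
  have hmeas : MeasurableSet s :=
    (M.continuous_ofCoordinates i).measurable Metric.isOpen_ball.measurableSet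
  have hball : Metric.ball (0 : Plane) 1 = M.coordinates i ⁻¹' s := by
    ext x
    rw [hs, Set.mem_preimage, Set.mem_preimage, ofCoordinates_coordinates]
  have hvol : volume.real (Metric.ball (0 : Plane) 1) / volume.real (M.cell i)
      = volume.real s := by
    rw [hball, M.volume_real_coordinates_preimage i hmeas, volume_real_cell,
      mul_div_cancel_left₀ _ (abs_pos.2 (M.det_ne_zero i)).ne']
  have hbdd : Bornology.IsBounded s := by
    refine ((isCompact_closedBall (0 : Plane) 1).image
      (M.continuous_coordinates i)).isBounded.subset fun t ht => ?_
    exact ⟨M.ofCoordinates i t, Metric.ball_subset_closedBall ht, M.coordinates_ofCoordinates i t⟩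
  have hconv : Convex ℝ s := by
    intro x hx y hy a b ha hb hab
    have h := convex_ball (0 : Plane) 1 hx hy ha hb hab
    rw [hs, Set.mem_preimage, ofCoordinates_add, ofCoordinates_smul, ofCoordinates_smul]
    exact h
  have hmem : ∀ t, t ∈ s ↔ ‖M.ofCoordinates i t‖ < 1 := by
    intro t
    rw [hs, Set.mem_preimage, Metric.mem_ball, dist_zero_right]
  -- Monotonicity of the dilates lets the limit run over real radii.
  have hstar : ∀ ⦃x y : ℝ⦄, 0 < x → x ≤ y → x • s ⊆ y • s := by
    rintro x y hx hxy _ ⟨a, ha, rfl⟩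
    have hy : 0 < y := hx.trans_le hxy
    refine ⟨(x / y) • a, ?_, ?_⟩
    · rw [hmem] at ha ⊢
      rw [ofCoordinates_smul, norm_smul, Real.norm_of_nonneg (by positivity)]
      have : x / y ≤ 1 := (div_le_one hy).2 hxy
      nlinarith [norm_nonneg (M.ofCoordinates i a), div_pos hx hy]
    · change y • (x / y) • a = x • a
      rw [smul_smul]
      congr 1
      field_simp
  have h1 := tendsto_card_div_pow_atTop_volume' s hbdd hmeas (hconv.addHaar_frontier volume) hstar
  rw [hvol]
  refine h1.congr' ?_
  filter_upwards [eventually_gt_atTop 0] with x hx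
  rw [Fintype.card_fin]
  congr 2
  have himage : s ∩ x⁻¹ • ((Submodule.span ℤ (Set.range (Pi.basisFun ℝ (Fin 2))) :
      Submodule ℤ (Fin 2 → ℝ)) : Set (Fin 2 → ℝ))
      = (fun n : Fin 2 → ℤ => x⁻¹ • (fun k => (n k : ℝ))) '' (M.latticeBall i x) := by
    ext t
    constructor
    · rintro ⟨ht, y, hy, rfl⟩
      rw [SetLike.mem_coe, (Pi.basisFun ℝ (Fin 2)).mem_span_iff_repr_mem ℤ] at hy
      choose n hn using hy
      have hny : (fun k => (n k : ℝ)) = y := by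
        funext k
        simpa using hn k
      refine ⟨n, ?_, by simp only [hny]⟩
      rw [Finset.mem_coe, mem_latticeBall, ← ofCoordinates_intCast, hny]
      change x⁻¹ • y ∈ s at ht
      rw [hmem, ofCoordinates_smul, norm_smul, Real.norm_of_nonneg (by positivity)] at ht
      rwa [inv_mul_lt_iff₀ hx, mul_one] at ht
    · rintro ⟨n, hn, rfl⟩
      rw [Finset.mem_coe, mem_latticeBall] at hn
      refine ⟨?_, fun k => (n k : ℝ), ?_, rfl⟩
      · rw [hmem, ofCoordinates_smul, norm_smul, Real.norm_of_nonneg (by positivity),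
          inv_mul_lt_iff₀ hx, mul_one]
        exact hn
      · rw [SetLike.mem_coe, (Pi.basisFun ℝ (Fin 2)).mem_span_iff_repr_mem ℤ]
        intro k
        exact ⟨n k, by simp⟩
  rw [himage, Nat.card_image_of_injective]
  · simp
  · intro m n h
    have h' := smul_right_injective (Fin 2 → ℝ) (inv_ne_zero hx.ne') h
    funext k
    exact_mod_cast congrFun h' k

theorem volume_real_unitBall_pos : 0 < volume.real (Metric.ball (0 : Plane) 1) :=
  ENNReal.toReal_pos (Metric.measure_ball_pos _ _ one_pos).ne' Metric.isBounded_ball.measure_lt_top.ne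

theorem card_latticeBall_pos (i : Fin 2) {r : ℝ} (hr : 0 < r) : 0 < (M.latticeBall i r).card :=
  Finset.card_pos.2 ⟨0, by rw [mem_latticeBall, latticePoint_zero, norm_zero]; exact hr⟩

/-- The lattice points in a boundary layer of fixed width are a negligible fraction. -/
theorem tendsto_card_latticeBall_sub_div (i : Fin 2) (c : ℝ) :
    Tendsto (fun r : ℝ => (((M.latticeBall i r).card : ℝ) - (M.latticeBall i (r - c)).card)
      / (M.latticeBall i r).card) atTop (𝓝 0) := by
  set v := volume.real (Metric.ball (0 : Plane) 1) / volume.real (M.cell i) with hv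
  have hv0 : v ≠ 0 := (div_pos volume_real_unitBall_pos (M.volume_real_cell_pos i)).ne'
  have h1 := M.tendsto_card_latticeBall_div_sq i
  have h2 : Tendsto (fun r : ℝ => ((M.latticeBall i (r - c)).card : ℝ) / (r - c) ^ 2
      * ((r - c) / r) ^ 2) atTop (𝓝 (v * 1 ^ 2)) := by
    refine (h1.comp (tendsto_atTop_add_const_right _ (-c) tendsto_id)).mul (Tendsto.pow ?_ 2)
    have h3 : Tendsto (fun r : ℝ => 1 - c / r) atTop (𝓝 (1 - 0)) :=
      tendsto_const_nhds.sub (tendsto_const_nhds.div_atTop tendsto_id)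
    rw [sub_zero] at h3
    refine h3.congr' ?_
    filter_upwards [eventually_gt_atTop 0] with r hr
    field_simp
  rw [one_pow, mul_one] at h2
  have h4 := (h1.sub h2).div h1 hv0
  rw [sub_self, zero_div] at h4
  refine h4.congr' ?_
  filter_upwards [eventually_gt_atTop 0, eventually_gt_atTop c] with r hr hrc
  have h5 : r - c ≠ 0 := (sub_pos.2 hrc).ne'
  have h6 : ((M.latticeBall i r).card : ℝ) ≠ 0 := by exact_mod_cast (M.card_latticeBall_pos i hr).ne'
  rw [Pi.div_apply]
  field_simp

/-- Averages over large balls of a lattice of a character which is not trivial on the lattice. -/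
theorem tendsto_sum_character_div (i : Fin 2) {χ : Plane → ℂ}
    (hadd : ∀ x y, χ (x + y) = χ x * χ y) (hnorm : ∀ x, ‖χ x‖ ≤ 1) {m : Fin 2 → ℤ}
    (hm : χ (M.latticePoint i m) ≠ 1) :
    Tendsto (fun r : ℝ => (∑ n ∈ M.latticeBall i r, χ (M.latticePoint i n))
      / ((M.latticeBall i r).card : ℂ)) atTop (𝓝 0) := by
  classical
  set c := ‖M.latticePoint i m‖ with hc
  set a := ‖χ (M.latticePoint i m) - 1‖ with ha
  have ha0 : 0 < a := norm_pos_iff.2 (sub_ne_zero.2 hm)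
  have hlim := (M.tendsto_card_latticeBall_sub_div i c).const_mul (2 / a)
  rw [mul_zero] at hlim
  refine squeeze_zero_norm' ?_ hlim
  filter_upwards [eventually_gt_atTop 0] with r hr
  have hN : 0 < ((M.latticeBall i r).card : ℝ) := by exact_mod_cast M.card_latticeBall_pos i hr
  set s := M.latticeBall i r with hs
  set s' := s.map (Equiv.addRight m).toEmbedding with hs'
  -- Multiplication by `χ` at `m` translates the sum by `m`, so only the symmetric difference of the
  -- ball and its translate remains. This lies in a boundary layer of width `c`.
  have hsum : (χ (M.latticePoint i m) - 1) * ∑ n ∈ s, χ (M.latticePoint i n)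
      = ∑ n ∈ s' \ s, χ (M.latticePoint i n) - ∑ n ∈ s \ s', χ (M.latticePoint i n) := by
    rw [Finset.sum_sdiff_sub_sum_sdiff, hs', Finset.sum_map, sub_mul, one_mul, Finset.mul_sum]
    congr 1
    refine Finset.sum_congr rfl fun n _ => ?_
    simp [latticePoint_add, hadd, mul_comm]
  have hsub : M.latticeBall i (r - c) ⊆ s ∩ s' := by
    intro n hn
    rw [mem_latticeBall] at hn
    rw [Finset.mem_inter]
    refine ⟨?_, ?_⟩
    · rw [hs, mem_latticeBall]
      linarith [norm_nonneg (M.latticePoint i m)]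
    · rw [hs', Finset.mem_map]
      refine ⟨n - m, ?_, by simp⟩
      rw [hs, mem_latticeBall, sub_eq_add_neg, latticePoint_add, latticePoint_neg,
        ← sub_eq_add_neg]
      linarith [norm_sub_le (M.latticePoint i n) (M.latticePoint i m)]
  have hcard := Finset.card_le_card hsub
  have h1 : (s' \ s).card + (s ∩ s').card = s.card := by
    rw [Finset.inter_comm, Finset.card_sdiff_add_card_inter, hs', Finset.card_map]
  have h2 : (s \ s').card + (s ∩ s').card = s.card := Finset.card_sdiff_add_card_inter _ _
  have hle : ∀ t : Finset (Fin 2 → ℤ), ‖∑ n ∈ t, χ (M.latticePoint i n)‖ ≤ t.card := by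
    intro t
    refine (norm_sum_le _ _).trans ((Finset.sum_le_sum fun n _ => hnorm _).trans ?_)
    simp
  have hbound : a * ‖∑ n ∈ s, χ (M.latticePoint i n)‖
      ≤ 2 * ((s.card : ℝ) - (M.latticeBall i (r - c)).card) := by
    rw [ha, ← norm_mul, hsum]
    refine (norm_sub_le _ _).trans ((add_le_add (hle _) (hle _)).trans ?_)
    have h1' : ((s' \ s).card : ℝ) + (s ∩ s').card = s.card := by exact_mod_cast h1
    have h2' : ((s \ s').card : ℝ) + (s ∩ s').card = s.card := by exact_mod_cast h2
    have h3' : ((M.latticeBall i (r - c)).card : ℝ) ≤ (s ∩ s').card := by exact_mod_cast hcard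
    linarith
  rw [norm_div, Complex.norm_natCast, ← mul_div_assoc]
  refine div_le_div_of_nonneg_right ?_ hN.le
  rw [div_mul_eq_mul_div, le_div_iff₀ ha0]
  linarith

end Bilayer

/-! ### Fourier analysis on the torus -/

/-- The character `t ↦ exp(2πi n·t)` of the plane. -/
def planeWave (n : Fin 2 → ℤ) (t : Fin 2 → ℝ) : ℂ :=
  Complex.exp (2 * Real.pi * Complex.I * ((∑ k, n k * t k : ℝ) : ℂ))

theorem norm_planeWave (n : Fin 2 → ℤ) (t : Fin 2 → ℝ) : ‖planeWave n t‖ = 1 := by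
  rw [planeWave, show (2 * Real.pi * Complex.I * ((∑ k, n k * t k : ℝ) : ℂ) : ℂ)
    = ((2 * Real.pi * ∑ k, n k * t k : ℝ) : ℂ) * Complex.I by push_cast; ring,
    Complex.norm_exp_ofReal_mul_I]

theorem planeWave_add (n : Fin 2 → ℤ) (s t : Fin 2 → ℝ) :
    planeWave n (s + t) = planeWave n s * planeWave n t := by
  rw [planeWave, planeWave, planeWave, ← Complex.exp_add]
  simp only [Pi.add_apply, mul_add, Finset.sum_add_distrib, Complex.ofReal_add]

theorem planeWave_zero (t : Fin 2 → ℝ) : planeWave 0 t = 1 := by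
  simp [planeWave]

theorem continuous_planeWave (n : Fin 2 → ℤ) : Continuous (planeWave n) := by
  unfold planeWave
  fun_prop

theorem planeWave_eq_prod (n : Fin 2 → ℤ) (t : Fin 2 → ℝ) :
    planeWave n t = ∏ k, Complex.exp (2 * Real.pi * Complex.I * n k * (t k : ℂ)) := by
  rw [planeWave, ← Complex.exp_sum]
  congr 1
  push_cast
  rw [Finset.mul_sum]
  exact Finset.sum_congr rfl fun k _ => by ring

theorem mFourier_coe_eq_planeWave (n : Fin 2 → ℤ) (t : Fin 2 → ℝ) :
    UnitAddTorus.mFourier n (fun k => (t k : UnitAddCircle)) = planeWave n t := by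
  rw [planeWave_eq_prod, UnitAddTorus.mFourier, ContinuousMap.coe_mk]
  refine Finset.prod_congr rfl fun k _ => ?_
  rw [fourier_coe_apply, Complex.ofReal_one, div_one]

/-- Continuous `ℤ²`-periodic functions are uniform limits of trigonometric polynomials. -/
theorem exists_trigonometric_polynomial_near {F : (Fin 2 → ℝ) → ℂ} (hF : Continuous F)
    (hper : ∀ (t : Fin 2 → ℝ) (m : Fin 2 → ℤ), F (t + fun k => (m k : ℝ)) = F t) {ε : ℝ}
    (hε : 0 < ε) :
    ∃ c : (Fin 2 → ℤ) →₀ ℂ, ∀ t, ‖F t - c.sum fun n a => a * planeWave n t‖ < ε := by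
  set π : (Fin 2 → ℝ) → UnitAddTorus (Fin 2) := Pi.map fun _ x => (x : UnitAddCircle) with hπ
  have hquot : IsOpenQuotientMap π :=
    IsOpenQuotientMap.piMap fun _ => QuotientAddGroup.isOpenQuotientMap_mk
  -- An arbitrary section of the projection suffices: periodicity makes `F'` independent of it, and
  -- continuity descends along the quotient map.
  set F' : UnitAddTorus (Fin 2) → ℂ := fun x => F (Function.surjInv hquot.surjective x) with hF'
  have hlift : ∀ t, F' (π t) = F t := by
    intro t
    have h1 := Function.surjInv_eq hquot.surjective (π t)
    set s := Function.surjInv hquot.surjective (π t) with hs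
    have h2 : ∀ k, ∃ m : ℤ, s k = t k + m := by
      intro k
      have h3 : ((s k : ℝ) : UnitAddCircle) = (t k : ℝ) := congrFun h1 k
      obtain ⟨m, hm⟩ := (AddCircle.coe_eq_zero_iff (p := (1 : ℝ)) (x := s k - t k)).1 (by
        rw [AddCircle.coe_sub, h3, sub_self])
      refine ⟨m, ?_⟩
      rw [zsmul_eq_mul, mul_one] at hm
      rw [hm]
      ring
    choose m hm using h2
    change F s = F t
    rw [← hper t m]
    congr 1
    funext k
    exact hm k
  have hcont : Continuous F' := by
    rw [← hquot.continuous_comp_iff]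
    exact hF.congr fun t => (hlift t).symm
  have hmem : (⟨F', hcont⟩ : C(UnitAddTorus (Fin 2), ℂ)) ∈ closure
      ((Submodule.span ℂ (Set.range (UnitAddTorus.mFourier (d := Fin 2))) :
        Submodule ℂ C(UnitAddTorus (Fin 2), ℂ)) : Set C(UnitAddTorus (Fin 2), ℂ)) := by
    rw [← Submodule.topologicalClosure_coe, UnitAddTorus.span_mFourier_closure_eq_top]
    trivial
  obtain ⟨g, hg, hdist⟩ := Metric.mem_closure_iff.1 hmem ε hε
  obtain ⟨c, rfl⟩ := Finsupp.mem_span_range_iff_exists_finsupp.1 hg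
  refine ⟨c, fun t => ?_⟩
  have h4 := (ContinuousMap.dist_apply_le_dist (π t)).trans_lt hdist
  rw [dist_eq_norm] at h4
  have h5 : (c.sum fun n a => a * planeWave n t)
      = (c.sum fun n a => a • UnitAddTorus.mFourier n) (π t) := by
    simp only [Finsupp.sum, ContinuousMap.sum_apply]
    refine Finset.sum_congr rfl fun n _ => ?_
    rw [← mFourier_coe_eq_planeWave]
    rfl
  rw [h5, ← hlift t]
  exact h4

theorem setIntegral_planeWave (n : Fin 2 → ℤ) :
    ∫ t in Set.univ.pi fun _ : Fin 2 => Set.Ico (0 : ℝ) 1, planeWave n t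
      = if n = 0 then 1 else 0 := by
  have h1 : ∀ m : ℤ, ∫ t in Set.Ico (0 : ℝ) 1, Complex.exp (2 * Real.pi * Complex.I * m * (t : ℂ))
      = if m = 0 then 1 else 0 := by
    intro m
    rw [integral_Ico_eq_integral_Ioc, ← intervalIntegral.integral_of_le zero_le_one]
    split_ifs with hm
    · simp [hm]
    · have hc : (2 * Real.pi * Complex.I * m : ℂ) ≠ 0 := by
        have : (m : ℂ) ≠ 0 := by exact_mod_cast hm
        exact mul_ne_zero Complex.two_pi_I_ne_zero this
      rw [integral_exp_mul_complex hc, Complex.ofReal_one, Complex.ofReal_zero, mul_one, mul_zero,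
        Complex.exp_zero, mul_comm _ (m : ℂ), Complex.exp_int_mul_two_pi_mul_I, sub_self, zero_div]
  simp only [planeWave_eq_prod]
  rw [volume_pi, Measure.restrict_pi_pi, integral_fintype_prod_eq_prod
    (f := fun k (x : ℝ) => Complex.exp (2 * Real.pi * Complex.I * n k * (x : ℂ)))]
  simp only [h1]
  split_ifs with hn
  · simp [hn]
  · obtain ⟨k, hk⟩ := Function.ne_iff.1 hn
    exact Finset.prod_eq_zero (Finset.mem_univ k) (if_neg hk)

/-! ### Incommensurability and equidistribution -/

namespace Bilayer

variable (M : Bilayer.{u})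

theorem reciprocalLattice_add {i : Fin 2} {x y : Plane} (hx : x ∈ M.reciprocalLattice i)
    (hy : y ∈ M.reciprocalLattice i) : x + y ∈ M.reciprocalLattice i := by
  intro z hz
  obtain ⟨m, hm⟩ := hx z hz
  obtain ⟨n, hn⟩ := hy z hz
  exact ⟨m + n, by rw [inner_add_left, hm, hn, Int.cast_add]⟩

theorem reciprocalLattice_neg {i : Fin 2} {x : Plane} (hx : x ∈ M.reciprocalLattice i) :
    -x ∈ M.reciprocalLattice i := by
  intro z hz
  obtain ⟨m, hm⟩ := hx z hz
  exact ⟨-m, by rw [inner_neg_left, hm, Int.cast_neg]⟩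

variable {M}

/-- A common dual vector translates each dual lattice onto itself, hence also their union. -/
theorem eq_zero_of_mem_reciprocalLattice
    (hrec : Incommensurate (M.reciprocalLattice 0) (M.reciprocalLattice 1)) {x : Plane}
    (hx : ∀ i, x ∈ M.reciprocalLattice i) : x = 0 := by
  refine (hrec x).1 (Set.Subset.antisymm ?_ ?_)
  · rintro _ ⟨y, hy | hy, rfl⟩
    · exact Or.inl (M.reciprocalLattice_add (hx 0) hy)
    · exact Or.inr (M.reciprocalLattice_add (hx 1) hy)
  · rintro y (hy | hy)
    · exact ⟨-x + y, Or.inl (M.reciprocalLattice_add (M.reciprocalLattice_neg (hx 0)) hy), by simp⟩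
    · exact ⟨-x + y, Or.inr (M.reciprocalLattice_add (M.reciprocalLattice_neg (hx 1)) hy), by simp⟩

/-- The wave vector `x` of such a character lies in the dual lattice of the sheet `other i`. Were
the character trivial on the lattice of sheet `i`, `x` would lie in both dual lattices and vanish.
-/
theorem exists_planeWave_ne_one
    (hrec : Incommensurate (M.reciprocalLattice 0) (M.reciprocalLattice 1)) (i : Fin 2)
    {n : Fin 2 → ℤ} (hn : n ≠ 0) :
    ∃ m, planeWave n (M.coordinates (other i) (M.latticePoint i m)) ≠ 1 := by
  by_contra! h
  set x : Plane := WithLp.toLp 2 (((M.A (other i))⁻¹).transpose.mulVec fun k => (n k : ℝ)) with hx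
  have hinner : ∀ y, inner ℝ x y = ∑ k, n k * M.coordinates (other i) y k := by
    intro y
    have h1 : inner ℝ x y = ((M.A (other i))⁻¹).transpose.mulVec (fun k => (n k : ℝ))
        ⬝ᵥ WithLp.ofLp y := by
      rw [hx, PiLp.inner_apply, dotProduct]
      refine Finset.sum_congr rfl fun k _ => ?_
      simp [mul_comm]
    rw [h1, Matrix.mulVec_transpose, ← Matrix.dotProduct_mulVec]
    rfl
  have hx0 : x = 0 := by
    refine eq_zero_of_mem_reciprocalLattice hrec fun i' => ?_
    rcases eq_or_eq_other i' i with rfl | rfl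
    · rintro _ ⟨m, rfl⟩
      obtain ⟨z, hz⟩ := Complex.exp_eq_one_iff.1 (h m)
      refine ⟨z, ?_⟩
      rw [hinner]
      rw [mul_comm] at hz
      exact_mod_cast mul_right_cancel₀ Complex.two_pi_I_ne_zero hz
    · rintro _ ⟨m, rfl⟩
      refine ⟨∑ k, n k * m k, ?_⟩
      rw [hinner, ← ofCoordinates_intCast, coordinates_ofCoordinates]
      push_cast
      rfl
  refine hn (funext fun k => ?_)
  have h2 := hinner (M.ofCoordinates (other i) (Pi.single k 1))
  rw [hx0, inner_zero_left, coordinates_ofCoordinates] at h2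
  simpa [Pi.single_apply] using h2.symm

/-- The lattice of one sheet is equidistributed modulo the lattice of the other sheet. -/
theorem tendsto_average_latticeBall
    (hrec : Incommensurate (M.reciprocalLattice 0) (M.reciprocalLattice 1)) (i : Fin 2)
    {F : Plane → ℂ} (hF : Continuous F)
    (hper : ∀ x m, F (x + M.latticePoint (other i) m) = F x) :
    Tendsto (fun r : ℝ => (∑ n ∈ M.latticeBall i r, F (M.latticePoint i n))
        / ((M.latticeBall i r).card : ℂ)) atTop
      (𝓝 ((volume.real (M.cell (other i)) : ℂ)⁻¹ * ∫ x in M.cell (other i), F x)) := by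
  set Q : Set (Fin 2 → ℝ) := Set.univ.pi fun _ : Fin 2 => Set.Ico (0 : ℝ) 1 with hQ
  have hQ1 : volume.real Q = 1 := by
    rw [measureReal_def, hQ, Real.volume_pi_Ico]
    simp
  have hQfin : volume Q < ⊤ := by
    rw [hQ, Real.volume_pi_Ico]
    simp
  have hQint : ∀ f : (Fin 2 → ℝ) → ℂ, Continuous f → IntegrableOn f Q := by
    intro f hf
    refine (hf.continuousOn.integrableOn_compact
      (isCompact_univ_pi fun _ => isCompact_Icc (a := (0 : ℝ)) (b := 1))).mono_set ?_
    exact Set.pi_mono fun _ _ => Set.Ico_subset_Icc_self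
  have hdet : ((|(M.A (other i)).det| : ℝ) : ℂ) ≠ 0 := by
    exact_mod_cast (abs_pos.2 (M.det_ne_zero _)).ne'
  rw [volume_real_cell, M.setIntegral_cell _ hF, inv_mul_cancel_left₀ hdet]
  have hF' : Continuous fun t => F (M.ofCoordinates (other i) t) :=
    hF.comp (M.continuous_ofCoordinates _)
  rw [Metric.tendsto_nhds]
  intro ε hε
  obtain ⟨c, hc⟩ := exists_trigonometric_polynomial_near hF'
    (fun t m => by rw [ofCoordinates_add, ofCoordinates_intCast, hper])
    (show 0 < ε / 3 by positivity)
  set G : (Fin 2 → ℝ) → ℂ := fun t => c.sum fun n a => a * planeWave n t with hG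
  have hGcont : Continuous G :=
    continuous_finsetSum _ fun n _ => continuous_const.mul (continuous_planeWave n)
  have hGint : ∫ t in Q, G t = ∑ k ∈ c.support, c k * if k = 0 then 1 else 0 := by
    simp only [hG, Finsupp.sum]
    rw [integral_finsetSum]
    · refine Finset.sum_congr rfl fun k _ => ?_
      rw [integral_const_mul, hQ, setIntegral_planeWave]
    · exact fun k _ => hQint _ (continuous_const.mul (continuous_planeWave k))
  have hint : ‖(∫ t in Q, G t) - ∫ t in Q, F (M.ofCoordinates (other i) t)‖ ≤ ε / 3 := by
    rw [← integral_sub (hQint _ hGcont) (hQint _ hF')]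
    refine (norm_setIntegral_le_of_norm_le_const (C := ε / 3) hQfin fun t _ => ?_).trans ?_
    · rw [norm_sub_rev]
      exact (hc t).le
    · rw [hQ1, mul_one]
  -- Weyl's criterion: each mode with `k ≠ 0` averages to zero, and the constant mode gives the
  -- integral.
  have hlimG : Tendsto (fun r : ℝ => (∑ n ∈ M.latticeBall i r,
      G (M.coordinates (other i) (M.latticePoint i n))) / ((M.latticeBall i r).card : ℂ)) atTop
      (𝓝 (∫ t in Q, G t)) := by
    rw [hGint]
    have h1 : ∀ k ∈ c.support, Tendsto (fun r : ℝ => c k * ((∑ n ∈ M.latticeBall i r,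
        planeWave k (M.coordinates (other i) (M.latticePoint i n)))
          / ((M.latticeBall i r).card : ℂ))) atTop (𝓝 (c k * if k = 0 then 1 else 0)) := by
      intro k _
      refine Tendsto.const_mul _ ?_
      split_ifs with hk
      · subst hk
        refine tendsto_const_nhds.congr' ?_
        filter_upwards [eventually_gt_atTop 0] with r hr
        have hN : ((M.latticeBall i r).card : ℂ) ≠ 0 := by
          exact_mod_cast (M.card_latticeBall_pos i hr).ne'
        simp [planeWave_zero, hN]
      · obtain ⟨m, hm⟩ := exists_planeWave_ne_one hrec i hk
        refine M.tendsto_sum_character_div i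
          (χ := fun x => planeWave k (M.coordinates (other i) x)) (fun x y => ?_)
          (fun x => (norm_planeWave _ _).le) hm
        rw [← planeWave_add]
        congr 1
        rw [coordinates, WithLp.ofLp_add, Matrix.mulVec_add]
        rfl
    refine (tendsto_finsetSum _ h1).congr fun r => ?_
    simp only [hG, Finsupp.sum]
    rw [Finset.sum_comm, Finset.sum_div]
    refine Finset.sum_congr rfl fun k _ => ?_
    rw [← Finset.mul_sum, mul_div_assoc]
  filter_upwards [(Metric.tendsto_nhds.1 hlimG) (ε / 3) (by positivity), eventually_gt_atTop 0]
    with r hr hr0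
  have hN : 0 < ((M.latticeBall i r).card : ℝ) := by exact_mod_cast M.card_latticeBall_pos i hr0
  have hdiff : ‖(∑ n ∈ M.latticeBall i r, F (M.latticePoint i n)) / ((M.latticeBall i r).card : ℂ)
      - (∑ n ∈ M.latticeBall i r, G (M.coordinates (other i) (M.latticePoint i n)))
        / ((M.latticeBall i r).card : ℂ)‖ ≤ ε / 3 := by
    rw [← sub_div, ← Finset.sum_sub_distrib, norm_div, Complex.norm_natCast, div_le_iff₀ hN]
    refine (norm_sum_le _ _).trans ((Finset.sum_le_sum fun n _ => ?_).trans
      (le_of_eq (by rw [Finset.sum_const, nsmul_eq_mul, mul_comm])))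
    have := (hc (M.coordinates (other i) (M.latticePoint i n))).le
    rwa [ofCoordinates_coordinates] at this
  rw [dist_eq_norm] at hr ⊢
  have h4 := norm_add₃_le
    (a := (∑ n ∈ M.latticeBall i r, F (M.latticePoint i n)) / ((M.latticeBall i r).card : ℂ)
      - (∑ n ∈ M.latticeBall i r, G (M.coordinates (other i) (M.latticePoint i n)))
        / ((M.latticeBall i r).card : ℂ))
    (b := (∑ n ∈ M.latticeBall i r, G (M.coordinates (other i) (M.latticePoint i n)))
        / ((M.latticeBall i r).card : ℂ) - ∫ t in Q, G t)
    (c := (∫ t in Q, G t) - ∫ t in Q, F (M.ofCoordinates (other i) t))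
  rw [sub_add_sub_cancel, sub_add_sub_cancel] at h4
  linarith

end Bilayer

/-! ### Periodicity in the shift and recentring at a site -/

namespace Bilayer

variable {M : Bilayer.{u}}

/-- Shifting a sheet by one of its lattice vectors does not change the local densities of states. -/
theorem ldos_add_latticePoint (hhop : M.RegularHopping) (hherm : M.IsHermitianModel)
    (j : Fin 2) (α : M.Orb j) (b : Plane) (m : Fin 2 → ℤ)
    (f : C(M.energyInterval, ℂ)) :
    M.ldos j α (b + M.latticePoint (other j) m) f = M.ldos j α b f := by
  have hpoly : ∀ P : Polynomial ℂ,
      M.ldos j α (b + M.latticePoint (other j) m) (P.toRealContinuousMap.restrict M.energyInterval)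
        = M.ldos j α b (P.toRealContinuousMap.restrict M.energyInterval) := by
    intro P
    obtain ⟨C, hC, γ, hγ, h⟩ := hhop.exists_truncation hherm one_pos
    set L := M.latticePoint (other j) m with hL
    -- Only the shifted sheet is relabelled, so the origin of sheet `j` stays in place.
    set τ : Fin 2 → Fin 2 → ℤ := fun i => if i = j then 0 else m with hτ
    have hτj : τ j = 0 := if_pos rfl
    have hτo : τ (other j) = m := if_neg (other_ne j)
    have hle : ∀ r i, r + ‖M.latticePoint i (τ i)‖ ≤ r + ‖L‖ := by
      intro r i
      rcases eq_or_eq_other i j with rfl | rfl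
      · rw [hτj, latticePoint_zero, norm_zero]
        linarith [norm_nonneg L]
      · rw [hτo]
    have hbound : ∀ r : ℝ, 0 < r →
        ‖M.clusterLdos j α (r + ‖L‖) b P.toRealContinuousMap
          - M.clusterLdos j α r (b + L) P.toRealContinuousMap‖
        ≤ C * ((1 : ℝ) ^ 2)⁻¹ * M.supNear 1 (fun z => P.eval z)
          * Real.exp (-γ * 1 * (r - ‖b + L‖)) := by
      intro r hr
      have hr' : 0 < r + ‖L‖ := by positivity
      have horigin : M.clusterTranslation τ (hle r) (M.originSite j α hr)
          = M.originSite j α hr' := by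
        refine Subtype.ext ?_
        change (⟨j, 0 + τ j, α⟩ : M.Site) = ⟨j, 0, α⟩
        rw [hτj, add_zero]
      rw [clusterLdos_of_pos j α hr, clusterLdos_of_pos j α hr', ← horigin]
      refine h 1 one_pos le_rfl _ _ (isAnalyticWithin_polynomial (M := M) 1 P) j j r (r + ‖L‖)
        (r - ‖b + L‖) (b + L) b (M.clusterTranslation τ (hle r)) _
        (M.hamiltonian_eq_submatrix τ (hle r) (v := 0) fun i => ?_) fun x hx => ?_
      · rcases eq_or_eq_other i j with rfl | rfl
        · simp [hτj, sheetShift, (other_ne i).symm]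
        · simp [hτo, sheetShift, hL]
      · have h1 := M.le_norm_of_notMem_range_clusterTranslation τ (hle r) hx
        have h2 : M.shiftedPosition j b
            (M.clusterTranslation τ (hle r) (M.originSite j α hr)) = 0 := by
          rw [horigin, shiftedPosition_eq]
          have h3 : M.position (M.originSite j α hr') = 0 := M.latticePoint_zero j
          have h4 : sheetShift j b (M.originSite j α hr').1.1 = 0 := if_neg (other_ne j).symm
          rw [h3, h4, add_zero]
        rw [h2, sub_zero, shiftedPosition_eq]
        -- Removed sites on sheet `j` are at distance at least `r`. On the other sheet the removed
        -- sites lie outside the ball of radius `r` about `L`, hence at least `r - ‖b + L‖` from the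
        -- origin after the shift `b`.
        rcases eq_or_eq_other x.1.1 j with hx1 | hx1
        · rw [hx1, hτj, latticePoint_zero, sub_zero] at h1
          rw [hx1, sheetShift, if_neg (other_ne j).symm, zero_add]
          linarith [norm_nonneg (b + L)]
        · rw [hx1, hτo] at h1
          rw [hx1, sheetShift, if_pos rfl]
          have h5 := norm_sub_le (b + M.position x) (b + L)
          rw [add_sub_add_left_eq_sub] at h5
          linarith
    have hlim1 := (tendsto_clusterLdos hhop hherm j α b P.toRealContinuousMap).comp
      (tendsto_atTop_add_const_right atTop ‖L‖ tendsto_id)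
    have hlim2 := tendsto_clusterLdos hhop hherm j α (b + L) P.toRealContinuousMap
    have hlim3 : Tendsto (fun r : ℝ => M.clusterLdos j α (r + ‖L‖) b P.toRealContinuousMap
        - M.clusterLdos j α r (b + L) P.toRealContinuousMap) atTop (𝓝 0) := by
      refine squeeze_zero_norm' ?_ (Real.tendsto_mul_exp_neg_mul_sub
        (C * ((1 : ℝ) ^ 2)⁻¹ * M.supNear 1 fun z => P.eval z) ‖b + L‖ (γ := γ * 1) (by linarith))
      filter_upwards [eventually_gt_atTop 0] with r hr
      have := hbound r hr
      rwa [neg_mul] at this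
    have h6 := tendsto_nhds_unique hlim3 (hlim1.sub hlim2)
    exact (sub_eq_zero.1 h6.symm).symm
  refine eq_of_forall_dist_le fun ε hε => ?_
  obtain ⟨P, hP⟩ := (extendMap f).exists_polynomial_near M.energyBound (half_pos hε)
  have hfP : ∀ b', ‖M.ldos j α b' f
      - M.ldos j α b' (P.toRealContinuousMap.restrict M.energyInterval)‖ ≤ ε / 2 := by
    intro b'
    refine norm_ldos_sub_le hhop hherm j α b' fun x => ?_
    have := hP x x.2
    rwa [extendMap_apply] at this
  have h1 := hfP (b + M.latticePoint (other j) m)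
  have h2 := hfP b
  rw [hpoly] at h1
  rw [← dist_eq_norm] at h1 h2
  have h3 := dist_triangle_right (M.ldos j α (b + M.latticePoint (other j) m) f)
    (M.ldos j α b f) (M.ldos j α b (P.toRealContinuousMap.restrict M.energyInterval))
  linarith

/-- In the unshifted cluster, the diagonal entry at a site `(R, α)` is exponentially close to the
local density of states of the infinite system at the shift `-R`. -/
theorem exists_norm_matrixFunction_sub_ldos_le
    (hhop : M.RegularHopping) (hherm : M.IsHermitianModel) :
    ∃ C > (0 : ℝ), ∃ γ > (0 : ℝ), ∀ (P : Polynomial ℂ) (j : Fin 2) (r : ℝ) (k : M.Cluster r),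
      ‖matrixFunction (M.hamiltonian j r 0) P.toRealContinuousMap k k
          - M.ldos k.1.1 k.1.2.2 (-M.position k)
            (P.toRealContinuousMap.restrict M.energyInterval)‖
        ≤ C * M.supNear 1 (fun z => P.eval z) * Real.exp (-γ * (r - ‖M.position k‖)) := by
  obtain ⟨C, hC, γ, hγ, h⟩ := hhop.exists_truncation hherm one_pos
  refine ⟨C, hC, γ, hγ, fun P j r k => ?_⟩
  obtain ⟨⟨i, n, α⟩, hk⟩ := k
  have hpos : M.position ⟨i, n, α⟩ = M.latticePoint i n := rfl
  simp only [hpos]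
  rw [hpos] at hk
  set R := M.latticePoint i n with hR
  -- Translating sheet `i` by `-R` brings the site to the origin. The other sheet keeps its labels
  -- and takes up the common displacement `-R` as its shift.
  set τ : Fin 2 → Fin 2 → ℤ := fun i' => if i' = i then -n else 0 with hτ
  have hτi : τ i = -n := if_pos rfl
  have hτo : τ (other i) = 0 := if_neg (other_ne i)
  have hr : 0 < r := (norm_nonneg _).trans_lt hk
  refine le_of_tendsto ((tendsto_clusterLdos hhop hherm i α (-R)
    P.toRealContinuousMap).const_sub _).norm ?_
  filter_upwards [eventually_ge_atTop (r + ‖R‖)] with r' hr'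
  have hr'0 : 0 < r' := by linarith [norm_nonneg R]
  have hle : ∀ i', r + ‖M.latticePoint i' (τ i')‖ ≤ r' := by
    intro i'
    rcases eq_or_eq_other i' i with rfl | rfl
    · rw [hτi, latticePoint_neg, norm_neg]
      exact hr'
    · rw [hτo, latticePoint_zero, norm_zero]
      linarith [norm_nonneg R]
  have horigin : M.clusterTranslation τ hle ⟨⟨i, n, α⟩, hk⟩ = M.originSite i α hr'0 := by
    refine Subtype.ext ?_
    change (⟨i, n + τ i, α⟩ : M.Site) = ⟨i, 0, α⟩
    rw [hτi, add_neg_cancel]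
  rw [clusterLdos_of_pos i α hr'0, ← horigin, norm_sub_rev]
  have hmain := h 1 one_pos le_rfl _ _ (isAnalyticWithin_polynomial (M := M) 1 P) j i r r'
    (r - ‖R‖) 0 (-R) (M.clusterTranslation τ hle) ⟨⟨i, n, α⟩, hk⟩
    (M.hamiltonian_eq_submatrix τ hle (v := -R) fun i' => ?_) fun x hx => ?_
  · simpa using hmain
  · rcases eq_or_eq_other i' i with rfl | rfl
    · simp [hτi, sheetShift, (other_ne i').symm, latticePoint_neg, hR]
    · simp [hτo, sheetShift]
  · have h1 := M.le_norm_of_notMem_range_clusterTranslation τ hle hx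
    have h2 : M.shiftedPosition i (-R) (M.clusterTranslation τ hle ⟨⟨i, n, α⟩, hk⟩) = 0 := by
      rw [horigin, shiftedPosition_eq]
      have h3 : M.position (M.originSite i α hr'0) = 0 := M.latticePoint_zero i
      have h4 : sheetShift i (-R) (M.originSite i α hr'0).1.1 = 0 := if_neg (other_ne i).symm
      rw [h3, h4, add_zero]
    rw [h2, sub_zero, shiftedPosition_eq]
    rcases eq_or_eq_other x.1.1 i with hx1 | hx1
    · rw [hx1, hτi, latticePoint_neg, ← hR, sub_neg_eq_add] at h1
      rw [hx1, sheetShift, if_neg (other_ne i).symm, zero_add]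
      linarith [norm_add_le (M.position x) R]
    · rw [hx1, hτo, latticePoint_zero, sub_zero] at h1
      rw [hx1, sheetShift, if_pos rfl, add_comm, ← sub_eq_add_neg]
      linarith [norm_sub_norm_le (M.position x) R]

end Bilayer

/-! ### The thermodynamic limit -/

namespace Bilayer

variable {M : Bilayer.{u}}

theorem sum_cluster {β : Type*} [AddCommMonoid β] (r : ℝ) (f : M.Site → β) :
    ∑ k : M.Cluster r, f k
      = ∑ i : Fin 2, ∑ α : M.Orb i, ∑ n ∈ M.latticeBall i r, f ⟨i, n, α⟩ := by
  classical
  have h := Finset.sum_subtype (F := inferInstanceAs (Fintype (M.Cluster r)))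
    (p := fun k : M.Site => ‖M.position k‖ < r)
    (Finset.univ.sigma fun i : Fin 2 => M.latticeBall i r ×ˢ (Finset.univ : Finset (M.Orb i)))
    (fun k => by
      rw [Finset.mem_sigma, Finset.mem_product, mem_latticeBall]
      simp [position]) f
  rw [← h, Finset.sum_sigma]
  exact Finset.sum_congr rfl fun i _ => Finset.sum_product_right _ _ _

theorem card_cluster (r : ℝ) :
    (Fintype.card (M.Cluster r) : ℝ)
      = ∑ i : Fin 2, (Fintype.card (M.Orb i) : ℝ) * (M.latticeBall i r).card := by
  have h := M.sum_cluster r fun _ => (1 : ℝ)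
  simpa using h

/-- The fraction of the sites of a large cluster which carry a given orbital. -/
theorem tendsto_card_latticeBall_div_card_cluster (i : Fin 2) [Nonempty (M.Orb i)] :
    Tendsto (fun r : ℝ => ((M.latticeBall i r).card : ℝ) / Fintype.card (M.Cluster r)) atTop
      (𝓝 (M.nu * volume.real (M.cell (other i)))) := by
  set V := volume.real (Metric.ball (0 : Plane) 1) with hV
  have hV0 : 0 < V := volume_real_unitBall_pos
  have hv := M.volume_real_cell_pos
  have hi : 0 < (Fintype.card (M.Orb i) : ℝ) := by exact_mod_cast Fintype.card_pos
  set W : ℝ := ∑ i : Fin 2, (Fintype.card (M.Orb i) : ℝ) * (V / volume.real (M.cell i)) with hW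
  -- An orbital on sheet `i` is needed here: without any orbitals `W` would be zero.
  have hW0 : 0 < W := by
    refine Finset.sum_pos' (fun k _ => ?_) ⟨i, Finset.mem_univ _, ?_⟩
    · have := hv k
      positivity
    · have := hv i
      positivity
  have hden : Tendsto (fun r : ℝ => (Fintype.card (M.Cluster r) : ℝ) / r ^ 2) atTop (𝓝 W) := by
    refine (tendsto_finsetSum Finset.univ fun k _ =>
      (M.tendsto_card_latticeBall_div_sq k).const_mul (Fintype.card (M.Orb k) : ℝ)).congr
      fun r => ?_
    rw [card_cluster, Finset.sum_div]
    exact Finset.sum_congr rfl fun k _ => by ring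
  have hlim := (M.tendsto_card_latticeBall_div_sq i).div hden hW0.ne'
  -- The area `V` of the unit disc cancels, and clearing the two cell areas leaves `ν` times the
  -- area of the other cell.
  have heq : V / volume.real (M.cell i) / W = M.nu * volume.real (M.cell (other i)) := by
    have h0 := (hv 0).ne'
    have h1 := (hv 1).ne'
    have hW' : W = V * (Fintype.card (M.Orb 1) * volume.real (M.cell 0)
        + Fintype.card (M.Orb 0) * volume.real (M.cell 1))
        / (volume.real (M.cell 0) * volume.real (M.cell 1)) := by
      rw [hW, Fin.sum_univ_two]
      field_simp
      ring
    rw [hW', nu]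
    rcases eq_or_eq_other i 0 with rfl | rfl
    · rw [show other 0 = 1 from rfl]
      field_simp
    · rw [other_other, show other 0 = 1 from rfl]
      field_simp
  rw [heq] at hlim
  refine hlim.congr' ?_
  filter_upwards [eventually_gt_atTop 0] with r hr
  rw [Pi.div_apply, div_div_div_cancel_right₀ (by positivity)]

/-- Averages over large balls of a lattice of bounded quantities which are small away from the
boundary. -/
theorem tendsto_sum_div_card_zero (i : Fin 2) {a : ℝ → (Fin 2 → ℤ) → ℂ} {B : ℝ}
    (hB : ∀ r, ∀ n ∈ M.latticeBall i r, ‖a r n‖ ≤ B)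
    (hsmall : ∀ ε > 0, ∃ c : ℝ, ∀ r, ∀ n ∈ M.latticeBall i r,
      ‖M.latticePoint i n‖ < r - c → ‖a r n‖ ≤ ε) :
    Tendsto (fun r : ℝ => (∑ n ∈ M.latticeBall i r, a r n) / ((M.latticeBall i r).card : ℂ)) atTop
      (𝓝 0) := by
  have hB0 : 0 ≤ B := (norm_nonneg _).trans (hB 1 0 (by simp [mem_latticeBall]))
  rw [Metric.tendsto_nhds]
  intro ε hε
  obtain ⟨c', hc'⟩ := hsmall (ε / 2) (half_pos hε)
  -- A non-negative width keeps the smaller ball inside the larger one.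
  set c := max c' 0 with hc
  have hlim := (M.tendsto_card_latticeBall_sub_div i c).const_mul B
  rw [mul_zero] at hlim
  filter_upwards [hlim.eventually (gt_mem_nhds (half_pos hε)), eventually_gt_atTop 0] with r hr hr0
  have hN : 0 < ((M.latticeBall i r).card : ℝ) := by exact_mod_cast M.card_latticeBall_pos i hr0
  have hsub : M.latticeBall i (r - c) ⊆ M.latticeBall i r :=
    M.latticeBall_mono i (by linarith [le_max_right c' 0])
  rw [dist_zero_right, norm_div, Complex.norm_natCast, div_lt_iff₀ hN]
  have h1 : ‖∑ n ∈ M.latticeBall i (r - c), a r n‖ ≤ (M.latticeBall i r).card * (ε / 2) := by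
    refine (norm_sum_le _ _).trans ((Finset.sum_le_sum fun n hn => hc' r n (hsub hn) ?_).trans ?_)
    · rw [mem_latticeBall] at hn
      linarith [le_max_left c' 0]
    · rw [Finset.sum_const, nsmul_eq_mul]
      have : ((M.latticeBall i (r - c)).card : ℝ) ≤ (M.latticeBall i r).card := by
        exact_mod_cast Finset.card_le_card hsub
      gcongr
  have h2 : ‖∑ n ∈ M.latticeBall i r \ M.latticeBall i (r - c), a r n‖
      ≤ B * (((M.latticeBall i r).card : ℝ) - (M.latticeBall i (r - c)).card) := by
    refine (norm_sum_le _ _).trans ((Finset.sum_le_sum fun n hn =>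
      hB r n (Finset.mem_sdiff.1 hn).1).trans (le_of_eq ?_))
    rw [Finset.sum_const, nsmul_eq_mul, Finset.cast_card_sdiff hsub, mul_comm]
  rw [← mul_div_assoc, div_lt_iff₀ hN] at hr
  rw [← Finset.sum_sdiff hsub]
  refine (norm_add_le _ _).trans_lt ?_
  linarith

theorem norm_matrixFunction_diag_le {n : Type*} [Fintype n] [DecidableEq n]
    {B : Matrix n n ℂ} (hB : B.IsHermitian) {E : ℝ}
    (hE : ‖Matrix.toEuclideanCLM (𝕜 := ℂ) B‖ ≤ E) {g : ℝ → ℂ} {ε : ℝ}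
    (h : ∀ x ∈ Set.Icc (-E) E, ‖g x‖ ≤ ε) (k : n) : ‖matrixFunction B g k k‖ ≤ ε := by
  have h0 := matrixFunction_diag_smul hB 0 g k
  rw [zero_smul, zero_mul] at h0
  have h1 := norm_matrixFunction_diag_sub_le hB hE (g := g) (g' := 0) (ε := ε)
    (fun x hx => by simpa using h x hx) k
  rwa [h0, sub_zero] at h1

/-- Deep inside an unshifted cluster, the diagonal entries are close to the local densities of
states of the infinite system. -/
theorem exists_norm_matrixFunction_sub_ldos_le_of_lt (hhop : M.RegularHopping) (hherm : M.IsHermitianModel)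
    (g : C(ℝ, ℂ)) {ε : ℝ} (hε : 0 < ε) :
    ∃ c : ℝ, ∀ (j : Fin 2) (r : ℝ) (k : M.Cluster r), ‖M.position k‖ < r - c →
      ‖matrixFunction (M.hamiltonian j r 0) g k k
        - M.ldos k.1.1 k.1.2.2 (-M.position k) (g.restrict M.energyInterval)‖ ≤ ε := by
  obtain ⟨P, hP⟩ := g.exists_polynomial_near M.energyBound (show 0 < ε / 3 by positivity)
  obtain ⟨C, hC, γ, hγ, h⟩ := exists_norm_matrixFunction_sub_ldos_le hhop hherm
  have hlim := Real.tendsto_mul_exp_neg_mul_sub (C * M.supNear 1 fun z => P.eval z) 0 hγ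
  obtain ⟨c, hc⟩ := (hlim.eventually (gt_mem_nhds (show 0 < ε / 3 by positivity))).exists
  rw [sub_zero] at hc
  refine ⟨c, fun j r k hk => ?_⟩
  have h1 := norm_matrixFunction_diag_sub_le (hherm j r 0) (hhop.norm_hamiltonian_le j r 0) hP k
  have h2 := norm_ldos_sub_le hhop hherm k.1.1 k.1.2.2 (-M.position k)
    (f := P.toRealContinuousMap.restrict M.energyInterval) (f' := g.restrict M.energyInterval)
    (ε := ε / 3) fun x => by
      rw [norm_sub_rev]
      exact hP x x.2
  have h3 : ‖matrixFunction (M.hamiltonian j r 0) P.toRealContinuousMap k k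
      - M.ldos k.1.1 k.1.2.2 (-M.position k)
        (P.toRealContinuousMap.restrict M.energyInterval)‖ ≤ ε / 3 := by
    refine (h P j r k).trans (le_trans ?_ hc.le)
    have hS := supNear_nonneg (M := M) 1 fun z => P.eval z
    refine mul_le_mul_of_nonneg_left (Real.exp_le_exp.2 ?_) (by positivity)
    nlinarith
  have h4 := norm_add₃_le
    (a := matrixFunction (M.hamiltonian j r 0) g k k
      - matrixFunction (M.hamiltonian j r 0) P.toRealContinuousMap k k)
    (b := matrixFunction (M.hamiltonian j r 0) P.toRealContinuousMap k k
      - M.ldos k.1.1 k.1.2.2 (-M.position k) (P.toRealContinuousMap.restrict M.energyInterval))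
    (c := M.ldos k.1.1 k.1.2.2 (-M.position k) (P.toRealContinuousMap.restrict M.energyInterval)
      - M.ldos k.1.1 k.1.2.2 (-M.position k) (g.restrict M.energyInterval))
  rw [sub_add_sub_cancel, sub_add_sub_cancel] at h4
  linarith

/-- The diagonal entry of `g(H_{r,j}(0))` at a site, and zero at the sites outside of the cluster. -/
def clusterDiagonal (M : Bilayer.{u}) (j : Fin 2) (g : ℝ → ℂ) (r : ℝ) (k : M.Site) : ℂ :=
  if h : ‖M.position k‖ < r then matrixFunction (M.hamiltonian j r 0) g ⟨k, h⟩ ⟨k, h⟩ else 0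

/-- Away from a boundary layer of fixed width the entry at `R` is close to the local density at
shift `-R`, a continuous function periodic under the other lattice. Equidistribution applies once
the symmetry of the ball has turned `-R` into `R`. -/
theorem tendsto_average_clusterDiagonal (hhop : M.RegularHopping) (hherm : M.IsHermitianModel)
    (hrec : Incommensurate (M.reciprocalLattice 0) (M.reciprocalLattice 1)) (j i : Fin 2)
    (α : M.Orb i) (g : C(ℝ, ℂ)) :
    Tendsto (fun r : ℝ => (∑ n ∈ M.latticeBall i r, M.clusterDiagonal j g r ⟨i, n, α⟩)
        / ((M.latticeBall i r).card : ℂ)) atTop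
      (𝓝 ((volume.real (M.cell (other i)) : ℂ)⁻¹ *
        ∫ b in M.cell (other i), M.ldos i α b (g.restrict M.energyInterval))) := by
  set f := g.restrict M.energyInterval with hf
  have hdiag : ∀ (r : ℝ) (n : Fin 2 → ℤ) (h : ‖M.latticePoint i n‖ < r),
      M.clusterDiagonal j g r ⟨i, n, α⟩
        = matrixFunction (M.hamiltonian j r 0) g ⟨⟨i, n, α⟩, h⟩ ⟨⟨i, n, α⟩, h⟩ :=
    fun r n h => dif_pos h
  have h1 : Tendsto (fun r : ℝ => (∑ n ∈ M.latticeBall i r,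
      (M.clusterDiagonal j g r ⟨i, n, α⟩ - M.ldos i α (-M.latticePoint i n) f))
        / ((M.latticeBall i r).card : ℂ)) atTop (𝓝 0) := by
    refine tendsto_sum_div_card_zero i (B := ‖f‖ + ‖f‖) (fun r n hn => ?_) fun ε hε => ?_
    · rw [mem_latticeBall] at hn
      rw [hdiag r n hn]
      refine (norm_sub_le _ _).trans (add_le_add ?_ (norm_ldos_le hhop hherm i α _ f))
      exact norm_matrixFunction_diag_le (hherm j r 0) (hhop.norm_hamiltonian_le j r 0)
        (fun x hx => f.norm_coe_le_norm ⟨x, hx⟩) _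
    · obtain ⟨c, hc⟩ := exists_norm_matrixFunction_sub_ldos_le_of_lt hhop hherm g hε
      refine ⟨c, fun r n hn hnc => ?_⟩
      rw [mem_latticeBall] at hn
      rw [hdiag r n hn]
      exact hc j r ⟨⟨i, n, α⟩, hn⟩ hnc
  have h2 := tendsto_average_latticeBall hrec i (continuous_ldos hhop hherm i α f)
    fun x m => ldos_add_latticePoint hhop hherm i α x m f
  have h3 := h1.add h2
  rw [zero_add] at h3
  refine h3.congr fun r => ?_
  have h4 : ∑ n ∈ M.latticeBall i r, M.ldos i α (-M.latticePoint i n) f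
      = ∑ n ∈ M.latticeBall i r, M.ldos i α (M.latticePoint i n) f := by
    refine Finset.sum_equiv (Equiv.neg _) (fun n => ?_) fun n _ => ?_
    · simp [mem_latticeBall, latticePoint_neg]
    · simp [latticePoint_neg]
  rw [Finset.sum_sub_distrib, h4, ← add_div, sub_add_cancel]

/-- The thermodynamic limit of the density of states. -/
theorem tendsto_dos (hhop : M.RegularHopping) (hherm : M.IsHermitianModel)
    (hrec : Incommensurate (M.reciprocalLattice 0) (M.reciprocalLattice 1))
    (j : Fin 2) (g : C(ℝ, ℂ)) :
    Tendsto (fun r : ℝ => dos (M.hamiltonian j r 0) g) atTop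
      (𝓝 (dosLimit hhop hherm (g.restrict M.energyInterval))) := by
  set f := g.restrict M.energyInterval with hf
  have hterm : ∀ (i : Fin 2) (α : M.Orb i), Tendsto (fun r : ℝ =>
      ((((M.latticeBall i r).card : ℝ) / Fintype.card (M.Cluster r) : ℝ) : ℂ)
        * ((∑ n ∈ M.latticeBall i r, M.clusterDiagonal j g r ⟨i, n, α⟩)
          / ((M.latticeBall i r).card : ℂ))) atTop
      (𝓝 ((M.nu : ℂ) * ∫ b in M.cell (other i), M.ldos i α b f)) := by
    intro i α
    have : Nonempty (M.Orb i) := ⟨α⟩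
    have h1 := (Complex.continuous_ofReal.tendsto _).comp
      (tendsto_card_latticeBall_div_card_cluster (M := M) i)
    have h2 := h1.mul (tendsto_average_clusterDiagonal hhop hherm hrec j i α g)
    have hv : (volume.real (M.cell (other i)) : ℂ) ≠ 0 := by
      exact_mod_cast (M.volume_real_cell_pos (other i)).ne'
    -- The proportion of sites carrying `α` contains the cell area by which the cell average
    -- divides, so exactly `ν` remains.
    rw [Complex.ofReal_mul, mul_assoc, mul_inv_cancel_left₀ hv] at h2
    exact h2
  have hsum := tendsto_finsetSum Finset.univ fun i _ =>
    tendsto_finsetSum Finset.univ fun α _ => hterm i α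
  rw [dosLimit_apply]
  simp only [Finset.mul_sum]
  refine hsum.congr' ?_
  filter_upwards [eventually_gt_atTop 0] with r hr
  have htrace : (matrixFunction (M.hamiltonian j r 0) g).trace
      = ∑ i : Fin 2, ∑ α : M.Orb i, ∑ n ∈ M.latticeBall i r,
        M.clusterDiagonal j g r ⟨i, n, α⟩ := by
    rw [← sum_cluster, Matrix.trace]
    refine Finset.sum_congr rfl fun k _ => ?_
    rw [clusterDiagonal, dif_pos k.2, Matrix.diag_apply]
  rw [dos, htrace]
  simp only [Finset.mul_sum]
  refine Finset.sum_congr rfl fun i _ => Finset.sum_congr rfl fun α _ => ?_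
  rw [← Finset.mul_sum]
  have hN : ((M.latticeBall i r).card : ℂ) ≠ 0 := by
    exact_mod_cast (M.card_latticeBall_pos i hr).ne'
  push_cast
  field_simp

end Bilayer

end

theorem theorem2p3 (M : Bilayer.{u}) (hherm : M.IsHermitianModel)
    (hinc : Incommensurate (M.lattice 0) (M.lattice 1))
    (hrec : Incommensurate (M.reciprocalLattice 0) (M.reciprocalLattice 1))
    (hhop : M.RegularHopping) :
    -- `E[H]` is finite, the local densities of states exist and are integrable over the unit cells
    BddAbove M.hamiltonianNorms ∧
    (∀ (j : Fin 2) (α : M.Orb j) (b : Plane) (g : C(ℝ, ℂ)),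
      Tendsto (fun r : ℝ => M.clusterLdos j α r b g) atTop
        (𝓝 (M.ldos j α b (g.restrict M.energyInterval)))) ∧
    (∀ (j : Fin 2) (α : M.Orb j) (f : C(M.energyInterval, ℂ)),
      IntegrableOn (fun b => M.ldos j α b f) (M.cell (Bilayer.other j)) volume) ∧
    (∀ (j : Fin 2) (α : M.Orb j) (g : C(ℝ, ℂ)) (r : ℝ),
      IntegrableOn (fun b => M.clusterLdos j α r b g) (M.cell (Bilayer.other j)) volume) ∧
    ∃ D : C(M.energyInterval, ℂ) →L[ℂ] ℂ,
      -- the thermodynamic limit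
      (∀ g ∈ M.analyticClass, ∀ j : Fin 2,
        Tendsto (fun r : ℝ => Bilayer.dos (M.hamiltonian j r 0) g) atTop
          (𝓝 (D (g.restrict M.energyInterval)))) ∧
      -- the representation formula
      (∀ f : C(M.energyInterval, ℂ),
        D f = (M.nu : ℂ) * ∑ j : Fin 2, ∑ α : M.Orb j,
          ∫ b in M.cell (Bilayer.other j), M.ldos j α b f) ∧
      -- the truncation error
      ∀ d₀ > (0 : ℝ), ∃ C > (0 : ℝ), ∃ γ > (0 : ℝ),
        ∀ (d : ℝ), 0 < d → d ≤ d₀ →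
          ∀ (g : C(ℝ, ℂ)) (G : ℂ → ℂ), M.IsAnalyticWithin d g G → ∀ r : ℝ, 0 < r →
            ‖D (g.restrict M.energyInterval) - (M.nu : ℂ) * ∑ j : Fin 2, ∑ α : M.Orb j,
              ∫ b in M.cell (Bilayer.other j), M.clusterLdos j α r b g‖
              ≤ C * (d ^ 2)⁻¹ * M.supNear d G * Real.exp (-γ * d * r) := by
  refine ⟨hhop.bddAbove_hamiltonianNorms,
    fun j α b g => Bilayer.tendsto_clusterLdos hhop hherm j α b g,
    fun j α f => M.integrableOn_cell _ (Bilayer.continuous_ldos hhop hherm j α f),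
    fun j α g r => M.integrableOn_cell _ (Bilayer.continuous_clusterLdos hhop hherm j α r g),
    Bilayer.dosLimit hhop hherm,
    fun g _ j => Bilayer.tendsto_dos hhop hherm hrec j g,
    fun f => Bilayer.dosLimit_apply hhop hherm f, fun d₀ hd₀ => ?_⟩
  obtain ⟨C, hC, γ, hγ, h⟩ := Bilayer.exists_norm_dosLimit_sub_le hhop hherm hd₀
  exact ⟨C, hC, γ, hγ, fun d hd hdd g G hG r hr => h d hd hdd g G hG r hr⟩
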